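/- Let $n\ge 1$, $\gamma\ge 0$, and let $|\cdot|$ be the Euclidean norm on $\mathbb R^n$. **Kernel.** Let $g:\mathbb R^n\times\mathbb R^n\to[0,+\infty]$ be symmetric and lower semicontinuous, and such that - for every $\epsilon>0$ there is $\delta>0$ such that $g(u,x)\le\epsilon|u-x|^{-n}$ whenever $|u-x|\le\delta$; - there are $p>1$ and real numbers $c_k\ge0$ with $c_k\to0$ as $k\to\infty$ such that, for every integer $k\ge 1$, $g=g_k+g^k$, where $g_k$ is real-valued and continuous with $g_k\le k$, $g^k\ge 0$, $\int g^k(u,x)^p\,dx\le c_k$ for all $u\in\mathbb R^n$, and $g_k(x,u)\to0$ as $|x|\to\infty$ for every $u\in\mathbb R^n$. **Potential.** Let $V:\mathbb R^n\to[0,+\infty)$ be continuous, $C^2$ outside a compact set, with $e^{-V}\in L^1(\mathbb R^n)$. Let $\mu_0$ be the probability measure proportional to $e^{-V(x)}dx$. **Equilibrium measure.** Assume that the free energy $$\mathscr F_\gamma(\mu)=\frac\gamma2\iint g(x,z)\,\mu(dx)\mu(dz)+\mathrm H(\mu\,|\,\mu_0)$$ ($\mathrm H$ being the relative entropy) has a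 unique minimizer $\mu_\gamma$ among the probability measures on $\mathbb R^n$. Put $U(x)=\int g(x,z)\,\mu_\gamma(dz)$ and $\mathrm L_\gamma=\int e^{-\gamma U(x)-V(x)}dx$, the normalization constant in $\mu_\gamma(dx)=\mathrm L_\gamma^{-1}e^{-\gamma U(x)-V(x)}dx$. **Gibbs measure.** Let $\beta=\beta_N>0$ with $\beta_N N\to\gamma$ as $N\to\infty$, and let $\mathbb P_N$ be the probability measure on $(\mathbb R^n)^N$ with density proportional to $$\exp\Big(-\beta_N\sum_{1\le i<j\le N}g(x_i,x_j)-\sum_{j=1}^N V(x_j)\Big).$$ **Zooming.** Let $E_N\in\mathbb R^n$ with $|E_N|\to\infty$ and, for all large $N$, $\nabla V(E_N)=\alpha_N\upsilon_N$ with $\alpha_N>0$ and $|\upsilon_N|=1$. Suppose that as $N\to\infty$ $$\frac{N e^{-V(E_N)}}{\mathrm L_\gamma\,\alpha_N^n}\to1,\qquad \upsilon_N\to\upsilon,\qquad \alpha_N|E_N|\to+\infty .$$ Let $\psi:\mathbb R^n\to\mathbb R^n$ be a $C^1$ diffeomorphism with Jacobian $|\det D\psi|=1$ everywhere, let $\varphi_N(x)=E_N+\alpha_N^{-1}\psi(x)$,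 and suppose that for every compact set $\mathscr K\subset\mathbb R^n$ $$\alpha_N^{-2}\,\sup_{x\in\mathscr K}\big\|\nabla^2V(\varphi_N(x))\big\|\to0\qquad(N\to\infty).$$ **Conclusion.** Under $\mathbb P_N$, the point process $\Xi_N=\sum_{j=1}^N\delta_{\varphi_N^{-1}(x_j)}$ converges in distribution as $N\to\infty$ to a Poisson point process $\Xi$ on $\mathbb R^n$ with intensity $\theta(x)=e^{-\upsilon\cdot\psi(x)}$ with respect to Lebesgue measure. That is, $\mathbb E_N[e^{-\Xi_N(f)}]\to\mathbb E[e^{-\Xi(f)}]$ for every continuous compactly supported $f:\mathbb R^n\to[0,+\infty)$, where $\Xi$ is a point process with $\mathbb E[e^{-\Xi(f)}]=\exp\big(\int(e^{-f(x)}-1)\,\theta(x)\,dx\big)$ for all Borel $f:\mathbb R^n\to[0,+\infty)$. -/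

import Mathlib

open MeasureTheory Filter Topology
open scoped ENNReal NNReal Manifold RealInnerProductSpace

noncomputable section

namespace MeanFieldGas

/-- `e^{-a}` for `a ∈ [0,+∞]`, with `e^{-∞} = 0`. -/
def expNeg (a : ℝ≥0∞) : ℝ≥0∞ := EReal.exp (-(a : EReal))

/-! ### Interaction kernels -/

/-- Symmetric, lower semicontinuous kernels `g : ℝⁿ × ℝⁿ → [0,+∞]` which are `o(dist⁻ⁿ)` near the
diagonal and which split, for every `k ≥ 1`, as `g = gₖ + gᵏ`, where `gₖ ≤ k` is continuous and
tends to `0` at infinity in its first variable, while `gᵏ ≥ 0` is small in `Lᵖ`, for some fixed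
`p > 1`. -/
structure IsDecayingKernel {n : ℕ}
    (g : EuclideanSpace ℝ (Fin n) → EuclideanSpace ℝ (Fin n) → ℝ≥0∞) : Prop where
  symm : ∀ u x, g u x = g x u
  lsc : LowerSemicontinuous
    (fun q : EuclideanSpace ℝ (Fin n) × EuclideanSpace ℝ (Fin n) => g q.1 q.2)
  near_diag : ∀ ε : ℝ, 0 < ε → ∃ δ : ℝ, 0 < δ ∧ ∀ u x, dist u x ≤ δ →
    g u x ≤ ENNReal.ofReal ε * (edist u x ^ n)⁻¹
  decomp : ∃ (gLow : ℕ → EuclideanSpace ℝ (Fin n) → EuclideanSpace ℝ (Fin n) → ℝ)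
      (gUp : ℕ → EuclideanSpace ℝ (Fin n) → EuclideanSpace ℝ (Fin n) → ℝ≥0∞)
      (p : ℝ) (c : ℕ → ℝ≥0),
    1 < p ∧ Tendsto c atTop (𝓝 0) ∧ ∀ k : ℕ, 1 ≤ k →
      (∀ u x, (g u x : EReal) = (gLow k u x : EReal) + (gUp k u x : EReal)) ∧
      Continuous (fun q : EuclideanSpace ℝ (Fin n) × EuclideanSpace ℝ (Fin n) =>
        gLow k q.1 q.2) ∧
      (∀ u x, gLow k u x ≤ k) ∧
      (∀ u, ∫⁻ x, gUp k u x ^ p ≤ c k) ∧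
      (∀ u, Tendsto (fun x => gLow k x u) (cocompact (EuclideanSpace ℝ (Fin n))) (𝓝 0))

/-! ### The Gibbs measure -/

/-- The energy `H_N(x) = β ∑_{i<j} g(x_i, x_j) + ∑_j V(x_j)`; used for `β ≥ 0` and `V ≥ 0`. -/
def hamiltonian {n : ℕ} (g : EuclideanSpace ℝ (Fin n) → EuclideanSpace ℝ (Fin n) → ℝ≥0∞)
    (V : EuclideanSpace ℝ (Fin n) → ℝ) (β : ℝ) (N : ℕ)
    (x : Fin N → EuclideanSpace ℝ (Fin n)) : ℝ≥0∞ :=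
  ENNReal.ofReal β * (∑ i : Fin N, ∑ j ∈ Finset.Ioi i, g (x i) (x j)) +
    ∑ j : Fin N, ENNReal.ofReal (V (x j))

/-- The partition function `Z_N`. -/
def partitionFunction {n : ℕ}
    (g : EuclideanSpace ℝ (Fin n) → EuclideanSpace ℝ (Fin n) → ℝ≥0∞)
    (V : EuclideanSpace ℝ (Fin n) → ℝ) (β : ℝ) (N : ℕ) : ℝ≥0∞ :=
  ∫⁻ x : Fin N → EuclideanSpace ℝ (Fin n), expNeg (hamiltonian g V β N x)

/-- The Gibbs measure `P_N(dx) = Z_N⁻¹ e^{-H_N(x)} dx` on `(ℝⁿ)^N`. -/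
def gibbs {n : ℕ} (g : EuclideanSpace ℝ (Fin n) → EuclideanSpace ℝ (Fin n) → ℝ≥0∞)
    (V : EuclideanSpace ℝ (Fin n) → ℝ) (β : ℝ) (N : ℕ) :
    Measure (Fin N → EuclideanSpace ℝ (Fin n)) :=
  (partitionFunction g V β N)⁻¹ • volume.withDensity (fun x => expNeg (hamiltonian g V β N x))

/-! ### Free energy and equilibrium measure -/

/-- The potential `U^μ(x) = ∫ g(x,z) μ(dz)`. -/
def potential {n : ℕ} (g : EuclideanSpace ℝ (Fin n) → EuclideanSpace ℝ (Fin n) → ℝ≥0∞)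
    (μ : Measure (EuclideanSpace ℝ (Fin n))) (x : EuclideanSpace ℝ (Fin n)) : ℝ≥0∞ :=
  ∫⁻ z, g x z ∂μ

/-- The free energy `(γ/2) ∬ g dμ dμ + H(μ | μ₀)`, where `μ₀` is the probability measure
proportional to `e^{-V(x)} dx` and `H` is the relative entropy. -/
def freeEnergy {n : ℕ} (γ : ℝ)
    (g : EuclideanSpace ℝ (Fin n) → EuclideanSpace ℝ (Fin n) → ℝ≥0∞)
    (V : EuclideanSpace ℝ (Fin n) → ℝ) (μ : Measure (EuclideanSpace ℝ (Fin n))) : ℝ≥0∞ :=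
  ENNReal.ofReal (γ / 2) * ∫⁻ x, potential g μ x ∂μ +
    InformationTheory.klDiv μ (volume.tilted (fun x => -V x))

/-- `μ` is the unique minimizer of the free energy among all probability measures. -/
def IsUniqueMinimizer {n : ℕ} (γ : ℝ)
    (g : EuclideanSpace ℝ (Fin n) → EuclideanSpace ℝ (Fin n) → ℝ≥0∞)
    (V : EuclideanSpace ℝ (Fin n) → ℝ) (μ : ProbabilityMeasure (EuclideanSpace ℝ (Fin n))) :
    Prop :=
  (∀ ν : ProbabilityMeasure (EuclideanSpace ℝ (Fin n)),
    freeEnergy γ g V (μ : Measure _) ≤ freeEnergy γ g V (ν : Measure _)) ∧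
  ∀ μ' : ProbabilityMeasure (EuclideanSpace ℝ (Fin n)),
    (∀ ν : ProbabilityMeasure (EuclideanSpace ℝ (Fin n)),
      freeEnergy γ g V (μ' : Measure _) ≤ freeEnergy γ g V (ν : Measure _)) → μ' = μ

/-- The constant `L = ∫ e^{-γ U^μ(x) - V(x)} dx`, that is, the normalization in the equation
`μ(dx) = L⁻¹ e^{-γ U^μ(x) - V(x)} dx` of the equilibrium measure `μ`. -/
def normConst {n : ℕ} (γ : ℝ)
    (g : EuclideanSpace ℝ (Fin n) → EuclideanSpace ℝ (Fin n) → ℝ≥0∞)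
    (V : EuclideanSpace ℝ (Fin n) → ℝ) (μ : Measure (EuclideanSpace ℝ (Fin n))) : ℝ :=
  (∫⁻ x, expNeg (ENNReal.ofReal γ * potential g μ x + ENNReal.ofReal (V x))).toReal

/-! ### Point processes -/

/-- A point process: a random locally finite sum of point masses (counted with multiplicity). -/
structure IsPointProcess {n : ℕ} {Ω : Type*} [MeasurableSpace Ω] (P : Measure Ω)
    (Ξ : Ω → Measure (EuclideanSpace ℝ (Fin n))) : Prop where
  isProbabilityMeasure : IsProbabilityMeasure P
  measurable : Measurable Ξ
  point : ∀ᵐ ω ∂P, ∃ (s : Set ℕ) (a : ℕ → EuclideanSpace ℝ (Fin n)),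
    Ξ ω = Measure.sum (fun i : s => Measure.dirac (a i))
  locallyFinite : ∀ᵐ ω ∂P, ∀ K : Set (EuclideanSpace ℝ (Fin n)), IsCompact K → Ξ ω K < ∞

/-- The Laplace functional `E[e^{-Ξ(f)}]`. -/
def laplace {n : ℕ} {Ω : Type*} [MeasurableSpace Ω] (P : Measure Ω)
    (Ξ : Ω → Measure (EuclideanSpace ℝ (Fin n))) (f : EuclideanSpace ℝ (Fin n) → ℝ≥0) : ℝ≥0∞ :=
  ∫⁻ ω, expNeg (∫⁻ x, (f x : ℝ≥0∞) ∂(Ξ ω)) ∂P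

/-- `Ξ` is a Poisson point process with intensity measure `θ`: its Laplace functional is
`exp (∫ (e^{-f} - 1) dθ) = exp (- ∫ (1 - e^{-f}) dθ)`. -/
structure IsPoissonProcess {n : ℕ} {Ω : Type*} [MeasurableSpace Ω] (P : Measure Ω)
    (Ξ : Ω → Measure (EuclideanSpace ℝ (Fin n))) (θ : Measure (EuclideanSpace ℝ (Fin n))) :
    Prop extends IsPointProcess P Ξ where
  laplace_eq : ∀ f : EuclideanSpace ℝ (Fin n) → ℝ≥0, Measurable f →
    laplace P Ξ f = expNeg (∫⁻ x, (1 - expNeg (f x : ℝ≥0∞)) ∂θ)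

/-- Convergence in distribution of point processes: convergence of the Laplace functionals on
nonnegative continuous functions with compact support. -/
def ConvergesInDistribution {n : ℕ} {Ω : ℕ → Type*} [∀ N, MeasurableSpace (Ω N)]
    (P : ∀ N, Measure (Ω N)) (Ξ : ∀ N, Ω N → Measure (EuclideanSpace ℝ (Fin n)))
    {Ω' : Type*} [MeasurableSpace Ω'] (P' : Measure Ω')
    (Ξ' : Ω' → Measure (EuclideanSpace ℝ (Fin n))) : Prop :=
  ∀ f : EuclideanSpace ℝ (Fin n) → ℝ≥0, Continuous f → HasCompactSupport f →
    Tendsto (fun N => laplace (P N) (Ξ N) f) atTop (𝓝 (laplace P' Ξ' f))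

/-! ### Zooming around a point -/

/-- The map `φ(x) = e + a⁻¹ ψ(x)`. -/
def zoom {n : ℕ} (e : EuclideanSpace ℝ (Fin n)) (a : ℝ)
    (ψ : EuclideanSpace ℝ (Fin n) → EuclideanSpace ℝ (Fin n)) (x : EuclideanSpace ℝ (Fin n)) :
    EuclideanSpace ℝ (Fin n) :=
  e + a⁻¹ • ψ x

/-- The inverse `φ⁻¹(y) = ψ⁻¹(a (y - e))` of `zoom e a ψ`, in terms of `ψinv = ψ⁻¹`. -/
def zoomInv {n : ℕ} (e : EuclideanSpace ℝ (Fin n)) (a : ℝ)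
    (ψinv : EuclideanSpace ℝ (Fin n) → EuclideanSpace ℝ (Fin n))
    (y : EuclideanSpace ℝ (Fin n)) : EuclideanSpace ℝ (Fin n) :=
  ψinv (a • (y - e))

theorem zoomInv_zoom {n : ℕ} (e : EuclideanSpace ℝ (Fin n)) {a : ℝ} (ha : 0 < a)
    (ψ : EuclideanSpace ℝ (Fin n) ≃ EuclideanSpace ℝ (Fin n)) (x : EuclideanSpace ℝ (Fin n)) :
    zoomInv e a ψ.symm (zoom e a ψ x) = x := by
  simp [zoom, zoomInv, smul_smul, ha.ne']

theorem zoom_zoomInv {n : ℕ} (e : EuclideanSpace ℝ (Fin n)) {a : ℝ} (ha : 0 < a)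
    (ψ : EuclideanSpace ℝ (Fin n) ≃ EuclideanSpace ℝ (Fin n)) (y : EuclideanSpace ℝ (Fin n)) :
    zoom e a ψ (zoomInv e a ψ.symm y) = y := by
  simp [zoom, zoomInv, smul_smul, ha.ne']

/-- The zoomed configuration `Ξ(x) = ∑_j δ_{φ⁻¹(x_j)}`. -/
def zoomedProcess {n : ℕ} (e : EuclideanSpace ℝ (Fin n)) (a : ℝ)
    (ψinv : EuclideanSpace ℝ (Fin n) → EuclideanSpace ℝ (Fin n)) (N : ℕ)
    (x : Fin N → EuclideanSpace ℝ (Fin n)) : Measure (EuclideanSpace ℝ (Fin n)) :=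
  ∑ j : Fin N, Measure.dirac (zoomInv e a ψinv (x j))

end MeanFieldGas

end

open MeanFieldGas

namespace MeanFieldGas

/-! ### The function `a ↦ e^{-a}` on `[0,+∞]` -/

/-! Take the probability measure `m` proportional to `e^{-V}` as reference (`gibbs_eq_gasProb`), and
let `h` be `1 - e^{-f}` composed with the inverse zoom. The Laplace functional for `N + 1` particles
is `A(1)`, where `A(t) = E_{N+1} ∏ (1 - t h(x_j))`. Differentiate in `t` and remove the marked
particle: with `κ = Z_N / Z_{N+1}` and `w_y = exp(-b ∑ g(y, x_j))`, one gets `-A'(t) = κ (N+1) ∫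
h(y) E_N[w_y ∏ (1 - t h(x_j))] m(dy)`. The support of `h` escapes to infinity, where the kernel
decays and `w_y ≈ 1`, so this is about `κ T E_N ∏ (1 - t h(x_j))` with `T = (N+1) ∫ h dm`. Removing
a particle from `A(t)` itself shows that the last expectation is about `A(t)`, because `w_y` is
close to the deterministic `l(y) = e^{-γ U(y)}` and `κ ∫ l dm ≈ 1`. Hence `A' ≈ -κ T A` and `A(1) ≈
e^{-κ T}`. This comparison is quantitative for fixed `N` (`abs_integral_prod_sub_exp_le`); its limit
is `tendsto_integral_gasProb_prod`.

Two facts about the gas feed the comparison. The first is a density bound: Jensen's inequality gives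
`Z_{N+1} ≥ e^{-bNG} Z_N`, where `G` bounds `∫ g(y, ·) dm`, so the one-particle marginals are at most
`C m` with `C` independent of `N` (`lintegral_gasProb_eval_le`). It yields tightness, makes `w_y`
close to `1` at infinity, and allows parts of `g` that are small in `L¹(m)` to be discarded. The
second is the law of large numbers `tendsto_lintegral_gasProb_abs_sub`. It comes from a large
deviation upper bound: the probability of being near a non-minimizer is bounded by an exponential
Chebyshev inequality with a Donsker–Varadhan test function and a truncated energy, and the partition
function is bounded below with the trial measure `μ^{⊗N}`. Approximating `g` from below by bounded
continuous kernels then gives the convergence of `w_y` (`tendsto_lintegral_gasProb_abs_expNeg_sub`).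

The intensity comes from Taylor's formula: on the scale `α_N⁻¹` around `E_N` the potential is affine
up to `o(1)`, so `N ∫ e^{-V} h` tends to `L_γ` times the integral of `1 - e^{-f}` against `e^{-υ·ψ}`
(`tendsto_integral_zoom`). The factor `L_γ` is cancelled by the limit of `κ`. The limiting process
is constructed in `exists_isPoissonProcess`. -/

theorem expNeg_coe (a : ℝ≥0) : expNeg a = ENNReal.ofReal (Real.exp (-(a : ℝ))) := by
  have : (-((a : ℝ≥0∞) : EReal)) = ((-(a : ℝ) : ℝ) : EReal) := rfl
  rw [expNeg, this, EReal.exp_coe]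

theorem expNeg_ofReal {a : ℝ} (ha : 0 ≤ a) :
    expNeg (ENNReal.ofReal a) = ENNReal.ofReal (Real.exp (-a)) := by
  rw [ENNReal.ofReal, expNeg_coe, Real.coe_toNNReal a ha]

@[simp] theorem expNeg_zero : expNeg 0 = 1 := by simpa using expNeg_coe 0

@[simp] theorem expNeg_top : expNeg ⊤ = 0 := by simp [expNeg]

theorem expNeg_antitone : Antitone expNeg := fun a b h => by
  unfold expNeg
  exact EReal.exp_monotone (EReal.neg_le_neg_iff.2 (by exact_mod_cast h))

@[fun_prop] theorem measurable_expNeg : Measurable expNeg := expNeg_antitone.measurable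

theorem expNeg_le_one (a : ℝ≥0∞) : expNeg a ≤ 1 := by
  simpa using expNeg_antitone (zero_le (a := a))

theorem expNeg_ne_top (a : ℝ≥0∞) : expNeg a ≠ ∞ :=
  ne_top_of_le_ne_top ENNReal.one_ne_top (expNeg_le_one a)

theorem expNeg_add (a b : ℝ≥0∞) : expNeg (a + b) = expNeg a * expNeg b := by
  induction a with
  | top => simp
  | coe a =>
    induction b with
    | top => simp
    | coe b =>
      rw [← ENNReal.coe_add, expNeg_coe, expNeg_coe, expNeg_coe,
        ← ENNReal.ofReal_mul (Real.exp_nonneg _), ← Real.exp_add]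
      push_cast
      ring_nf

theorem expNeg_sum {ι : Type*} (s : Finset ι) (f : ι → ℝ≥0∞) :
    expNeg (∑ i ∈ s, f i) = ∏ i ∈ s, expNeg (f i) := by
  classical
  induction s using Finset.induction_on with
  | empty => simp
  | insert a s ha ih => rw [Finset.sum_insert ha, Finset.prod_insert ha, expNeg_add, ih]

theorem expNeg_pos {a : ℝ≥0∞} (ha : a ≠ ∞) : 0 < expNeg a := by
  lift a to ℝ≥0 using ha
  rw [expNeg_coe]
  exact ENNReal.ofReal_pos.2 (Real.exp_pos _)

theorem toReal_expNeg {a : ℝ≥0∞} (ha : a ≠ ∞) : (expNeg a).toReal = Real.exp (-a.toReal) := by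
  lift a to ℝ≥0 using ha
  rw [expNeg_coe, ENNReal.toReal_ofReal (Real.exp_nonneg _), ENNReal.coe_toReal]

/-- Multiply `1 ≤ e^{-b} + b` by `e^{-a} ≤ 1`. This is the 1-Lipschitz property of `e^{-a}` in a
form that survives the value `+∞`. -/
theorem expNeg_le_add (a b : ℝ≥0∞) : expNeg a ≤ expNeg (a + b) + b := by
  induction b with
  | top => simp
  | coe b =>
    rw [expNeg_add]
    have h1 : (1 : ℝ≥0∞) ≤ expNeg b + b := by
      rw [expNeg_coe, ← ENNReal.ofReal_one, ← ENNReal.ofReal_coe_nnreal,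
        ← ENNReal.ofReal_add (Real.exp_nonneg _) b.coe_nonneg]
      refine ENNReal.ofReal_le_ofReal ?_
      have := Real.add_one_le_exp (-(b : ℝ))
      linarith
    calc expNeg a = expNeg a * 1 := (mul_one _).symm
      _ ≤ expNeg a * (expNeg b + b) := by gcongr
      _ = expNeg a * expNeg b + expNeg a * b := mul_add _ _ _
      _ ≤ expNeg a * expNeg b + 1 * b := by gcongr; exact expNeg_le_one a
      _ = _ := by rw [one_mul]

theorem one_sub_expNeg_le (a : ℝ≥0∞) : 1 - expNeg a ≤ a := by
  have := expNeg_le_add 0 a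
  simpa [tsub_le_iff_left, add_comm] using this

theorem continuous_expNeg : Continuous expNeg := by
  unfold expNeg
  exact EReal.expHomeomorph.continuous.comp (continuous_neg.comp continuous_coe_ennreal_ereal)

/-! ### Pair energies and the mean-field gas -/

section Gas

variable {X : Type*}

/-- The pair energy `∑_{i<j} g(x_i, x_j)`. -/
noncomputable def pairEnergy (g : X → X → ℝ≥0∞) {N : ℕ} (x : Fin N → X) : ℝ≥0∞ :=
  ∑ i : Fin N, ∑ j ∈ Finset.Ioi i, g (x i) (x j)

/-- Doubling replaces the sum over `i < j` by a sum over all off-diagonal pairs, which no longer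
depends on the order of the labels. -/
theorem two_mul_pairEnergy {g : X → X → ℝ≥0∞} (hg : ∀ u x, g u x = g x u) {N : ℕ}
    (x : Fin N → X) :
    2 * pairEnergy g x = ∑ i, ∑ j, if i = j then 0 else g (x i) (x j) := by
  have h1 : pairEnergy g x = ∑ i, ∑ j, if i < j then g (x i) (x j) else 0 := by
    refine Finset.sum_congr rfl fun i _ => ?_
    rw [← Finset.sum_filter]
    refine Finset.sum_congr ?_ fun _ _ => rfl
    ext j; simp
  have h2 : pairEnergy g x = ∑ i, ∑ j, if j < i then g (x i) (x j) else 0 := by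
    rw [h1, Finset.sum_comm]
    refine Finset.sum_congr rfl fun i _ => Finset.sum_congr rfl fun j _ => ?_
    rw [hg]
  rw [two_mul]
  nth_rewrite 1 [h1]
  rw [h2, ← Finset.sum_add_distrib]
  refine Finset.sum_congr rfl fun i _ => ?_
  rw [← Finset.sum_add_distrib]
  refine Finset.sum_congr rfl fun j _ => ?_
  rcases lt_trichotomy i j with h | h | h
  · simp [h, h.ne, h.not_gt]
  · simp [h]
  · simp [h, h.ne', h.not_gt]

/-- In the doubled energy, row `i` and column `i` each contribute `∑ g(y, x_j)`. Any particle can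
thus be split off, not only the first, which the derivative of the Laplace functional requires. -/
theorem pairEnergy_insertNth {g : X → X → ℝ≥0∞} (hg : ∀ u x, g u x = g x u) {N : ℕ}
    (i : Fin (N + 1)) (y : X) (x : Fin N → X) :
    pairEnergy g (i.insertNth y x : Fin (N + 1) → X) = ∑ j, g y (x j) + pairEnergy g x := by
  have h : 2 * pairEnergy g (i.insertNth y x : Fin (N + 1) → X)
      = 2 * (∑ j, g y (x j) + pairEnergy g x) := by
    rw [mul_add, two_mul_pairEnergy hg, two_mul_pairEnergy hg, Fin.sum_univ_succAbove _ i,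
      Fin.sum_univ_succAbove _ i]
    simp only [if_true, Fin.insertNth_apply_same, Fin.insertNth_apply_succAbove, zero_add,
      Fin.ne_succAbove, if_false]
    have h1 : ∀ j : Fin N, (∑ k, if i.succAbove j = k then 0 else
        g (x j) ((i.insertNth y x : Fin (N + 1) → X) k)) = g y (x j) +
        ∑ k, if j = k then 0 else g (x j) (x k) := fun j => by
      rw [Fin.sum_univ_succAbove _ i]
      simp only [Fin.succAbove_ne, if_false, Fin.insertNth_apply_same,
        Fin.insertNth_apply_succAbove, Fin.succAbove_right_inj]
      rw [hg]
    simp_rw [h1, Finset.sum_add_distrib]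
    rw [two_mul, add_assoc]
  exact (ENNReal.mul_right_inj (by simp) (by simp)).1 h

variable [MeasurableSpace X]

@[fun_prop] theorem measurable_pairEnergy {g : X → X → ℝ≥0∞}
    (hg : Measurable (Function.uncurry g)) {N : ℕ} :
    Measurable (pairEnergy g : (Fin N → X) → ℝ≥0∞) := by
  unfold pairEnergy
  refine Finset.measurable_sum _ fun i _ => Finset.measurable_sum _ fun j _ => ?_
  exact hg.comp (f := fun x : Fin N → X => (x i, x j))
    ((measurable_pi_apply i).prodMk (measurable_pi_apply j))

theorem measurable_sum_kernel {g : X → X → ℝ≥0∞} (hg : Measurable (Function.uncurry g)) {N : ℕ} :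
    Measurable fun q : X × (Fin N → X) => ∑ j, g q.1 (q.2 j) := by
  refine Finset.measurable_sum _ fun j _ => ?_
  exact hg.comp (measurable_fst.prodMk ((measurable_pi_apply j).comp measurable_snd))

/-- The unnormalized Gibbs measure `e^{-b ∑_{i<j} g(x_i,x_j)} m^{⊗ N}(dx)`. -/
noncomputable def gas (m : Measure X) (g : X → X → ℝ≥0∞) (b : ℝ≥0) (N : ℕ) : Measure (Fin N → X) :=
  (Measure.pi fun _ => m).withDensity fun x => expNeg (b * pairEnergy g x)

theorem lintegral_pi_succ (m : Measure X) [SigmaFinite m] {N : ℕ} (i : Fin (N + 1))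
    {F : (Fin (N + 1) → X) → ℝ≥0∞} (hF : Measurable F) :
    ∫⁻ x, F x ∂(Measure.pi fun _ => m) =
      ∫⁻ y, ∫⁻ x, F (i.insertNth y x : Fin (N + 1) → X) ∂(Measure.pi fun _ => m) ∂m := by
  have h := (measurePreserving_piFinSuccAbove (fun _ : Fin (N + 1) => m) i).symm
  rw [← h.lintegral_comp hF]
  exact lintegral_prod _ (hF.comp h.measurable).aemeasurable

theorem measurable_insertNth {N : ℕ} (i : Fin (N + 1)) :
    Measurable fun q : X × (Fin N → X) => (i.insertNth q.1 q.2 : Fin (N + 1) → X) :=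
  (MeasurableEquiv.piFinSuccAbove (fun _ : Fin (N + 1) => X) i).symm.measurable

theorem measurable_insertNth_right {N : ℕ} (i : Fin (N + 1)) (y : X) :
    Measurable fun x : (Fin N → X) => (i.insertNth y x : Fin (N + 1) → X) :=
  (measurable_insertNth i).comp (measurable_const.prodMk measurable_id)

theorem lintegral_gas (m : Measure X) {g : X → X → ℝ≥0∞} (hg : Measurable (Function.uncurry g))
    (b : ℝ≥0) {N : ℕ} {F : (Fin N → X) → ℝ≥0∞} (hF : Measurable F) :
    ∫⁻ x, F x ∂(gas m g b N) =
      ∫⁻ x, F x * expNeg (b * pairEnergy g x) ∂(Measure.pi fun _ => m) := by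
  have := measurable_pairEnergy hg (N := N)
  rw [gas, lintegral_withDensity_eq_lintegral_mul _ (by fun_prop) hF]
  simp_rw [Pi.mul_apply, mul_comm]

/-- The parameter `b` is the same on both sides: systems of `N + 1` and `N` particles are always
compared at equal inverse temperature. -/
theorem lintegral_gas_succ (m : Measure X) [SigmaFinite m] {g : X → X → ℝ≥0∞}
    (hgm : Measurable (Function.uncurry g)) (hg : ∀ u x, g u x = g x u) (b : ℝ≥0) {N : ℕ}
    (i : Fin (N + 1)) {F : (Fin (N + 1) → X) → ℝ≥0∞} (hF : Measurable F) :
    ∫⁻ x, F x ∂(gas m g b (N + 1)) =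
      ∫⁻ y, ∫⁻ x, F (i.insertNth y x : Fin (N + 1) → X) * expNeg (b * ∑ j, g y (x j))
        ∂(gas m g b N) ∂m := by
  have h1 := measurable_pairEnergy hgm (N := N)
  have h2 := measurable_pairEnergy hgm (N := N + 1)
  rw [lintegral_gas m hgm b hF, lintegral_pi_succ m i (by fun_prop)]
  refine lintegral_congr fun y => ?_
  have h3 : Measurable fun x : Fin N → X => ∑ j, g y (x j) :=
    (measurable_sum_kernel hgm).comp (measurable_const.prodMk measurable_id)
  have h4 : Measurable fun x : Fin N → X => F (i.insertNth y x : Fin (N + 1) → X) :=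
    hF.comp (measurable_insertNth_right i y)
  have h5 : Measurable fun x : Fin N → X => expNeg (b * ∑ j, g y (x j)) :=
    measurable_expNeg.comp (h3.const_mul _)
  rw [lintegral_gas m hgm b (h4.fun_mul h5)]
  refine lintegral_congr fun x => ?_
  rw [pairEnergy_insertNth hg, mul_add, expNeg_add, mul_assoc]

end Gas

end MeanFieldGas

namespace MeanFieldGas

open InformationTheory

/-! ### Variational lower bounds for the partition function and bounds on one-particle marginals -/

section Variational

variable {X : Type*} [MeasurableSpace X]

theorem ofReal_integral_le_lintegral {μ : Measure X} {h : X → ℝ} (hh : Integrable h μ) :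
    ENNReal.ofReal (∫ x, h x ∂μ) ≤ ∫⁻ x, ENNReal.ofReal (h x) ∂μ := by
  have h1 : ∫ x, h x ∂μ ≤ ∫ x, max (h x) 0 ∂μ :=
    integral_mono hh hh.pos_part fun x => le_max_left _ _
  refine (ENNReal.ofReal_le_ofReal h1).trans ?_
  rw [ofReal_integral_eq_lintegral_ofReal hh.pos_part (ae_of_all _ fun x => le_max_right _ _)]
  simp

/-- The Gibbs variational inequality. -/
theorem expNeg_lintegral_add_klDiv_le (m P : Measure X) [IsProbabilityMeasure m]
    [IsProbabilityMeasure P] {S : X → ℝ≥0∞} (hS : Measurable S) :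
    expNeg (∫⁻ x, S x ∂P + klDiv P m) ≤ ∫⁻ x, expNeg (S x) ∂m := by
  by_cases hk : klDiv P m = ∞
  · simp [hk]
  by_cases hs : ∫⁻ x, S x ∂P = ∞
  · simp [hs]
  obtain ⟨hac, hint⟩ := klDiv_ne_top_iff.1 hk
  have hSint : Integrable (fun x => (S x).toReal) P :=
    integrable_toReal_of_lintegral_ne_top hS.aemeasurable hs
  set φ := P.rnDeriv m with hφ
  have hφm : Measurable φ := Measure.measurable_rnDeriv _ _
  have hP : m.withDensity φ = P := Measure.withDensity_rnDeriv_eq _ _ hac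
  set s := ∫ x, (S x).toReal ∂P with hsdef
  set k := ∫ x, llr P m x ∂P with hkdef
  have hs0 : ∫⁻ x, S x ∂P = ENNReal.ofReal s := by
    rw [hsdef, integral_toReal hS.aemeasurable (ae_lt_top hS hs), ENNReal.ofReal_toReal hs]
  have hk0 : klDiv P m = ENNReal.ofReal k := by
    rw [klDiv_of_ac_of_integrable hac hint]; simp [hkdef]
  have hk1 : 0 ≤ k := by
    have := integral_llr_add_sub_measure_univ_nonneg hac hint
    simpa [hkdef] using this
  have hs1 : 0 ≤ s := integral_nonneg fun _ => ENNReal.toReal_nonneg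
  -- Change of measure from `m` to `P`; only an inequality, since `m` may charge `{φ = 0}`.
  have h1 : ∫⁻ x, expNeg (S x) * (φ x)⁻¹ ∂P ≤ ∫⁻ x, expNeg (S x) ∂m := by
    conv_lhs => rw [← hP]
    rw [lintegral_withDensity_eq_lintegral_mul _ hφm (by fun_prop)]
    refine lintegral_mono fun x => ?_
    calc φ x * (expNeg (S x) * (φ x)⁻¹) = expNeg (S x) * (φ x * (φ x)⁻¹) := by ring
      _ ≤ expNeg (S x) * 1 := by gcongr; exact ENNReal.mul_inv_le_one _
      _ = _ := mul_one _
  refine le_trans ?_ h1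
  -- Jensen by hand: the tangent line of the exponential at the mean `s + k` of `S + llr`. Its
  -- integral under `P` is exactly `e^{-(s+k)}`.
  have h2 : ∀ᵐ x ∂P, ENNReal.ofReal (Real.exp (-(s + k)) *
      (1 + (s + k) - (S x).toReal - llr P m x)) ≤ expNeg (S x) * (φ x)⁻¹ := by
    have hpos : ∀ᵐ x ∂P, 0 < φ x := Measure.rnDeriv_pos hac
    have hfin : ∀ᵐ x ∂P, φ x < ∞ := hac.ae_le (Measure.rnDeriv_lt_top P m)
    filter_upwards [hpos, hfin, ae_lt_top hS hs] with x hx1 hx2 hx3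
    have hr : 0 < (φ x).toReal := ENNReal.toReal_pos hx1.ne' hx2.ne
    have e1 : expNeg (S x) * (φ x)⁻¹
        = ENNReal.ofReal (Real.exp (-((S x).toReal + llr P m x))) := by
      rw [← ENNReal.ofReal_toReal (expNeg_ne_top (S x)), toReal_expNeg hx3.ne,
        ← ENNReal.ofReal_toReal hx2.ne, ← ENNReal.ofReal_inv_of_pos hr,
        ← ENNReal.ofReal_mul (Real.exp_nonneg _), neg_add, Real.exp_add, Real.exp_neg (llr P m x),
        llr_def, Real.exp_log hr]
    rw [e1]
    refine ENNReal.ofReal_le_ofReal ?_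
    have := Real.add_one_le_exp (s + k - ((S x).toReal + llr P m x))
    calc Real.exp (-(s + k)) * (1 + (s + k) - (S x).toReal - llr P m x)
        ≤ Real.exp (-(s + k)) * Real.exp (s + k - ((S x).toReal + llr P m x)) := by
          gcongr; linarith
      _ = _ := by rw [← Real.exp_add]; ring_nf
  refine le_trans ?_ (lintegral_mono_ae h2)
  refine le_trans ?_ (ofReal_integral_le_lintegral
    ((((integrable_const _).sub hSint).sub hint).const_mul _))
  have h3 : Integrable (fun x => 1 + (s + k) - (S x).toReal) P := (integrable_const _).sub hSint
  rw [hs0, hk0, ← ENNReal.ofReal_add hs1 hk1, expNeg_ofReal (by positivity),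
    integral_const_mul, integral_sub h3 hint,
    integral_sub (integrable_const _) hSint]
  refine ENNReal.ofReal_le_ofReal (le_of_eq ?_)
  simp only [integral_const, probReal_univ, one_smul]
  rw [← hsdef, ← hkdef]
  ring

theorem expNeg_lintegral_le (m : Measure X) [IsProbabilityMeasure m] {S : X → ℝ≥0∞}
    (hS : Measurable S) : expNeg (∫⁻ x, S x ∂m) ≤ ∫⁻ x, expNeg (S x) ∂m := by
  simpa using expNeg_lintegral_add_klDiv_le m m hS

/-- The particles are integrated out one at a time: the one-particle inequality is applied to the
average of `S` over the others, with their entropy cost `N * klDiv P m` added as a constant. The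
entropy of a product measure is never computed. -/
theorem expNeg_lintegral_pi_add_klDiv_le (m P : Measure X) [IsProbabilityMeasure m]
    [IsProbabilityMeasure P] (N : ℕ) {S : (Fin N → X) → ℝ≥0∞} (hS : Measurable S) :
    expNeg (∫⁻ x, S x ∂(Measure.pi fun _ => P) + N * klDiv P m) ≤
      ∫⁻ x, expNeg (S x) ∂(Measure.pi fun _ => m) := by
  induction N with
  | zero =>
    rw [Measure.pi_of_empty, Measure.pi_of_empty, lintegral_dirac' _ hS,
      lintegral_dirac' _ (by fun_prop)]
    simp
  | succ N ih =>
    have hS' : Measurable fun q : X × (Fin N → X) => S ((0 : Fin (N + 1)).insertNth q.1 q.2) :=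
      hS.comp (measurable_insertNth 0)
    rw [lintegral_pi_succ m 0 (by fun_prop), lintegral_pi_succ P 0 hS]
    have h1 : Measurable fun y => ∫⁻ x, S ((0 : Fin (N + 1)).insertNth y x)
        ∂(Measure.pi fun _ : Fin N => P) := hS'.lintegral_prod_right'
    calc expNeg (∫⁻ y, ∫⁻ x, S ((0 : Fin (N + 1)).insertNth y x)
            ∂(Measure.pi fun _ => P) ∂P + (N + 1 : ℕ) * klDiv P m)
        = expNeg (∫⁻ y, (∫⁻ x, S ((0 : Fin (N + 1)).insertNth y x)
            ∂(Measure.pi fun _ => P) + N * klDiv P m) ∂P + klDiv P m) := by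
          rw [lintegral_add_right _ measurable_const]
          simp only [lintegral_const, measure_univ, mul_one]
          push_cast
          ring_nf
      _ ≤ ∫⁻ y, expNeg (∫⁻ x, S ((0 : Fin (N + 1)).insertNth y x)
            ∂(Measure.pi fun _ => P) + N * klDiv P m) ∂m :=
          expNeg_lintegral_add_klDiv_le m P (h1.add_const _)
      _ ≤ _ := lintegral_mono fun y => ih (hS.comp (measurable_insertNth_right 0 y))

theorem measurable_kernel_left {g : X → X → ℝ≥0∞} (hgm : Measurable (Function.uncurry g)) (y : X) :
    Measurable (g y) := hgm.comp (measurable_const.prodMk measurable_id)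

theorem lintegral_pi_eval (P : Measure X) [IsProbabilityMeasure P] {N : ℕ} (i : Fin N)
    {f : X → ℝ≥0∞} (hf : Measurable f) :
    ∫⁻ x, f (x i) ∂(Measure.pi fun _ : Fin N => P) = ∫⁻ z, f z ∂P :=
  (measurePreserving_eval (fun _ : Fin N => P) i).lintegral_comp hf

theorem lintegral_pairEnergy (P : Measure X) [IsProbabilityMeasure P] {g : X → X → ℝ≥0∞}
    (hgm : Measurable (Function.uncurry g)) (hg : ∀ u x, g u x = g x u) (N : ℕ) :
    ∫⁻ x, pairEnergy g x ∂(Measure.pi fun _ : Fin N => P) =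
      N.choose 2 * ∫⁻ y, ∫⁻ z, g y z ∂P ∂P := by
  induction N with
  | zero => simp [pairEnergy]
  | succ N ih =>
    have h0 := measurable_pairEnergy hgm (N := N)
    rw [lintegral_pi_succ P 0 (measurable_pairEnergy hgm)]
    simp_rw [pairEnergy_insertNth hg]
    have h1 : ∀ y, ∫⁻ x, (∑ j, g y (x j) + pairEnergy g x) ∂(Measure.pi fun _ : Fin N => P)
        = N * ∫⁻ z, g y z ∂P + N.choose 2 * ∫⁻ y, ∫⁻ z, g y z ∂P ∂P := fun y => by
      have h2 : ∀ j ∈ Finset.univ, Measurable fun x : Fin N → X => g y (x j) := fun j _ =>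
        (measurable_kernel_left hgm y).comp (measurable_pi_apply j)
      rw [lintegral_add_right _ h0, ih, lintegral_finsetSum _ h2]
      simp [lintegral_pi_eval P _ (measurable_kernel_left hgm y)]
    simp_rw [h1]
    have h2 : Measurable fun y => ∫⁻ z, g y z ∂P := hgm.lintegral_prod_right'
    rw [lintegral_add_right _ measurable_const, lintegral_const_mul _ h2]
    simp only [lintegral_const, measure_univ, mul_one]
    rw [Nat.choose_succ_succ' N 1]
    push_cast
    simp only [Nat.choose_one_right]
    ring

instance isFiniteMeasure_gas (m : Measure X) [IsProbabilityMeasure m] (g : X → X → ℝ≥0∞)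
    (b : ℝ≥0) (N : ℕ) : IsFiniteMeasure (gas m g b N) := by
  refine isFiniteMeasure_withDensity (ne_top_of_le_ne_top ENNReal.one_ne_top ?_)
  calc ∫⁻ x, expNeg (b * pairEnergy g x) ∂(Measure.pi fun _ : Fin N => m)
      ≤ ∫⁻ _, 1 ∂(Measure.pi fun _ : Fin N => m) := lintegral_mono fun x => expNeg_le_one _
    _ = 1 := by simp

/-- The product `P^{⊗N}` serves as trial measure. With `P` the equilibrium measure this is the sharp
lower bound used in the law of large numbers. -/
theorem le_gas_univ (m P : Measure X) [IsProbabilityMeasure m] [IsProbabilityMeasure P]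
    {g : X → X → ℝ≥0∞} (hgm : Measurable (Function.uncurry g)) (hg : ∀ u x, g u x = g x u)
    (b : ℝ≥0) (N : ℕ) :
    expNeg (b * (N.choose 2 * ∫⁻ y, ∫⁻ z, g y z ∂P ∂P) + N * klDiv P m) ≤
      gas m g b N Set.univ := by
  have h0 := measurable_pairEnergy hgm (N := N)
  rw [gas, withDensity_apply _ MeasurableSet.univ, setLIntegral_univ,
    ← lintegral_pairEnergy P hgm hg, ← lintegral_const_mul _ h0]
  exact expNeg_lintegral_pi_add_klDiv_le m P N (by fun_prop)

theorem gas_succ_univ (m : Measure X) [IsProbabilityMeasure m]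
    {g : X → X → ℝ≥0∞} (hgm : Measurable (Function.uncurry g)) (hg : ∀ u x, g u x = g x u)
    (b : ℝ≥0) (N : ℕ) :
    gas m g b (N + 1) Set.univ =
      ∫⁻ y, ∫⁻ x, expNeg (b * ∑ j, g y (x j)) ∂(gas m g b N) ∂m := by
  have := lintegral_gas_succ m hgm hg b (0 : Fin (N + 1)) (F := fun _ => 1) measurable_const
  simpa using this

/-- Freeze `N` particles and apply Jensen to the position of the new one, drawn from `m`. By
symmetry of `g` its mean interaction with each frozen particle is at most `G`. -/
theorem mul_gas_univ_le_gas_succ_univ (m : Measure X) [IsProbabilityMeasure m]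
    {g : X → X → ℝ≥0∞} (hgm : Measurable (Function.uncurry g)) (hg : ∀ u x, g u x = g x u)
    {G : ℝ≥0∞} (hG : ∀ y, ∫⁻ x, g y x ∂m ≤ G) (b : ℝ≥0) (N : ℕ) :
    expNeg (b * (N * G)) * gas m g b N Set.univ ≤ gas m g b (N + 1) Set.univ := by
  have h1 : Measurable fun q : X × (Fin N → X) => expNeg (b * ∑ j, g q.1 (q.2 j)) :=
    measurable_expNeg.comp ((measurable_sum_kernel hgm).const_mul _)
  rw [gas_succ_univ m hgm hg, lintegral_lintegral_swap h1.aemeasurable]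
  calc expNeg (b * (N * G)) * gas m g b N Set.univ
      = ∫⁻ _, expNeg (b * (N * G)) ∂(gas m g b N) := by simp
    _ ≤ _ := lintegral_mono fun x => ?_
  have h2 : Measurable fun y => ∑ j, g y (x j) :=
    (measurable_sum_kernel hgm).comp (measurable_id.prodMk measurable_const)
  refine le_trans (expNeg_antitone ?_) (expNeg_lintegral_le m (h2.const_mul _))
  rw [lintegral_const_mul _ h2]
  gcongr
  have h3 : ∀ j ∈ Finset.univ, Measurable fun y => g y (x j) := fun j _ =>
    hgm.comp (measurable_id.prodMk measurable_const)
  rw [lintegral_finsetSum _ h3]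
  calc ∑ j, ∫⁻ y, g y (x j) ∂m ≤ ∑ _j : Fin N, G := by
        refine Finset.sum_le_sum fun j _ => ?_
        simp_rw [hg _ (x j)]
        exact hG _
    _ = N * G := by simp

theorem gas_univ_pos (m : Measure X) [IsProbabilityMeasure m]
    {g : X → X → ℝ≥0∞} (hgm : Measurable (Function.uncurry g)) (hg : ∀ u x, g u x = g x u)
    {G : ℝ≥0∞} (hGt : G ≠ ∞) (hG : ∀ y, ∫⁻ x, g y x ∂m ≤ G) (b : ℝ≥0) (N : ℕ) :
    0 < gas m g b N Set.univ := by
  induction N with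
  | zero =>
    rw [gas, withDensity_apply _ MeasurableSet.univ, setLIntegral_univ]
    simp [pairEnergy]
  | succ N ih =>
    refine lt_of_lt_of_le (ENNReal.mul_pos (expNeg_pos ?_).ne' ih.ne')
      (mul_gas_univ_le_gas_succ_univ m hgm hg hG b N)
    exact ENNReal.mul_ne_top (by simp) (ENNReal.mul_ne_top (by simp) hGt)

/-- Dropping the interaction of particle `i` with the others bounds its density against `m` by a
ratio of consecutive partition functions, which `mul_gas_univ_le_gas_succ_univ` controls. -/
theorem lintegral_gas_eval_le (m : Measure X) [IsProbabilityMeasure m]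
    {g : X → X → ℝ≥0∞} (hgm : Measurable (Function.uncurry g)) (hg : ∀ u x, g u x = g x u)
    {G : ℝ≥0∞} (hG : ∀ y, ∫⁻ x, g y x ∂m ≤ G) (b : ℝ≥0) {N : ℕ} (i : Fin N)
    {F : X → ℝ≥0∞} (hF : Measurable F) :
    expNeg (b * (N * G)) * ∫⁻ x, F (x i) ∂(gas m g b N) ≤
      (∫⁻ z, F z ∂m) * gas m g b N Set.univ := by
  cases N with
  | zero => exact i.elim0
  | succ N =>
    have h1 : Measurable fun x : Fin (N + 1) → X => F (x i) := hF.comp (measurable_pi_apply i)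
    rw [lintegral_gas_succ m hgm hg b i h1]
    simp only [Fin.insertNth_apply_same]
    calc expNeg (b * ((N + 1 : ℕ) * G)) *
          ∫⁻ y, ∫⁻ x, F y * expNeg (b * ∑ j, g y (x j)) ∂(gas m g b N) ∂m
        ≤ expNeg (b * (N * G)) * ∫⁻ y, ∫⁻ x, F y ∂(gas m g b N) ∂m := by
          gcongr with y x
          · refine expNeg_antitone ?_
            gcongr
            simp
          · calc F y * expNeg (b * ∑ j, g y (x j)) ≤ F y * 1 := by
                  gcongr; exact expNeg_le_one _
              _ = F y := mul_one _
      _ = (∫⁻ z, F z ∂m) * (expNeg (b * (N * G)) * gas m g b N Set.univ) := by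
          simp only [lintegral_const]
          rw [lintegral_mul_const _ hF]
          ring
      _ ≤ _ := by
          gcongr
          exact mul_gas_univ_le_gas_succ_univ m hgm hg hG b N

end Variational

end MeanFieldGas

namespace MeanFieldGas

open InformationTheory
open scoped BoundedContinuousFunction

/-! ### Relative entropy as a supremum over bounded continuous test functions -/

section DonskerVaradhan

variable {X : Type*} [MeasurableSpace X]

/-- With `s` the clamp of `φ` to `[t⁻¹, t]`, the expression is `klFun s + (φ - s) log s`. Where the
clamp acts, `φ - s` and `log s` have the same sign, since `t⁻¹ ≤ 1 ≤ t`. Nonnegativity is what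
Fatou's lemma needs. -/
theorem mul_log_clamp_nonneg {φ t : ℝ} (ht : 1 ≤ t) :
    0 ≤ φ * Real.log (max t⁻¹ (min φ t)) + 1 - max t⁻¹ (min φ t) := by
  set s := max t⁻¹ (min φ t) with hs
  have ht0 : 0 < t := by linarith
  have hti : t⁻¹ ≤ 1 := inv_le_one_of_one_le₀ ht
  have hs0 : 0 < s := lt_of_lt_of_le (inv_pos.2 ht0) (le_max_left _ _)
  have h1 : 0 ≤ (φ - s) * Real.log s := by
    rcases le_total φ t⁻¹ with h | h
    · have : s = t⁻¹ := by rw [hs, max_eq_left]; exact (min_le_left _ _).trans h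
      rw [this]
      exact mul_nonneg_of_nonpos_of_nonpos (by linarith) (Real.log_nonpos (by positivity) hti)
    · rcases le_total φ t with h' | h'
      · have : s = φ := by rw [hs, min_eq_left h', max_eq_right h]
        simp [this]
      · have : s = t := by rw [hs, min_eq_right h', max_eq_right (hti.trans ht)]
        rw [this]
        exact mul_nonneg (by linarith) (Real.log_nonneg ht)
  have h2 := klFun_nonneg hs0.le
  rw [klFun_apply] at h2
  nlinarith

theorem tendsto_mul_log_clamp {φ : ℝ} (hφ : 0 ≤ φ) :
    Tendsto (fun n : ℕ => φ * Real.log (max ((n : ℝ) + 1)⁻¹ (min φ (n + 1))) + 1 -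
      max ((n : ℝ) + 1)⁻¹ (min φ (n + 1))) atTop (𝓝 (klFun φ)) := by
  have hi : Tendsto (fun n : ℕ => ((n : ℝ) + 1)⁻¹) atTop (𝓝 0) := by
    simpa using tendsto_one_div_add_atTop_nhds_zero_nat (𝕜 := ℝ)
  rcases hφ.eq_or_lt with rfl | hpos
  · have : Tendsto (fun n : ℕ => 1 - ((n : ℝ) + 1)⁻¹) atTop (𝓝 (1 - 0)) := hi.const_sub 1
    rw [klFun_zero]
    convert! this using 2 with n
    · have : (0 : ℝ) ≤ (n : ℝ) + 1 := by positivity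
      rw [min_eq_left this, max_eq_left (by positivity)]
      ring
    · simp
  · refine tendsto_const_nhds.congr' ?_
    filter_upwards [hi.eventually_lt_const hpos, eventually_ge_atTop ⌈φ⌉₊] with n h1 h2
    have h3 : φ ≤ n + 1 := (Nat.le_ceil φ).trans (by exact_mod_cast h2.trans (Nat.le_succ n))
    rw [min_eq_left h3, max_eq_right h1.le, klFun_apply]

/-- The optimal test function is the log-density of `P`; clamping the density to `[1/(n+1), n+1]`
makes it bounded, and Fatou's lemma recovers the entropy as `n` grows. If `P` is not absolutely
continuous, a large multiple of the indicator of an `m`-null set charged by `P` suffices. -/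
theorem exists_measurable_lt_of_lt_klDiv (m P : Measure X) [IsProbabilityMeasure m]
    [IsProbabilityMeasure P] {c : ℝ} (hc : ENNReal.ofReal c < klDiv P m) :
    ∃ (f : X → ℝ) (R : ℝ), Measurable f ∧ (∀ x, |f x| ≤ R) ∧
      c < ∫ x, f x ∂P + 1 - ∫ x, Real.exp (f x) ∂m := by
  by_cases hac : P ≪ m
  · rw [klDiv_eq_lintegral_klFun_of_ac hac] at hc
    set φ : X → ℝ := fun x => (P.rnDeriv m x).toReal with hφ
    have hφm : Measurable φ := (Measure.measurable_rnDeriv _ _).ennreal_toReal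
    have hφi : Integrable φ m := Measure.integrable_toReal_rnDeriv
    set s : ℕ → X → ℝ := fun n x => max ((n : ℝ) + 1)⁻¹ (min (φ x) (n + 1)) with hs
    have hsm : ∀ n, Measurable (s n) := fun n => by fun_prop
    have hs1 : ∀ (n : ℕ) x, ((n : ℝ) + 1)⁻¹ ≤ s n x := fun n x => le_max_left _ _
    have hs0 : ∀ n x, 0 < s n x := fun n x => lt_of_lt_of_le (by positivity) (hs1 n x)
    have hs2 : ∀ (n : ℕ) x, s n x ≤ n + 1 := fun n x => by
      refine max_le ?_ (min_le_right _ _)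
      exact (inv_le_one_of_one_le₀ (by simp)).trans (by simp)
    have hlog : ∀ (n : ℕ) x, |Real.log (s n x)| ≤ Real.log (n + 1) := fun n x => by
      rw [abs_le]
      constructor
      · rw [← Real.log_inv]
        exact Real.log_le_log (by positivity) (hs1 n x)
      · exact Real.log_le_log (hs0 n x) (hs2 n x)
    have hlim : ∀ x, ENNReal.ofReal (klFun (φ x)) =
        liminf (fun n => ENNReal.ofReal (φ x * Real.log (s n x) + 1 - s n x)) atTop := fun x =>
      ((ENNReal.tendsto_ofReal (tendsto_mul_log_clamp ENNReal.toReal_nonneg)).liminf_eq).symm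
    have hF : ENNReal.ofReal c < liminf (fun n =>
        ∫⁻ x, ENNReal.ofReal (φ x * Real.log (s n x) + 1 - s n x) ∂m) atTop := by
      refine hc.trans_le ?_
      simp_rw [hφ] at hlim
      simp_rw [hlim]
      refine lintegral_liminf_le fun n => ?_
      have := hsm n
      fun_prop
    obtain ⟨n, hn⟩ := (eventually_lt_of_lt_liminf hF).exists
    have hsi : Integrable (s n) m := by
      refine Integrable.of_bound (hsm n).aestronglyMeasurable (n + 1) (ae_of_all _ fun x => ?_)
      rw [Real.norm_eq_abs, abs_of_pos (hs0 n x)]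
      exact hs2 n x
    have hmul : Integrable (fun x => φ x * Real.log (s n x)) m := by
      refine hφi.mul_bdd (c := Real.log (n + 1)) ?_ (ae_of_all _ fun x => ?_)
      · have := hsm n
        exact Measurable.aestronglyMeasurable (by fun_prop)
      · exact hlog n x
    have h1 : Integrable (fun x => φ x * Real.log (s n x) + 1) m := hmul.add (integrable_const 1)
    have h3 : Integrable (fun x => φ x * Real.log (s n x) + 1 - s n x) m := h1.sub hsi
    rw [← ofReal_integral_eq_lintegral_ofReal h3
      (ae_of_all _ fun x => mul_log_clamp_nonneg (by simp))] at hn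
    have hn' := lt_of_not_ge fun h => hn.not_ge (ENNReal.ofReal_le_ofReal h)
    refine ⟨fun x => Real.log (s n x), Real.log (n + 1), (hsm n).log, hlog n, hn'.trans_eq ?_⟩
    simp_rw [Real.exp_log (hs0 n _)]
    have h2 : ∫ x, φ x * Real.log (s n x) ∂m = ∫ x, Real.log (s n x) ∂P := by
      simpa [smul_eq_mul] using integral_rnDeriv_smul (f := fun x => Real.log (s n x)) hac
    calc ∫ x, (φ x * Real.log (s n x) + 1 - s n x) ∂m
        = ∫ x, (φ x * Real.log (s n x) + 1) ∂m - ∫ x, s n x ∂m := integral_sub h1 hsi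
      _ = _ := by rw [integral_add hmul (integrable_const 1), h2]; simp
  · obtain ⟨A, hA, hmA, hPA⟩ : ∃ A, MeasurableSet A ∧ m A = 0 ∧ P A ≠ 0 := by
      by_contra! h
      exact hac (Measure.AbsolutelyContinuous.mk fun s hs hms => h s hs hms)
    have hp : 0 < P.real A := ENNReal.toReal_pos hPA (measure_ne_top _ _)
    -- With this height `∫ f dP = |c| + 1`, while `∫ e^f dm = 1` because `A` is `m`-null.
    set t := (|c| + 1) / P.real A with ht
    have ht0 : 0 ≤ t := by positivity
    refine ⟨A.indicator fun _ => t, t, measurable_const.indicator hA, fun x => ?_, ?_⟩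
    · by_cases hx : x ∈ A <;> simp [hx, abs_of_nonneg ht0, ht0]
    · have h1 : ∫ x, Real.exp (A.indicator (fun _ => t) x) ∂m = 1 := by
        have : (fun x => Real.exp (A.indicator (fun _ => t) x)) =ᵐ[m] fun _ => 1 := by
          have : ∀ᵐ x ∂m, x ∉ A := measure_eq_zero_iff_ae_notMem.1 hmA
          filter_upwards [this] with x hx
          simp [hx]
        rw [integral_congr_ae this]; simp
      rw [h1, integral_indicator_const _ hA, smul_eq_mul, ht, mul_div_cancel₀ _ hp.ne']
      linarith [le_abs_self c]

theorem abs_exp_sub_exp_le {a b R : ℝ} (ha : a ≤ R) (hb : b ≤ R) :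
    |Real.exp a - Real.exp b| ≤ Real.exp R * |a - b| := by
  have key : ∀ {a b : ℝ}, a ≤ R → b ≤ a → Real.exp a - Real.exp b ≤ Real.exp R * (a - b) := by
    intro a b ha hb
    have h1 := Real.add_one_le_exp (b - a)
    have h2 : Real.exp b = Real.exp a * Real.exp (b - a) := by rw [← Real.exp_add]; ring_nf
    have h3 : Real.exp a ≤ Real.exp R := Real.exp_le_exp.2 ha
    rw [h2]
    nlinarith [Real.exp_pos a]
  rcases le_total b a with h | h
  · rw [abs_of_nonneg (sub_nonneg.2 (Real.exp_le_exp.2 h)), abs_of_nonneg (sub_nonneg.2 h)]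
    exact key ha h
  · rw [abs_sub_comm, abs_sub_comm a, abs_of_nonneg (sub_nonneg.2 (Real.exp_le_exp.2 h)),
      abs_of_nonneg (sub_nonneg.2 h)]
    exact key hb h

variable [TopologicalSpace X] [BorelSpace X] [NormalSpace X]

/-- The Donsker–Varadhan lower bound on the relative entropy, with bounded continuous test
functions. -/
theorem exists_boundedContinuous_lt_of_lt_klDiv (m P : Measure X) [IsProbabilityMeasure m]
    [IsProbabilityMeasure P] [(P + m).WeaklyRegular] {c : ℝ}
    (hc : c < 0 ∨ ENNReal.ofReal c < klDiv P m) :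
    ∃ f : X →ᵇ ℝ, c < ∫ x, f x ∂P + 1 - ∫ x, Real.exp (f x) ∂m := by
  -- `ENNReal.ofReal` forgets negative `c`, so that case is separate; the zero function, of value
  -- `0`, settles it.
  rcases hc with hc | hc
  · exact ⟨0, by simpa using hc⟩
  obtain ⟨f, R, hfm, hfR, hf⟩ := exists_measurable_lt_of_lt_klDiv m P hc
  have hbdd : ∀ (Q : Measure X) [IsProbabilityMeasure Q] (h : X → ℝ), Measurable h →
      (∀ x, |h x| ≤ R) → Integrable h Q := fun Q _ h hm hR =>
    Integrable.of_bound hm.aestronglyMeasurable R (ae_of_all _ hR)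
  have hbddexp : ∀ (Q : Measure X) [IsProbabilityMeasure Q] (h : X → ℝ), Measurable h →
      (∀ x, |h x| ≤ R) → Integrable (fun x => Real.exp (h x)) Q := fun Q _ h hm hR =>
    Integrable.of_bound hm.exp.aestronglyMeasurable (Real.exp R) (ae_of_all _ fun x => by
      rw [Real.norm_eq_abs, Real.abs_exp]
      exact Real.exp_le_exp.2 (abs_le.1 (hR x)).2)
  set gap := ∫ x, f x ∂P + 1 - ∫ x, Real.exp (f x) ∂m - c with hgap
  have hgap0 : 0 < gap := by linarith
  have hE : 0 < 1 + Real.exp R := by positivity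
  have hint : Integrable f (P + m) := (hbdd P f hfm hfR).add_measure (hbdd m f hfm hfR)
  -- Approximating in `L¹(P + m)` lets a single function serve both integrals.
  obtain ⟨g, hg, hgi⟩ := hint.exists_boundedContinuous_integral_sub_le
    (ε := gap / (2 * (1 + Real.exp R))) (by positivity)
  have hR0 : 0 ≤ R := by
    obtain ⟨x⟩ : Nonempty X := nonempty_of_isProbabilityMeasure P
    exact (abs_nonneg _).trans (hfR x)
  -- Truncation to `[-R, R]` makes the exponential Lipschitz with constant `e^R`, and does not
  -- increase the distance to `f`, as `|f| ≤ R`.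
  set h : X →ᵇ ℝ := BoundedContinuousFunction.ofNormedAddCommGroup
    (fun x => max (-R) (min (g x) R)) (by fun_prop) R (fun x => by
      rw [Real.norm_eq_abs, abs_le]
      exact ⟨le_max_left _ _, max_le (by linarith) (min_le_right _ _)⟩) with hh
  have hhR : ∀ x, |h x| ≤ R := fun x => h.norm_coe_le_norm x |>.trans
    (BoundedContinuousFunction.norm_ofNormedAddCommGroup_le _ hR0 _)
  have hhm : Measurable h := h.continuous.measurable
  have hle : ∀ x, |f x - h x| ≤ |f x - g x| := fun x => by
    have h1 : h x = max (-R) (min (g x) R) := rfl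
    obtain ⟨h2, h3⟩ := abs_le.1 (hfR x)
    rw [h1]
    have e : f x = max (-R) (min (f x) R) := by rw [min_eq_left h3, max_eq_right h2]
    calc |f x - max (-R) (min (g x) R)| = |max (-R) (min (f x) R) - max (-R) (min (g x) R)| := by
          rw [← e]
      _ ≤ |min (f x) R - min (g x) R| := by
          rw [max_comm (-R), max_comm (-R)]
          exact abs_max_sub_max_le_abs _ _ _
      _ ≤ |f x - g x| := by
          simpa using abs_min_sub_min_le_max (f x) R (g x) R
  have hdi : ∀ (Q : Measure X) [IsProbabilityMeasure Q], Integrable (fun x => |f x - h x|) Q :=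
    fun Q _ => ((hbdd Q f hfm hfR).sub (hbdd Q h hhm hhR)).abs
  have hd : ∫ x, |f x - h x| ∂P + ∫ x, |f x - h x| ∂m ≤ gap / (2 * (1 + Real.exp R)) := by
    rw [← integral_add_measure (hdi P) (hdi m)]
    refine le_trans (integral_mono ((hdi P).add_measure (hdi m)) (hint.sub hgi).abs hle) ?_
    simpa [Real.norm_eq_abs] using hg
  have hP : ∫ x, f x ∂P - ∫ x, h x ∂P ≤ ∫ x, |f x - h x| ∂P := by
    rw [← integral_sub (hbdd P f hfm hfR) (hbdd P h hhm hhR)]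
    exact integral_mono ((hbdd P f hfm hfR).sub (hbdd P h hhm hhR)) (hdi P) fun x => le_abs_self _
  have hm : ∫ x, Real.exp (h x) ∂m - ∫ x, Real.exp (f x) ∂m
      ≤ Real.exp R * ∫ x, |f x - h x| ∂m := by
    rw [← integral_sub (hbddexp m h hhm hhR) (hbddexp m f hfm hfR), ← integral_const_mul]
    refine integral_mono ((hbddexp m h hhm hhR).sub (hbddexp m f hfm hfR))
      ((hdi m).const_mul _) fun x => ?_
    rw [abs_sub_comm]
    exact (le_abs_self _).trans
      (abs_exp_sub_exp_le (abs_le.1 (hhR x)).2 (abs_le.1 (hfR x)).2)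
  refine ⟨h, ?_⟩
  have a0 : 0 ≤ ∫ x, |f x - h x| ∂P := integral_nonneg fun x => abs_nonneg _
  have b0 : 0 ≤ ∫ x, |f x - h x| ∂m := integral_nonneg fun x => abs_nonneg _
  have h1 : (1 + Real.exp R) * (∫ x, |f x - h x| ∂P + ∫ x, |f x - h x| ∂m) ≤ gap / 2 := by
    calc _ ≤ (1 + Real.exp R) * (gap / (2 * (1 + Real.exp R))) := by gcongr
      _ = gap / 2 := by field_simp
  nlinarith [Real.exp_pos R]

end DonskerVaradhan

/-! ### Lower semicontinuity of integrals under weak convergence -/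

section LowerSemicontinuity

variable {X : Type*} [MeasurableSpace X] [TopologicalSpace X] [BorelSpace X]
  [HasOuterApproxClosed X]

/-- The superlevel sets of `f` are open, so the portmanteau theorem applies to each; the layer-cake
formula and Fatou's lemma assemble them. -/
theorem lintegral_le_liminf_of_lowerSemicontinuous {ι : Type*} {L : Filter ι}
    [L.IsCountablyGenerated] {μ : ProbabilityMeasure X} {μs : ι → ProbabilityMeasure X}
    (h : Tendsto μs L (𝓝 μ)) {f : X → ℝ≥0∞} (hf : LowerSemicontinuous f) (hft : ∀ x, f x ≠ ∞) :
    ∫⁻ x, f x ∂(μ : Measure X) ≤ L.liminf fun i => ∫⁻ x, f x ∂(μs i : Measure X) := by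
  have hm : Measurable fun x => (f x).toReal := hf.measurable.ennreal_toReal
  have e : ∀ Q : Measure X, ∫⁻ x, f x ∂Q = ∫⁻ t in Set.Ioi (0 : ℝ), Q {x | t < (f x).toReal} :=
    fun Q => by
      rw [← lintegral_eq_lintegral_meas_lt Q (ae_of_all _ fun x => ENNReal.toReal_nonneg)
        hm.aemeasurable]
      simp_rw [ENNReal.ofReal_toReal (hft _)]
  simp_rw [e]
  have hanti : ∀ Q : Measure X, Antitone fun t : ℝ => Q {x | t < (f x).toReal} :=
    fun Q s t hst => measure_mono fun x hx => lt_of_le_of_lt hst hx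
  refine le_trans ?_ (lintegral_liminf_le fun i => (hanti _).measurable)
  refine setLIntegral_mono' measurableSet_Ioi fun t ht => ?_
  refine ProbabilityMeasure.le_liminf_measure_open_of_tendsto h ?_
  have : {x | t < (f x).toReal} = f ⁻¹' Set.Ioi (ENNReal.ofReal t) := by
    ext x
    simp [ENNReal.ofReal_lt_iff_lt_toReal (Set.mem_Ioi.1 ht).le (hft x)]
  rw [this]
  exact hf.isOpen_preimage _

/-- Monotone convergence selects the truncation level `k`, and the truncated function is lower
semicontinuous with finite values. The truncation matters for empirical measures, whose diagonal
terms may have infinite energy. -/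
theorem exists_eventually_lt_lintegral_min [FirstCountableTopology (ProbabilityMeasure X)]
    {f : X → ℝ≥0∞} (hf : LowerSemicontinuous f) (μ : ProbabilityMeasure X) {a : ℝ≥0∞}
    (ha : a < ∫⁻ x, f x ∂(μ : Measure X)) :
    ∃ k : ℕ, ∀ᶠ ν : ProbabilityMeasure X in 𝓝 μ, a < ∫⁻ x, min (f x) k ∂(ν : Measure X) := by
  have hsup : ∫⁻ x, f x ∂(μ : Measure X) = ⨆ k : ℕ, ∫⁻ x, min (f x) k ∂(μ : Measure X) := by
    rw [← lintegral_iSup (fun k => hf.measurable.min measurable_const)]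
    · refine lintegral_congr fun x => ?_
      rw [← inf_iSup_eq, ENNReal.iSup_natCast, inf_top_eq]
    · intro i j hij x
      exact min_le_min_left _ (by exact_mod_cast hij)
  rw [hsup, lt_iSup_iff] at ha
  obtain ⟨k, hk⟩ := ha
  refine ⟨k, eventually_lt_of_lt_liminf (hk.trans_le ?_)⟩
  refine lintegral_le_liminf_of_lowerSemicontinuous tendsto_id
    (hf.inf lowerSemicontinuous_const) fun x => ?_
  exact ne_top_of_le_ne_top (ENNReal.natCast_ne_top k) (min_le_right _ _)

end LowerSemicontinuity

end MeanFieldGas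

namespace MeanFieldGas

open InformationTheory
open scoped BoundedContinuousFunction

/-! ### The normalized gas -/

section GasProb

variable {X : Type*} [MeasurableSpace X]

theorem lintegral_pi_prod (m : Measure X) [SigmaFinite m] {N : ℕ} {f : Fin N → X → ℝ≥0∞}
    (hf : ∀ i, Measurable (f i)) :
    ∫⁻ x, ∏ i, f i (x i) ∂(Measure.pi fun _ : Fin N => m) = ∏ i, ∫⁻ z, f i z ∂m := by
  induction N with
  | zero => simp
  | succ N ih =>
    have h1 : ∀ {M : ℕ} {f : Fin M → X → ℝ≥0∞}, (∀ i, Measurable (f i)) →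
        Measurable fun x : Fin M → X => ∏ i, f i (x i) := fun hf =>
      Finset.measurable_prod _ fun i _ => (hf i).comp (measurable_pi_apply i)
    rw [lintegral_pi_succ m 0 (h1 hf), Fin.prod_univ_succAbove _ 0,
      ← ih (fun i => hf _), ← lintegral_mul_const _ (hf 0)]
    refine lintegral_congr fun y => ?_
    rw [← lintegral_const_mul _ (h1 fun i => hf _)]
    refine lintegral_congr fun x => ?_
    rw [Fin.prod_univ_succAbove _ 0]
    simp

/-- The normalized mean-field Gibbs measure. -/
noncomputable def gasProb (m : Measure X) (g : X → X → ℝ≥0∞) (b : ℝ≥0) (N : ℕ) :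
    Measure (Fin N → X) :=
  (gas m g b N Set.univ)⁻¹ • gas m g b N

theorem isProbabilityMeasure_gasProb (m : Measure X) [IsProbabilityMeasure m]
    {g : X → X → ℝ≥0∞} (hgm : Measurable (Function.uncurry g)) (hg : ∀ u x, g u x = g x u)
    {G : ℝ≥0∞} (hGt : G ≠ ∞) (hG : ∀ y, ∫⁻ x, g y x ∂m ≤ G) (b : ℝ≥0) (N : ℕ) :
    IsProbabilityMeasure (gasProb m g b N) := by
  refine ⟨?_⟩
  rw [gasProb, Measure.smul_apply, smul_eq_mul]
  exact ENNReal.inv_mul_cancel (gas_univ_pos m hgm hg hGt hG b N).ne' (measure_ne_top _ _)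

/-- The bound `b * N ≤ B` makes the constant independent of the number of particles. It is the
domination of the marginals on which tightness and all kernel approximations rest. -/
theorem lintegral_gasProb_eval_le (m : Measure X) [IsProbabilityMeasure m]
    {g : X → X → ℝ≥0∞} (hgm : Measurable (Function.uncurry g)) (hg : ∀ u x, g u x = g x u)
    {G : ℝ≥0∞} (hGt : G ≠ ∞) (hG : ∀ y, ∫⁻ x, g y x ∂m ≤ G) {b : ℝ≥0} {N : ℕ} {B : ℝ≥0}
    (hB : b * N ≤ B) (i : Fin N) {F : X → ℝ≥0∞} (hF : Measurable F) :
    ∫⁻ x, F (x i) ∂(gasProb m g b N) ≤ (expNeg (B * G))⁻¹ * ∫⁻ z, F z ∂m := by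
  have h1 := lintegral_gas_eval_le m hgm hg hG b i hF
  have h2 : expNeg (B * G) ≤ expNeg (b * (N * G)) := by
    refine expNeg_antitone ?_
    rw [← mul_assoc]
    gcongr
    exact_mod_cast hB
  have h3 : 0 < expNeg (B * G) := expNeg_pos (ENNReal.mul_ne_top (by simp) hGt)
  have hZ := gas_univ_pos m hgm hg hGt hG b N
  rw [gasProb, lintegral_smul_measure, smul_eq_mul, mul_comm (_)⁻¹, mul_comm (_)⁻¹,
    ← div_eq_mul_inv, ← div_eq_mul_inv]
  refine ENNReal.div_le_of_le_mul ?_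
  rw [div_eq_mul_inv, mul_assoc, mul_comm _ (gas m g b N Set.univ), ← mul_assoc, ← div_eq_mul_inv]
  refine (ENNReal.le_div_iff_mul_le (Or.inl h3.ne') (Or.inl (expNeg_ne_top _))).2 ?_
  rw [mul_comm]
  exact (mul_le_mul_left h2 _).trans h1

end GasProb

/-! ### Empirical measures -/

section Empirical

variable {X : Type*} [MeasurableSpace X]

/-- The empirical measure of a nonempty configuration. -/
noncomputable def empirical {N : ℕ} (x : Fin (N + 1) → X) : ProbabilityMeasure X :=
  ⟨((N + 1 : ℕ) : ℝ≥0∞)⁻¹ • ∑ j, Measure.dirac (x j), ⟨by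
    simp only [Measure.smul_apply, Measure.coe_finsetSum, Finset.sum_apply, measure_univ,
      Finset.sum_const, Finset.card_univ, Fintype.card_fin, smul_eq_mul, nsmul_eq_mul, mul_one]
    exact ENNReal.inv_mul_cancel (by simp) (by simp)⟩⟩

theorem coe_empirical {N : ℕ} (x : Fin (N + 1) → X) : (empirical x : Measure X) =
    ((N + 1 : ℕ) : ℝ≥0∞)⁻¹ • ∑ j, Measure.dirac (x j) := rfl

theorem lintegral_empirical {N : ℕ} (x : Fin (N + 1) → X) {f : X → ℝ≥0∞} (hf : Measurable f) :
    ∫⁻ z, f z ∂(empirical x : Measure X) = ((N + 1 : ℕ) : ℝ≥0∞)⁻¹ * ∑ j, f (x j) := by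
  rw [coe_empirical, lintegral_smul_measure, lintegral_finsetSum_measure, smul_eq_mul]
  simp_rw [lintegral_dirac' _ hf]

theorem integral_empirical [TopologicalSpace X] [BorelSpace X] {N : ℕ} (x : Fin (N + 1) → X)
    (f : X →ᵇ ℝ) :
    ∫ z, f z ∂(empirical x : Measure X) = ((N + 1 : ℕ) : ℝ)⁻¹ * ∑ j, f (x j) := by
  rw [coe_empirical, integral_smul_measure, integral_finsetSum_measure]
  · simp_rw [integral_dirac' _ _ f.continuous.measurable.stronglyMeasurable]
    rw [ENNReal.toReal_inv, ENNReal.toReal_natCast, smul_eq_mul]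
  · intro i _
    exact f.integrable _

end Empirical

/-! ### Exponential upper bounds -/

section LargeDeviations

variable {X : Type*} [MeasurableSpace X]

theorem ENNReal_exists_lt_of_lt_mul_add {F c A H : ℝ≥0∞} (hc : c ≠ ∞) (h : F < c * A + H) :
    F < H ∨ ∃ a < A, F < c * a + H := by
  by_cases hA : A = 0
  · left; simpa [hA] using h
  · right
    have hcont : Continuous fun a : ℝ≥0∞ => c * a + H :=
      (ENNReal.continuous_const_mul hc).add continuous_const
    have h1 : ∀ᶠ a in 𝓝[<] A, F < c * a + H :=
      (hcont.continuousAt.eventually_const_lt h).filter_mono nhdsWithin_le_nhds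
    have : (𝓝[<] A).NeBot := nhdsLT_neBot_of_exists_lt ⟨0, pos_iff_ne_zero.2 hA⟩
    obtain ⟨a, ha, ha'⟩ := (h1.and self_mem_nhdsWithin).exists
    exact ⟨a, ha', ha⟩

/-- The free energy of `P` for the reference measure `m`. -/
noncomputable def refFreeEnergy (γ : ℝ) (g : X → X → ℝ≥0∞) (m P : Measure X) : ℝ≥0∞ :=
  ENNReal.ofReal (γ / 2) * ∫⁻ y, ∫⁻ z, g y z ∂P ∂P + klDiv P m

/-- The diagonal is absent from the pair energy but present in the empirical double integral;
truncation at `k` limits its cost to `k` per particle, negligible against the square of the number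
of particles. -/
theorem sq_mul_le_two_mul_pairEnergy_add {g : X → X → ℝ≥0∞} (hg : ∀ u x, g u x = g x u) {N : ℕ}
    (hgm : Measurable (Function.uncurry g)) (k : ℕ) (x : Fin (N + 1) → X) :
    ((N + 1 : ℕ) : ℝ≥0∞) ^ 2 * ∫⁻ q, min (g q.1 q.2) k
        ∂((empirical x : Measure X).prod (empirical x : Measure X)) ≤
      2 * pairEnergy g x + (N + 1 : ℕ) * k := by
  have hm : Measurable fun q : X × X => min (g q.1 q.2) (k : ℝ≥0∞) := hgm.min measurable_const
  rw [lintegral_prod _ hm.aemeasurable, lintegral_empirical x hm.lintegral_prod_right']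
  have h1 : ∀ j, ∫⁻ z, min (g (x j) z) (k : ℝ≥0∞) ∂(empirical x : Measure X)
      = ((N + 1 : ℕ) : ℝ≥0∞)⁻¹ * ∑ l, min (g (x j) (x l)) k := fun j =>
    lintegral_empirical x (hm.comp (measurable_const.prodMk measurable_id))
  simp_rw [h1, ← Finset.mul_sum]
  have h2 : ((N + 1 : ℕ) : ℝ≥0∞) * ((N + 1 : ℕ) : ℝ≥0∞)⁻¹ = 1 :=
    ENNReal.mul_inv_cancel (by simp) (by simp)
  have h3 : ∀ S : ℝ≥0∞, ((N + 1 : ℕ) : ℝ≥0∞) ^ 2 * (((N + 1 : ℕ) : ℝ≥0∞)⁻¹ *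
      (((N + 1 : ℕ) : ℝ≥0∞)⁻¹ * S)) = S := fun S => by
    calc _ = (((N + 1 : ℕ) : ℝ≥0∞) * ((N + 1 : ℕ) : ℝ≥0∞)⁻¹) *
          (((N + 1 : ℕ) : ℝ≥0∞) * ((N + 1 : ℕ) : ℝ≥0∞)⁻¹) * S := by ring
      _ = S := by rw [h2]; ring
  rw [h3, two_mul_pairEnergy hg]
  calc ∑ i, ∑ l, min (g (x i) (x l)) (k : ℝ≥0∞)
      ≤ ∑ i : Fin (N + 1), ((∑ l, if i = l then 0 else g (x i) (x l)) + k) := by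
        refine Finset.sum_le_sum fun i _ => ?_
        calc ∑ l, min (g (x i) (x l)) (k : ℝ≥0∞)
            ≤ ∑ l, ((if i = l then 0 else g (x i) (x l)) + if i = l then (k : ℝ≥0∞) else 0) := by
              refine Finset.sum_le_sum fun l _ => ?_
              by_cases h : i = l <;> simp [h]
          _ = _ := by rw [Finset.sum_add_distrib]; simp
    _ = _ := by rw [Finset.sum_add_distrib]; simp

/-- Exponential Chebyshev: on the event, `e^{-b·energy} ≤ e^{-bu}` and `1 ≤ e^{-v} ∏ e^{f(x_j)}`.
The product integrates to `J^N` with `J = ∫ e^f dm`, and `J ≤ e^{J-1}` replaces `log J` by the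
linear expression of the Donsker–Varadhan bound above. -/
theorem gas_apply_le {m : Measure X} [IsProbabilityMeasure m] {g : X → X → ℝ≥0∞}
    (hgm : Measurable (Function.uncurry g)) (b : ℝ≥0) (N : ℕ) {f : X → ℝ} (hf : Measurable f)
    {R : ℝ} (hfR : ∀ x, |f x| ≤ R) {u v : ℝ} (hu : 0 ≤ u) :
    gas m g b N ({x | ENNReal.ofReal u ≤ pairEnergy g x} ∩ {x | v ≤ ∑ j, f (x j)}) ≤
      ENNReal.ofReal (Real.exp (-(b * u) - v + N * (∫ z, Real.exp (f z) ∂m - 1))) := by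
  set T := {x : Fin N → X | ENNReal.ofReal u ≤ pairEnergy g x} ∩ {x | v ≤ ∑ j, f (x j)} with hT
  have hsum : Measurable fun x : Fin N → X => ∑ j, f (x j) :=
    Finset.measurable_sum _ fun j _ => hf.comp (measurable_pi_apply j)
  have hTm : MeasurableSet T := (measurableSet_le measurable_const (measurable_pairEnergy hgm)).inter
    (measurableSet_le measurable_const hsum)
  have hexp : Integrable (fun z => Real.exp (f z)) m :=
    Integrable.of_bound hf.exp.aestronglyMeasurable (Real.exp R) (ae_of_all _ fun x => by
      rw [Real.norm_eq_abs, Real.abs_exp]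
      exact Real.exp_le_exp.2 (abs_le.1 (hfR x)).2)
  have hI : ∫⁻ z, ENNReal.ofReal (Real.exp (f z)) ∂m = ENNReal.ofReal (∫ z, Real.exp (f z) ∂m) :=
    (ofReal_integral_eq_lintegral_ofReal hexp (ae_of_all _ fun x => Real.exp_nonneg _)).symm
  have hI0 : 0 ≤ ∫ z, Real.exp (f z) ∂m := integral_nonneg fun x => Real.exp_nonneg _
  rw [gas, withDensity_apply _ hTm]
  calc ∫⁻ x in T, expNeg (b * pairEnergy g x) ∂(Measure.pi fun _ => m)
      ≤ ∫⁻ x in T, ENNReal.ofReal (Real.exp (-(b * u) - v)) *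
          ∏ j, ENNReal.ofReal (Real.exp (f (x j))) ∂(Measure.pi fun _ => m) := by
        refine setLIntegral_mono' hTm fun x hx => ?_
        obtain ⟨h1, h2⟩ := hx
        rw [← ENNReal.ofReal_prod_of_nonneg fun j _ => Real.exp_nonneg _, ← Real.exp_sum,
          ← ENNReal.ofReal_mul (Real.exp_nonneg _), ← Real.exp_add]
        calc expNeg (b * pairEnergy g x) ≤ expNeg (ENNReal.ofReal (b * u)) := by
              refine expNeg_antitone ?_
              rw [ENNReal.ofReal_mul b.coe_nonneg, ENNReal.ofReal_coe_nnreal]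
              exact mul_le_mul_right h1 _
          _ = ENNReal.ofReal (Real.exp (-(b * u))) := expNeg_ofReal (by positivity)
          _ ≤ _ := by
              refine ENNReal.ofReal_le_ofReal (Real.exp_le_exp.2 ?_)
              have : v ≤ ∑ j, f (x j) := h2
              linarith
    _ ≤ ∫⁻ x, ENNReal.ofReal (Real.exp (-(b * u) - v)) *
          ∏ j, ENNReal.ofReal (Real.exp (f (x j))) ∂(Measure.pi fun _ => m) :=
        setLIntegral_le_lintegral _ _
    _ = ENNReal.ofReal (Real.exp (-(b * u) - v)) * ENNReal.ofReal (∫ z, Real.exp (f z) ∂m) ^ N := by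
        rw [lintegral_const_mul' _ _ ENNReal.ofReal_ne_top,
          lintegral_pi_prod m (f := fun _ z => ENNReal.ofReal (Real.exp (f z)))
            fun _ => hf.exp.ennreal_ofReal, hI]
        simp
    _ ≤ ENNReal.ofReal (Real.exp (-(b * u) - v)) *
          ENNReal.ofReal (Real.exp (∫ z, Real.exp (f z) ∂m - 1)) ^ N := by
        gcongr
        have := Real.add_one_le_exp (∫ z, Real.exp (f z) ∂m - 1)
        linarith
    _ = _ := by
        rw [← ENNReal.ofReal_pow (Real.exp_nonneg _), ← Real.exp_nat_mul,
          ← ENNReal.ofReal_mul (Real.exp_nonneg _), ← Real.exp_add]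

end LargeDeviations

end MeanFieldGas

namespace MeanFieldGas

open InformationTheory
open scoped BoundedContinuousFunction

/-! ### Local large deviation estimate near a non-minimizer -/

section LocalEstimate

variable {X : Type*} [MeasurableSpace X] [MetricSpace X] [SecondCountableTopology X]
  [BorelSpace X]

theorem exists_eventually_le_energy {g : X → X → ℝ≥0∞}
    (hlsc : LowerSemicontinuous fun q : X × X => g q.1 q.2) {F c H : ℝ≥0∞} (hc : c ≠ ∞)
    (P : ProbabilityMeasure X)
    (h : F < c * ∫⁻ y, ∫⁻ z, g y z ∂(P : Measure X) ∂(P : Measure X) + H) :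
    ∃ (a : ℝ≥0) (k : ℕ), (∀ᶠ Q : ProbabilityMeasure X in 𝓝 P,
      (a : ℝ≥0∞) ≤ ∫⁻ q, min (g q.1 q.2) k ∂((Q : Measure X).prod (Q : Measure X))) ∧
      F < c * a + H := by
  rcases ENNReal_exists_lt_of_lt_mul_add hc h with h | ⟨a, ha, h⟩
  -- The entropy alone exceeds `F`, so no energy needs to be retained.
  · exact ⟨0, 0, Eventually.of_forall fun _ => by simp, by simpa using h⟩
  · lift a to ℝ≥0 using (ha.trans_le le_top).ne
    have hm : Measurable fun q : X × X => g q.1 q.2 := hlsc.measurable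
    have hprod : ∫⁻ q, g q.1 q.2 ∂(((P.prod P : ProbabilityMeasure (X × X))) : Measure (X × X))
        = ∫⁻ y, ∫⁻ z, g y z ∂(P : Measure X) ∂(P : Measure X) :=
      lintegral_prod _ hm.aemeasurable
    rw [← hprod] at ha
    obtain ⟨k, hk⟩ := exists_eventually_lt_lintegral_min hlsc (P.prod P) ha
    refine ⟨a, k, ?_, h⟩
    have hcont : Continuous fun Q : ProbabilityMeasure X => Q.prod Q :=
      ProbabilityMeasure.continuous_prod.comp (continuous_id.prodMk continuous_id)
    filter_upwards [hcont.continuousAt.eventually hk] with Q hQ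
    exact hQ.le

/-- Near `P` the truncated energy and the integral of a test function stay above levels almost
attaining the free energy of `P`. Chebyshev bounds the numerator with these levels, the trial
measure `μ` bounds the partition function, and the strict gap between the free energies leaves an
exponential factor. -/
theorem tendsto_gasProb_empirical_mem {γ : ℝ} (hγ : 0 ≤ γ) {m : Measure X}
    [IsProbabilityMeasure m] {g : X → X → ℝ≥0∞} (hg : ∀ u x, g u x = g x u)
    (hlsc : LowerSemicontinuous fun q : X × X => g q.1 q.2)
    {μ : ProbabilityMeasure X}
    (hI : ∫⁻ y, ∫⁻ z, g y z ∂(μ : Measure X) ∂(μ : Measure X) ≠ ∞) (hH : klDiv (μ : Measure X) m ≠ ∞)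
    {b : ℕ → ℝ≥0} (hb : Tendsto (fun N => ((N + 1 : ℕ) : ℝ) * b N) atTop (𝓝 γ))
    {P : ProbabilityMeasure X} (hlt : refFreeEnergy γ g m μ < refFreeEnergy γ g m P) :
    ∃ B ∈ 𝓝 P, Tendsto (fun N => gasProb m g (b N) (N + 1) {x | empirical x ∈ B}) atTop (𝓝 0) := by
  have hgm : Measurable (Function.uncurry g) := hlsc.measurable
  set I := (∫⁻ y, ∫⁻ z, g y z ∂(μ : Measure X) ∂(μ : Measure X)).toReal with hIdef
  set H := (klDiv (μ : Measure X) m).toReal with hHdef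
  have hI0 : 0 ≤ I := ENNReal.toReal_nonneg
  have hH0 : 0 ≤ H := ENNReal.toReal_nonneg
  have hI' : ∫⁻ y, ∫⁻ z, g y z ∂(μ : Measure X) ∂(μ : Measure X) = ENNReal.ofReal I :=
    (ENNReal.ofReal_toReal hI).symm
  have hH' : klDiv (μ : Measure X) m = ENNReal.ofReal H := (ENNReal.ofReal_toReal hH).symm
  have hF : refFreeEnergy γ g m μ = ENNReal.ofReal (γ / 2 * I + H) := by
    rw [refFreeEnergy, hI', hH', ← ENNReal.ofReal_mul (by positivity),
      ← ENNReal.ofReal_add (by positivity) hH0]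
  obtain ⟨a, k, hak, hak'⟩ := exists_eventually_le_energy hlsc ENNReal.ofReal_ne_top P hlt
  -- The share of the free energy of `μ` that the entropy of `P` must exceed once the energy level
  -- `a` is counted; it may be negative.
  set r := γ / 2 * I + H - γ / 2 * a with hr
  have hc : r < 0 ∨ ENNReal.ofReal r < klDiv (P : Measure X) m := by
    rcases lt_or_ge r 0 with h | h
    · exact Or.inl h
    · right
      have e : γ / 2 * I + H = γ / 2 * a + r := by rw [hr]; ring
      rw [hF, e, ENNReal.ofReal_add (by positivity) h, ENNReal.ofReal_mul (by positivity),
        ENNReal.ofReal_coe_nnreal] at hak'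
      exact lt_of_add_lt_add_left hak'
  obtain ⟨f, hf⟩ := exists_boundedContinuous_lt_of_lt_klDiv m (P : Measure X) hc
  set J := ∫ x, Real.exp (f x) ∂m with hJ
  set κ := ∫ x, f x ∂(P : Measure X) + 1 - J - r with hκ
  have hκ0 : 0 < κ := by linarith
  -- Half of the gap `κ` is given up so that the condition on `Q` holds on a neighbourhood of `P`.
  set w := ∫ x, f x ∂(P : Measure X) - κ / 2 with hw
  have hfe : ∀ᶠ Q : ProbabilityMeasure X in 𝓝 P, w ≤ ∫ x, f x ∂(Q : Measure X) := by
    have h1 : Continuous fun Q : ProbabilityMeasure X => ∫ x, f x ∂(Q : Measure X) :=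
      ProbabilityMeasure.continuous_integral_boundedContinuousFunction f
    have h2 : w < ∫ x, f x ∂(P : Measure X) := by linarith
    exact (h1.continuousAt.eventually_const_lt h2).mono fun _ h => h.le
  refine ⟨_, hak.and hfe, ?_⟩
  set u : ℕ → ℝ := fun N => max 0 ((((N + 1 : ℕ) : ℝ) ^ 2 * a - ((N + 1 : ℕ) : ℝ) * k) / 2) with hu
  -- Exponent per particle of the ratio of the two bounds, with `u` replaced by its second argument.
  -- Its limit is `r - w + J - 1 = -κ/2`.
  set θ : ℕ → ℝ := fun N => -((((N + 1 : ℕ) : ℝ) * b N * a - b N * k) / 2) - w + (J - 1) +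
    (((N + 1 : ℕ) : ℝ) * b N - b N) / 2 * I + H with hθ
  have hcast : Tendsto (fun N : ℕ => ((N + 1 : ℕ) : ℝ)) atTop atTop :=
    tendsto_natCast_atTop_atTop.comp (tendsto_add_atTop_nat 1)
  have hb0 : Tendsto (fun N => (b N : ℝ)) atTop (𝓝 0) := by
    have := hb.div_atTop hcast
    refine this.congr fun N => ?_
    field_simp
  have hθlim : Tendsto θ atTop (𝓝 (-(κ / 2))) := by
    have h1 : Tendsto θ atTop (𝓝 (-((γ * a - 0 * k) / 2) - w + (J - 1) + (γ - 0) / 2 * I + H)) :=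
      ((((((hb.mul_const _).sub (hb0.mul_const _)).div_const 2).neg.sub_const w).add_const
        (J - 1)).add (((hb.sub hb0).div_const 2).mul_const I)).add_const H
    convert! h1 using 2
    rw [hw, hκ, hr]; ring
  have hexp : Tendsto (fun N => ENNReal.ofReal (Real.exp (((N + 1 : ℕ) : ℝ) * θ N))) atTop (𝓝 0) := by
    have h1 : Tendsto (fun N => ((N + 1 : ℕ) : ℝ) * θ N) atTop atBot :=
      hcast.atTop_mul_neg (by linarith) hθlim
    have h2 := ENNReal.tendsto_ofReal (Real.tendsto_exp_atBot.comp h1)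
    simpa using h2
  refine tendsto_of_tendsto_of_tendsto_of_le_of_le tendsto_const_nhds hexp (fun _ => zero_le) ?_
  intro N
  have hsub : {x : Fin (N + 1) → X | empirical x ∈
      {Q : ProbabilityMeasure X | (a : ℝ≥0∞) ≤ ∫⁻ q, min (g q.1 q.2) k
        ∂((Q : Measure X).prod (Q : Measure X)) ∧ w ≤ ∫ x, f x ∂(Q : Measure X)}} ⊆
      {x | ENNReal.ofReal (u N) ≤ pairEnergy g x} ∩
        {x | ((N + 1 : ℕ) : ℝ) * w ≤ ∑ j, f (x j)} := by
    rintro x ⟨hx1, hx2⟩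
    constructor
    · have h1 := sq_mul_le_two_mul_pairEnergy_add hg hgm k x
      have h2 : ENNReal.ofReal (((N + 1 : ℕ) : ℝ) ^ 2 * a) ≤
          2 * pairEnergy g x + ENNReal.ofReal (((N + 1 : ℕ) : ℝ) * k) := by
        rw [ENNReal.ofReal_mul (by positivity), ENNReal.ofReal_mul (by positivity),
          ENNReal.ofReal_pow (by positivity), ENNReal.ofReal_natCast, ENNReal.ofReal_natCast,
          ENNReal.ofReal_coe_nnreal]
        exact (mul_le_mul_right hx1 _).trans h1
      have h3 : ENNReal.ofReal (2 * ((((N + 1 : ℕ) : ℝ) ^ 2 * a - ((N + 1 : ℕ) : ℝ) * k) / 2)) ≤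
          2 * pairEnergy g x := by
        rw [mul_div_cancel₀ _ two_ne_zero, ENNReal.ofReal_sub _ (by positivity)]
        exact tsub_le_iff_right.2 h2
      rw [ENNReal.ofReal_mul (by norm_num), ENNReal.ofReal_ofNat] at h3
      have h4 := (ENNReal.mul_le_mul_iff_right (by simp) (by simp)).1 h3
      simp only [Set.mem_ofPred_eq, hu, ENNReal.ofReal_max, ENNReal.ofReal_zero]
      exact max_le zero_le h4
    · rw [integral_empirical] at hx2
      have hpos : (0 : ℝ) < ((N + 1 : ℕ) : ℝ) := by positivity
      rw [inv_mul_eq_div, le_div_iff₀ hpos] at hx2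
      simpa [mul_comm] using hx2
  have hZ := le_gas_univ m (μ : Measure X) hgm hg (b N) (N + 1)
  have hZ' : ENNReal.ofReal (Real.exp (-(b N * (((N + 1 : ℕ) : ℝ) * N / 2 * I) +
      ((N + 1 : ℕ) : ℝ) * H))) ≤ gas m g (b N) (N + 1) Set.univ := by
    refine le_trans (le_of_eq ?_) hZ
    have e : (((N + 1).choose 2 : ℕ) : ℝ≥0∞) = ENNReal.ofReal (((N + 1 : ℕ) : ℝ) * N / 2) := by
      rw [← ENNReal.ofReal_natCast, Nat.cast_choose_two]
      congr 1; push_cast; ring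
    rw [hI', hH', e, ← ENNReal.ofReal_mul (by positivity), ← ENNReal.ofReal_coe_nnreal (p := b N),
      ← ENNReal.ofReal_mul (by positivity), ← ENNReal.ofReal_natCast,
      ← ENNReal.ofReal_mul (by positivity), ← ENNReal.ofReal_add (by positivity) (by positivity),
      expNeg_ofReal (by positivity)]
  simp only [gasProb, Measure.smul_apply, smul_eq_mul]
  have hup := (measure_mono hsub).trans
    (gas_apply_le (m := m) hgm (b N) (N + 1) f.continuous.measurable (f.norm_coe_le_norm)
      (u := u N) (v := ((N + 1 : ℕ) : ℝ) * w) (le_max_left _ _))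
  calc _ ≤ (ENNReal.ofReal (Real.exp (-(b N * (((N + 1 : ℕ) : ℝ) * N / 2 * I) +
        ((N + 1 : ℕ) : ℝ) * H))))⁻¹ * ENNReal.ofReal (Real.exp (-(b N * u N) -
        ((N + 1 : ℕ) : ℝ) * w + ((N + 1 : ℕ) : ℝ) * (J - 1))) :=
        mul_le_mul' (ENNReal.inv_le_inv.2 hZ') hup
    _ ≤ _ := by
      rw [← ENNReal.ofReal_inv_of_pos (Real.exp_pos _), ← Real.exp_neg,
        ← ENNReal.ofReal_mul (Real.exp_nonneg _), ← Real.exp_add]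
      refine ENNReal.ofReal_le_ofReal (Real.exp_le_exp.2 ?_)
      have h5 : (b N : ℝ) * ((((N + 1 : ℕ) : ℝ) ^ 2 * a - ((N + 1 : ℕ) : ℝ) * k) / 2) ≤ b N * u N :=
        mul_le_mul_of_nonneg_left (le_max_right _ _) (b N).coe_nonneg
      simp only [hθ]
      push_cast at h5 ⊢
      nlinarith [h5]

end LocalEstimate

end MeanFieldGas

namespace MeanFieldGas

open InformationTheory
open scoped BoundedContinuousFunction

/-! ### The mean of the empirical measure -/

section MeanEmpirical

variable {X : Type*} [MeasurableSpace X]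

theorem lintegral_gasProb_empirical_le (m : Measure X) [IsProbabilityMeasure m]
    {g : X → X → ℝ≥0∞} (hgm : Measurable (Function.uncurry g)) (hg : ∀ u x, g u x = g x u)
    {G : ℝ≥0∞} (hGt : G ≠ ∞) (hG : ∀ y, ∫⁻ x, g y x ∂m ≤ G) {b : ℝ≥0} {N : ℕ} {B : ℝ≥0}
    (hB : b * (N + 1 : ℕ) ≤ B) {F : X → ℝ≥0∞} (hF : Measurable F) :
    ∫⁻ x, ∫⁻ z, F z ∂(empirical x : Measure X) ∂(gasProb m g b (N + 1)) ≤
      (expNeg (B * G))⁻¹ * ∫⁻ z, F z ∂m := by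
  simp_rw [lintegral_empirical _ hF]
  rw [lintegral_const_mul' _ _ (by simp), lintegral_finsetSum _ fun j _ =>
    (show Measurable fun x : Fin (N + 1) → X => F (x j) from hF.comp (measurable_pi_apply j))]
  calc ((N + 1 : ℕ) : ℝ≥0∞)⁻¹ * ∑ j, ∫⁻ x, F (x j) ∂(gasProb m g b (N + 1))
      ≤ ((N + 1 : ℕ) : ℝ≥0∞)⁻¹ * ∑ _j : Fin (N + 1), (expNeg (B * G))⁻¹ * ∫⁻ z, F z ∂m := by
        gcongr with j
        exact lintegral_gasProb_eval_le m hgm hg hGt hG hB j hF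
    _ = _ := by
        rw [Finset.sum_const, Finset.card_univ, Fintype.card_fin, nsmul_eq_mul, ← mul_assoc,
          ENNReal.inv_mul_cancel (by simp) (by simp), one_mul]

end MeanEmpirical

/-! ### Tightness and the law of large numbers -/

section LawOfLargeNumbers

variable {X : Type*} [MeasurableSpace X] [MetricSpace X] [SecondCountableTopology X]
  [BorelSpace X] [CompleteSpace X]

/-- The mean of the empirical measure is at most `C m`, and the single measure `m` is tight;
Markov's inequality at each level `u n` and a union bound give the claim. Ordinary tightness is
enough here, since only convergence in probability is sought. -/
theorem exists_isCompact_gasProb_le (m : Measure X) [IsProbabilityMeasure m]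
    {g : X → X → ℝ≥0∞} (hgm : Measurable (Function.uncurry g)) (hg : ∀ u x, g u x = g x u)
    {G : ℝ≥0∞} (hGt : G ≠ ∞) (hG : ∀ y, ∫⁻ x, g y x ∂m ≤ G) {b : ℕ → ℝ≥0} {B : ℝ≥0}
    (hB : ∀ N, b N * (N + 1 : ℕ) ≤ B) {η : ℝ≥0∞} (hη : η ≠ 0) :
    ∃ 𝒦 : Set (ProbabilityMeasure X), IsCompact 𝒦 ∧
      ∀ N, gasProb m g (b N) (N + 1) {x | empirical x ∉ 𝒦} ≤ η := by
  set C := (expNeg (B * G))⁻¹ with hC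
  have hC0 : C ≠ 0 := ENNReal.inv_ne_zero.2 (expNeg_ne_top _)
  have hCt : C ≠ ∞ := ENNReal.inv_ne_top.2 (expNeg_pos (ENNReal.mul_ne_top (by simp) hGt)).ne'
  obtain ⟨ε, hε0, hεsum⟩ := ENNReal.exists_pos_sum_of_countable hη ℕ
  obtain ⟨u, -, u_pos, u_lim⟩ : ∃ u : ℕ → ℝ≥0, StrictAnti u ∧ (∀ n, 0 < u n) ∧
      Tendsto u atTop (𝓝 0) := exists_seq_strictAnti_tendsto 0
  -- The mass `u j * ε j / C` is such that Markov's inequality at level `u j` costs exactly `ε j`.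
  have hK : ∀ j, ∃ K : Set X, IsCompact K ∧ m Kᶜ ≤ u j * ε j / C := fun j => by
    have h := isTightMeasureSet_iff_exists_isCompact_measure_compl_le.1
      (isTightMeasureSet_singleton (μ := m)) (u j * ε j / C) (by
        refine ENNReal.div_pos ?_ hCt
        exact_mod_cast (mul_pos (u_pos j) (hε0 j)).ne')
    obtain ⟨K, hK1, hK2⟩ := h
    exact ⟨K, hK1, hK2 m rfl⟩
  choose K hKc hK using hK
  refine ⟨{μ : ProbabilityMeasure X | ∀ n, μ (K n)ᶜ ≤ u n},
    isCompact_setOfPred_probabilityMeasure_mass_eq_compl_isCompact_le u_lim hKc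
      (Or.inl inferInstance), fun N => ?_⟩
  have hsub : {x : Fin (N + 1) → X | empirical x ∉ {μ : ProbabilityMeasure X |
      ∀ n, μ (K n)ᶜ ≤ u n}} ⊆ ⋃ n, {x | (u n : ℝ≥0∞) ≤ (empirical x : Measure X) (K n)ᶜ} := by
    intro x hx
    obtain ⟨n, hn⟩ : ∃ n, u n < (empirical x) (K n)ᶜ := by
      by_contra! h
      exact hx h
    refine Set.mem_iUnion.2 ⟨n, ?_⟩
    rw [Set.mem_ofPred_eq, ← ProbabilityMeasure.ennreal_coeFn_eq_coeFn_toMeasure]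
    exact_mod_cast hn.le
  refine (measure_mono hsub).trans ((measure_iUnion_le _).trans (le_trans ?_ hεsum.le))
  refine ENNReal.tsum_le_tsum fun n => ?_
  have hKm : MeasurableSet (K n)ᶜ := (hKc n).measurableSet.compl
  have hind : Measurable ((K n)ᶜ.indicator fun _ => (1 : ℝ≥0∞)) := measurable_const.indicator hKm
  have h1 : ∀ x : Fin (N + 1) → X, (empirical x : Measure X) (K n)ᶜ =
      ∫⁻ z, (K n)ᶜ.indicator (fun _ => 1) z ∂(empirical x : Measure X) := fun x => by
    rw [lintegral_indicator_const hKm, one_mul]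
  have h2 := lintegral_gasProb_empirical_le m hgm hg hGt hG (hB N) hind
  simp_rw [← h1] at h2
  have h3 : Measurable fun x : Fin (N + 1) → X => (empirical x : Measure X) (K n)ᶜ := by
    simp_rw [h1, lintegral_empirical _ hind]
    refine (Finset.measurable_sum _ fun j _ => ?_).const_mul _
    exact hind.comp (measurable_pi_apply j)
  refine (meas_ge_le_lintegral_div h3.aemeasurable (by simpa using (u_pos n).ne') (by simp)).trans ?_
  refine ENNReal.div_le_of_le_mul (h2.trans ?_)
  rw [lintegral_indicator_const hKm, one_mul]
  calc C * m (K n)ᶜ ≤ C * (u n * ε n / C) := by gcongr; exact hK n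
    _ = u n * ε n := ENNReal.mul_div_cancel hC0 hCt
    _ = ε n * u n := mul_comm _ _

/-- Away from `μ` but inside a compact set of high probability, finitely many of the neighbourhoods
from `tendsto_gasProb_empirical_mem` suffice. -/
theorem tendsto_gasProb_empirical_notMem {γ : ℝ} (hγ : 0 ≤ γ) {m : Measure X}
    [IsProbabilityMeasure m] {g : X → X → ℝ≥0∞} (hg : ∀ u x, g u x = g x u)
    (hlsc : LowerSemicontinuous fun q : X × X => g q.1 q.2)
    {G : ℝ≥0∞} (hGt : G ≠ ∞) (hG : ∀ y, ∫⁻ x, g y x ∂m ≤ G)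
    {μ : ProbabilityMeasure X}
    (hI : ∫⁻ y, ∫⁻ z, g y z ∂(μ : Measure X) ∂(μ : Measure X) ≠ ∞) (hH : klDiv (μ : Measure X) m ≠ ∞)
    (hmin : ∀ P : ProbabilityMeasure X, P ≠ μ → refFreeEnergy γ g m μ < refFreeEnergy γ g m P)
    {b : ℕ → ℝ≥0} (hb : Tendsto (fun N => ((N + 1 : ℕ) : ℝ) * b N) atTop (𝓝 γ))
    {O : Set (ProbabilityMeasure X)} (hO : O ∈ 𝓝 μ) :
    Tendsto (fun N => gasProb m g (b N) (N + 1) {x | empirical x ∉ O}) atTop (𝓝 0) := by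
  have hgm : Measurable (Function.uncurry g) := hlsc.measurable
  obtain ⟨B, hB⟩ : ∃ B : ℝ≥0, ∀ N, b N * (N + 1 : ℕ) ≤ B := by
    obtain ⟨B, hB⟩ := hb.bddAbove_range
    refine ⟨B.toNNReal, fun N => ?_⟩
    rw [← NNReal.coe_le_coe]
    refine le_trans ?_ (Real.le_coe_toNNReal B)
    have := hB ⟨N, rfl⟩
    push_cast at this ⊢
    linarith
  obtain ⟨U, hUO, hU, hμU⟩ := mem_nhds_iff.1 hO
  rw [ENNReal.tendsto_nhds_zero]
  intro ε hε
  obtain ⟨𝒦, h𝒦, h𝒦'⟩ := exists_isCompact_gasProb_le m hgm hg hGt hG hB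
    (ENNReal.half_pos hε.ne').ne'
  have hcomp : IsCompact (𝒦 \ U) := h𝒦.diff hU
  have hlim : Tendsto (fun N => gasProb m g (b N) (N + 1) {x | empirical x ∈ 𝒦 \ U}) atTop
      (𝓝 0) := by
    refine hcomp.induction_on (p := fun S => Tendsto (fun N =>
      gasProb m g (b N) (N + 1) {x | empirical x ∈ S}) atTop (𝓝 0)) ?_ ?_ ?_ ?_
    · simp
    · intro S T hST hT
      refine tendsto_of_tendsto_of_tendsto_of_le_of_le tendsto_const_nhds hT (fun _ => zero_le) ?_
      exact fun N => measure_mono fun x hx => hST hx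
    · intro S T hS hT
      have := hS.add hT
      rw [add_zero] at this
      refine tendsto_of_tendsto_of_tendsto_of_le_of_le tendsto_const_nhds this (fun _ => zero_le) ?_
      exact fun N => measure_union_le _ _
    · intro P hP
      have hne : P ≠ μ := fun h => hP.2 (h ▸ hμU)
      obtain ⟨S, hS, hS'⟩ := tendsto_gasProb_empirical_mem hγ hg hlsc hI hH hb (hmin P hne)
      exact ⟨S, mem_nhdsWithin_of_mem_nhds hS, hS'⟩
  filter_upwards [ENNReal.tendsto_nhds_zero.1 hlim (ε / 2) (ENNReal.half_pos hε.ne')] with N hN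
  calc gasProb m g (b N) (N + 1) {x | empirical x ∉ O}
      ≤ gasProb m g (b N) (N + 1) ({x | empirical x ∈ 𝒦 \ U} ∪ {x | empirical x ∉ 𝒦}) := by
        refine measure_mono fun x hx => ?_
        by_cases h : empirical x ∈ 𝒦
        · exact Or.inl ⟨h, fun h' => hx (hUO h')⟩
        · exact Or.inr h
    _ ≤ ε / 2 + ε / 2 := (measure_union_le _ _).trans (add_le_add hN (h𝒦' N))
    _ = ε := ENNReal.add_halves ε

/-- The law of large numbers for the mean-field gas. -/
theorem tendsto_lintegral_gasProb_abs_sub {γ : ℝ} (hγ : 0 ≤ γ) {m : Measure X}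
    [IsProbabilityMeasure m] {g : X → X → ℝ≥0∞} (hg : ∀ u x, g u x = g x u)
    (hlsc : LowerSemicontinuous fun q : X × X => g q.1 q.2)
    {G : ℝ≥0∞} (hGt : G ≠ ∞) (hG : ∀ y, ∫⁻ x, g y x ∂m ≤ G)
    {μ : ProbabilityMeasure X}
    (hI : ∫⁻ y, ∫⁻ z, g y z ∂(μ : Measure X) ∂(μ : Measure X) ≠ ∞) (hH : klDiv (μ : Measure X) m ≠ ∞)
    (hmin : ∀ P : ProbabilityMeasure X, P ≠ μ → refFreeEnergy γ g m μ < refFreeEnergy γ g m P)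
    {b : ℕ → ℝ≥0} (hb : Tendsto (fun N => ((N + 1 : ℕ) : ℝ) * b N) atTop (𝓝 γ))
    (f : X →ᵇ ℝ) :
    Tendsto (fun N => ∫⁻ x, ENNReal.ofReal |∫ z, f z ∂(empirical x : Measure X) -
      ∫ z, f z ∂(μ : Measure X)| ∂(gasProb m g (b N) (N + 1))) atTop (𝓝 0) := by
  have hgm : Measurable (Function.uncurry g) := hlsc.measurable
  rw [ENNReal.tendsto_nhds_zero]
  intro ε hε
  by_cases hεt : ε = ∞
  · simp [hεt]
  obtain ⟨δ, hδ0, hδ⟩ : ∃ δ : ℝ, 0 < δ ∧ ENNReal.ofReal δ = ε / 2 :=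
    ⟨(ε / 2).toReal, ENNReal.toReal_pos (ENNReal.half_pos hε.ne').ne'
      (ENNReal.div_ne_top hεt (by simp)), ENNReal.ofReal_toReal (ENNReal.div_ne_top hεt (by simp))⟩
  set O : Set (ProbabilityMeasure X) := {P | |∫ z, f z ∂(P : Measure X) -
    ∫ z, f z ∂(μ : Measure X)| < δ} with hO
  have hOμ : O ∈ 𝓝 μ := by
    have h1 : Continuous fun P : ProbabilityMeasure X => |∫ z, f z ∂(P : Measure X) -
        ∫ z, f z ∂(μ : Measure X)| :=
      ((ProbabilityMeasure.continuous_integral_boundedContinuousFunction f).sub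
        continuous_const).abs
    exact (isOpen_lt h1 continuous_const).mem_nhds (by simpa [hO] using hδ0)
  have hlim := tendsto_gasProb_empirical_notMem hγ hg hlsc hGt hG hI hH hmin hb hOμ
  have hlim2 := ENNReal.Tendsto.const_mul (a := ENNReal.ofReal (2 * ‖f‖)) hlim
    (Or.inr ENNReal.ofReal_ne_top)
  rw [mul_zero] at hlim2
  have hmeas : ∀ N : ℕ, Measurable fun x : Fin (N + 1) → X =>
      ∫ z, f z ∂(empirical x : Measure X) := fun N => by
    simp_rw [integral_empirical]
    refine (Finset.measurable_sum _ fun j _ => ?_).const_mul _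
    exact f.continuous.measurable.comp (measurable_pi_apply j)
  filter_upwards [ENNReal.tendsto_nhds_zero.1 hlim2 (ε / 2) (ENNReal.half_pos hε.ne')] with N hN
  have := isProbabilityMeasure_gasProb m hgm hg hGt hG (b N) (N + 1)
  have hOm : MeasurableSet {x : Fin (N + 1) → X | empirical x ∉ O} := by
    have : {x : Fin (N + 1) → X | empirical x ∉ O} = {x | δ ≤ |∫ z, f z ∂(empirical x : Measure X) -
        ∫ z, f z ∂(μ : Measure X)|} := by
      ext x; simp [hO]
    rw [this]
    have := hmeas N
    exact measurableSet_le measurable_const (by fun_prop)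
  calc ∫⁻ x, ENNReal.ofReal |∫ z, f z ∂(empirical x : Measure X) -
        ∫ z, f z ∂(μ : Measure X)| ∂(gasProb m g (b N) (N + 1))
      ≤ ∫⁻ x, (ENNReal.ofReal δ + {x | empirical x ∉ O}.indicator
          (fun _ => ENNReal.ofReal (2 * ‖f‖)) x) ∂(gasProb m g (b N) (N + 1)) := by
        refine lintegral_mono fun x => ?_
        -- Off the likely event the deviation is still at most `2‖f‖`, so convergence in probability
        -- gives convergence in mean.
        by_cases hx : empirical x ∈ O
        · exact (ENNReal.ofReal_le_ofReal (le_of_lt hx)).trans le_self_add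
        · rw [Set.indicator_of_mem (by exact hx)]
          refine le_trans (ENNReal.ofReal_le_ofReal ?_) le_add_self
          have h1 : ∀ P : ProbabilityMeasure X, |∫ z, f z ∂(P : Measure X)| ≤ ‖f‖ := fun P =>
            (f.norm_integral_le_norm (P : Measure X))
          calc _ ≤ |∫ z, f z ∂(empirical x : Measure X)| + |∫ z, f z ∂(μ : Measure X)| :=
                abs_sub _ _
            _ ≤ 2 * ‖f‖ := by linarith [h1 (empirical x), h1 μ]
    _ = ENNReal.ofReal δ + ENNReal.ofReal (2 * ‖f‖) *
          gasProb m g (b N) (N + 1) {x | empirical x ∉ O} := by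
        rw [lintegral_add_left measurable_const, lintegral_indicator_const hOm]
        simp
    _ ≤ ε / 2 + ε / 2 := by rw [hδ]; gcongr
    _ = ε := ENNReal.add_halves ε

end LawOfLargeNumbers

end MeanFieldGas

namespace MeanFieldGas

open InformationTheory
open scoped BoundedContinuousFunction

/-! ### Consequences of approximating the kernel by bounded continuous ones -/

section ApproxKernel

variable {X : Type*} [MeasurableSpace X] [TopologicalSpace X]

/-- The kernel `g` is approximated from below, in `L¹(m)` in its second variable and uniformly in
its first one, by bounded continuous kernels which vanish at infinity in the first variable. -/
def IsApproxKernel (g : X → X → ℝ≥0∞) (m : Measure X) : Prop :=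
  ∀ ε : ℝ≥0, 0 < ε → ∃ (k : ℝ≥0) (q : X → X → ℝ≥0), Continuous (Function.uncurry q) ∧
    (∀ u x, q u x ≤ k) ∧ (∀ u x, (q u x : ℝ≥0∞) ≤ g u x) ∧
    (∀ u, ∫⁻ x, (g u x - q u x) ∂m ≤ ε) ∧ ∀ x, Tendsto (fun u => q u x) (cocompact X) (𝓝 0)

theorem IsApproxKernel.exists_lintegral_le {g : X → X → ℝ≥0∞} {m : Measure X}
    [OpensMeasurableSpace X] [IsProbabilityMeasure m] (h : IsApproxKernel g m) :
    ∃ G : ℝ≥0, ∀ u, ∫⁻ x, g u x ∂m ≤ G := by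
  obtain ⟨k, q, hq, hqk, -, hε, -⟩ := h 1 one_pos
  refine ⟨k + 1, fun u => ?_⟩
  have hqm : Measurable fun x => (q u x : ℝ≥0∞) :=
    ((hq.comp (Continuous.prodMk_right u)).measurable).coe_nnreal_ennreal
  calc ∫⁻ x, g u x ∂m ≤ ∫⁻ x, (q u x + (g u x - q u x)) ∂m :=
        lintegral_mono fun x => le_add_tsub
    _ = ∫⁻ x, q u x ∂m + ∫⁻ x, (g u x - q u x) ∂m := lintegral_add_left hqm _
    _ ≤ ∫⁻ _, k ∂m + 1 := by
        gcongr with x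
        · exact_mod_cast hqk u x
        · exact_mod_cast hε u
    _ = ((k + 1 : ℝ≥0) : ℝ≥0∞) := by simp

/-- The approximating kernel is bounded and vanishes at infinity, so dominated convergence applies
to it; the remainder is small uniformly in `u`. -/
theorem IsApproxKernel.tendsto_lintegral_cocompact {g : X → X → ℝ≥0∞} {m : Measure X}
    [OpensMeasurableSpace X] [(cocompact X).IsCountablyGenerated]
    [IsProbabilityMeasure m] (h : IsApproxKernel g m) :
    Tendsto (fun u => ∫⁻ x, g u x ∂m) (cocompact X) (𝓝 0) := by
  rw [ENNReal.tendsto_nhds_zero]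
  intro ε hε
  obtain ⟨δ, hδ0, hδ⟩ : ∃ δ : ℝ≥0, 0 < δ ∧ (δ : ℝ≥0∞) ≤ ε / 2 := by
    obtain ⟨δ, h1, h2⟩ := ENNReal.lt_iff_exists_nnreal_btwn.1 (ENNReal.half_pos hε.ne')
    exact ⟨δ, by exact_mod_cast h1, h2.le⟩
  obtain ⟨k, q, hq, hqk, -, hqε, hq0⟩ := h δ hδ0
  have hqm : ∀ u, Measurable fun x => (q u x : ℝ≥0∞) := fun u =>
    ((hq.comp (Continuous.prodMk_right u)).measurable).coe_nnreal_ennreal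
  have hlim : Tendsto (fun u => ∫⁻ x, (q u x : ℝ≥0∞) ∂m) (cocompact X) (𝓝 (∫⁻ _, 0 ∂m)) := by
    refine tendsto_lintegral_filter_of_dominated_convergence (fun _ => (k : ℝ≥0∞))
      (Eventually.of_forall hqm) (Eventually.of_forall fun u => ae_of_all _ fun x => ?_) (by simp)
      (ae_of_all _ fun x => ?_)
    · exact_mod_cast hqk u x
    · simpa using ENNReal.tendsto_coe.2 (hq0 x)
  rw [lintegral_zero] at hlim
  filter_upwards [ENNReal.tendsto_nhds_zero.1 hlim (ε / 2) (ENNReal.half_pos hε.ne')] with u hu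
  calc ∫⁻ x, g u x ∂m ≤ ∫⁻ x, (q u x + (g u x - q u x)) ∂m :=
        lintegral_mono fun x => le_add_tsub
    _ = ∫⁻ x, q u x ∂m + ∫⁻ x, (g u x - q u x) ∂m := lintegral_add_left (hqm u) _
    _ ≤ ε / 2 + ε / 2 := add_le_add hu ((hqε u).trans hδ)
    _ = ε := ENNReal.add_halves ε

theorem ofReal_abs_expNeg_sub_le {a a' d : ℝ≥0∞} (h1 : a' ≤ a) (h2 : a ≤ a' + d) :
    ENNReal.ofReal |(expNeg a).toReal - (expNeg a').toReal| ≤ d := by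
  have h3 := expNeg_antitone h1
  rw [abs_sub_comm, abs_of_nonneg (sub_nonneg.2 (ENNReal.toReal_mono (expNeg_ne_top _) h3)),
    ENNReal.ofReal_sub _ ENNReal.toReal_nonneg, ENNReal.ofReal_toReal (expNeg_ne_top _),
    ENNReal.ofReal_toReal (expNeg_ne_top _), tsub_le_iff_left]
  exact (expNeg_le_add a' d).trans (by gcongr; exact expNeg_antitone h2)

theorem abs_exp_neg_sub_exp_neg_le {s t : ℝ} (hs : 0 ≤ s) (ht : 0 ≤ t) :
    |Real.exp (-s) - Real.exp (-t)| ≤ |s - t| := by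
  have := abs_exp_sub_exp_le (R := 0) (neg_nonpos.2 hs) (neg_nonpos.2 ht)
  rw [Real.exp_zero, one_mul] at this
  rwa [show -s - -t = -(s - t) by ring, abs_neg] at this

end ApproxKernel

/-! ### Comparing measures through continuous functions -/

section Domination

variable {X : Type*} [MeasurableSpace X] [MetricSpace X] [SecondCountableTopology X]
  [BorelSpace X]

/-- Thickened indicators give the inequality on closed sets, and inner regularity extends it to
Borel sets. -/
theorem le_smul_of_forall_lintegral_le {μ m : Measure X} [IsFiniteMeasure μ] [IsFiniteMeasure m]
    {C : ℝ≥0∞} (hC : C ≠ ∞)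
    (h : ∀ f : X →ᵇ ℝ≥0, ∫⁻ x, f x ∂μ ≤ C * ∫⁻ x, f x ∂m) : μ ≤ C • m := by
  have hclosed : ∀ F : Set X, IsClosed F → μ F ≤ C * m F := fun F hF => by
    have h1 := tendsto_lintegral_thickenedIndicator_of_isClosed μ hF
      (δs := fun n : ℕ => 1 / ((n : ℝ) + 1)) (fun n => by positivity)
      tendsto_one_div_add_atTop_nhds_zero_nat
    have h2 := tendsto_lintegral_thickenedIndicator_of_isClosed m hF
      (δs := fun n : ℕ => 1 / ((n : ℝ) + 1)) (fun n => by positivity)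
      tendsto_one_div_add_atTop_nhds_zero_nat
    exact le_of_tendsto_of_tendsto' h1 (ENNReal.Tendsto.const_mul h2 (Or.inr hC)) fun n => h _
  refine Measure.le_iff.2 fun s hs => ?_
  rw [Measure.smul_apply, smul_eq_mul, hs.measure_eq_iSup_isClosed_of_ne_top (measure_ne_top _ _)]
  refine iSup₂_le fun F hF => iSup_le fun hFc => ?_
  exact (hclosed F hFc).trans (by gcongr)

end Domination

/-! ### Mean interaction with an added particle -/

section SumBounds

variable {X : Type*} [MeasurableSpace X]

theorem lintegral_gasProb_sum_le (m : Measure X) [IsProbabilityMeasure m]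
    {g : X → X → ℝ≥0∞} (hgm : Measurable (Function.uncurry g)) (hg : ∀ u x, g u x = g x u)
    {G : ℝ≥0∞} (hGt : G ≠ ∞) (hG : ∀ y, ∫⁻ x, g y x ∂m ≤ G) {b : ℝ≥0} {N : ℕ} {B : ℝ≥0}
    (hB : b * N ≤ B) {F : X → ℝ≥0∞} (hF : Measurable F) :
    ∫⁻ x, b * ∑ j, F (x j) ∂(gasProb m g b N) ≤ B * ((expNeg (B * G))⁻¹ * ∫⁻ z, F z ∂m) := by
  rw [lintegral_const_mul' _ _ (by simp), lintegral_finsetSum _ fun j _ =>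
    (show Measurable fun x : Fin N → X => F (x j) from hF.comp (measurable_pi_apply j))]
  calc (b : ℝ≥0∞) * ∑ j, ∫⁻ x, F (x j) ∂(gasProb m g b N)
      ≤ b * ∑ _j : Fin N, (expNeg (B * G))⁻¹ * ∫⁻ z, F z ∂m := by
        gcongr with j
        exact lintegral_gasProb_eval_le m hgm hg hGt hG hB j hF
    _ = (b * N) * ((expNeg (B * G))⁻¹ * ∫⁻ z, F z ∂m) := by
        rw [Finset.sum_const, Finset.card_univ, Fintype.card_fin, nsmul_eq_mul, mul_assoc]
    _ ≤ _ := by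
        gcongr
        exact_mod_cast hB

/-- The bound involves `y` only through `∫ g(y, ·) dm`, which vanishes at infinity: a distant
particle hardly feels the gas. -/
theorem lintegral_gasProb_one_sub_expNeg_le (m : Measure X) [IsProbabilityMeasure m]
    {g : X → X → ℝ≥0∞} (hgm : Measurable (Function.uncurry g)) (hg : ∀ u x, g u x = g x u)
    {G : ℝ≥0∞} (hGt : G ≠ ∞) (hG : ∀ y, ∫⁻ x, g y x ∂m ≤ G) {b : ℝ≥0} {N : ℕ} {B : ℝ≥0}
    (hB : b * N ≤ B) (y : X) :
    ∫⁻ x, (1 - expNeg (b * ∑ j, g y (x j))) ∂(gasProb m g b N) ≤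
      B * ((expNeg (B * G))⁻¹ * ∫⁻ z, g y z ∂m) :=
  (lintegral_mono fun _ => one_sub_expNeg_le _).trans
    (lintegral_gasProb_sum_le m hgm hg hGt hG hB (measurable_kernel_left hgm y))

end SumBounds

/-! ### Convergence of the random potential to the mean field -/

section PotentialLimit

variable {X : Type*} [MeasurableSpace X] [MetricSpace X] [SecondCountableTopology X]
  [BorelSpace X]

/-- The marginal bound passes to the limit of the empirical measures. Parts of the kernel that are
small in `L¹(m)` are then small in `L¹(μ)` too. -/
theorem le_smul_of_tendsto_gasProb {m : Measure X} [IsProbabilityMeasure m] {g : X → X → ℝ≥0∞}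
    (hgm : Measurable (Function.uncurry g)) (hg : ∀ u x, g u x = g x u)
    {G : ℝ≥0∞} (hGt : G ≠ ∞) (hG : ∀ y, ∫⁻ x, g y x ∂m ≤ G) {b : ℕ → ℝ≥0} {B : ℝ≥0}
    (hB : ∀ N, b N * (N + 1 : ℕ) ≤ B) {μ : ProbabilityMeasure X}
    (hlln : ∀ f : X →ᵇ ℝ, Tendsto (fun N => ∫⁻ x, ENNReal.ofReal
      |∫ z, f z ∂(empirical x : Measure X) - ∫ z, f z ∂(μ : Measure X)|
        ∂(gasProb m g (b N) (N + 1))) atTop (𝓝 0)) :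
    (μ : Measure X) ≤ (expNeg (B * G))⁻¹ • m := by
  refine le_smul_of_forall_lintegral_le
    (ENNReal.inv_ne_top.2 (expNeg_pos (ENNReal.mul_ne_top (by simp) hGt)).ne') fun f => ?_
  set fr : X →ᵇ ℝ := f.comp _ NNReal.isometry_coe.lipschitz with hfr
  have e : ∀ P : ProbabilityMeasure X, ∫⁻ x, f x ∂(P : Measure X) =
      ENNReal.ofReal (∫ x, fr x ∂(P : Measure X)) := fun P => by
    rw [ofReal_integral_eq_lintegral_ofReal (fr.integrable _) (ae_of_all _ fun x => (f x).coe_nonneg)]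
    refine lintegral_congr fun x => ?_
    simp [hfr]
  have hfm : Measurable fun x => (f x : ℝ≥0∞) := f.continuous.measurable.coe_nnreal_ennreal
  have key : ∀ N, ∫⁻ x, f x ∂(μ : Measure X) ≤ (expNeg (B * G))⁻¹ * ∫⁻ z, f z ∂m +
      ∫⁻ x, ENNReal.ofReal |∫ z, fr z ∂(empirical x : Measure X) - ∫ z, fr z ∂(μ : Measure X)|
        ∂(gasProb m g (b N) (N + 1)) := fun N => by
    have := isProbabilityMeasure_gasProb m hgm hg hGt hG (b N) (N + 1)
    have hmeas : Measurable fun x : Fin (N + 1) → X =>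
        ∫⁻ z, f z ∂(empirical x : Measure X) := by
      simp_rw [lintegral_empirical _ hfm]
      refine (Finset.measurable_sum _ fun j _ => ?_).const_mul _
      exact hfm.comp (measurable_pi_apply j)
    calc ∫⁻ x, f x ∂(μ : Measure X)
        = ∫⁻ _, (∫⁻ x, f x ∂(μ : Measure X)) ∂(gasProb m g (b N) (N + 1)) := by simp
      _ ≤ ∫⁻ x, (∫⁻ z, f z ∂(empirical x : Measure X) + ENNReal.ofReal
            |∫ z, fr z ∂(empirical x : Measure X) - ∫ z, fr z ∂(μ : Measure X)|)
            ∂(gasProb m g (b N) (N + 1)) := by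
          refine lintegral_mono fun x => ?_
          have h0 : 0 ≤ ∫ z, fr z ∂(empirical x : Measure X) :=
            integral_nonneg fun x => (f x).coe_nonneg
          rw [e μ, e (empirical x), ← ENNReal.ofReal_add h0 (abs_nonneg _)]
          refine ENNReal.ofReal_le_ofReal ?_
          linarith [neg_abs_le (∫ z, fr z ∂(empirical x : Measure X) - ∫ z, fr z ∂(μ : Measure X))]
      _ = _ := lintegral_add_left hmeas _
      _ ≤ _ := by
          gcongr
          exact lintegral_gasProb_empirical_le m hgm hg hGt hG (hB N) hfm
  have hlim := (hlln fr).const_add ((expNeg (B * G))⁻¹ * ∫⁻ z, f z ∂m)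
  rw [add_zero] at hlim
  exact ge_of_tendsto' hlim key

/-- The law of large numbers does not apply to the unbounded function `g(y, ·)`. It applies to a
bounded continuous minorant, and the replacement costs little under the gas and under `μ`, both
being dominated by `m`. -/
theorem tendsto_lintegral_gasProb_abs_expNeg_sub {γ : ℝ} (hγ : 0 ≤ γ) {m : Measure X}
    [IsProbabilityMeasure m] {g : X → X → ℝ≥0∞} (hgm : Measurable (Function.uncurry g))
    (hg : ∀ u x, g u x = g x u) (happ : IsApproxKernel g m) {μ : ProbabilityMeasure X}
    {b : ℕ → ℝ≥0} (hb : Tendsto (fun N => ((N + 1 : ℕ) : ℝ) * b N) atTop (𝓝 γ))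
    (hlln : ∀ f : X →ᵇ ℝ, Tendsto (fun N => ∫⁻ x, ENNReal.ofReal
      |∫ z, f z ∂(empirical x : Measure X) - ∫ z, f z ∂(μ : Measure X)|
        ∂(gasProb m g (b N) (N + 1))) atTop (𝓝 0)) (y : X) :
    Tendsto (fun N => ∫⁻ x, ENNReal.ofReal |(expNeg (b N * ∑ j, g y (x j))).toReal -
      (expNeg (ENNReal.ofReal γ * ∫⁻ z, g y z ∂(μ : Measure X))).toReal|
        ∂(gasProb m g (b N) (N + 1))) atTop (𝓝 0) := by
  obtain ⟨G, hG⟩ := happ.exists_lintegral_le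
  obtain ⟨B, hB, hγB⟩ : ∃ B : ℝ≥0, (∀ N, b N * (N + 1 : ℕ) ≤ B) ∧ γ ≤ B := by
    obtain ⟨B, hB⟩ := hb.bddAbove_range
    have h1 : ∀ N, ((b N * (N + 1 : ℕ) : ℝ≥0) : ℝ) ≤ B := fun N => by
      have := hB ⟨N, rfl⟩
      push_cast at this ⊢
      linarith
    refine ⟨B.toNNReal, fun N => ?_, ?_⟩
    · rw [← NNReal.coe_le_coe]
      exact (h1 N).trans (Real.le_coe_toNNReal B)
    · refine (le_of_tendsto' hb fun N => ?_).trans (Real.le_coe_toNNReal B)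
      exact hB ⟨N, rfl⟩
  have hGt : (G : ℝ≥0∞) ≠ ∞ := ENNReal.coe_ne_top
  set C := (expNeg (B * G))⁻¹ with hC
  have hCt : C ≠ ∞ := ENNReal.inv_ne_top.2 (expNeg_pos (ENNReal.mul_ne_top (by simp) hGt)).ne'
  have hμC : (μ : Measure X) ≤ C • m := le_smul_of_tendsto_gasProb hgm hg hGt hG hB hlln
  rw [ENNReal.tendsto_nhds_zero]
  intro ε hε
  have hε3 : ε / 3 ≠ 0 := (ENNReal.div_pos hε.ne' (by simp)).ne'
  -- `B * (C * δ)` bounds the replacement error both under the gas and under `μ`.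
  obtain ⟨δ, hδ0, hδ⟩ : ∃ δ : ℝ≥0, 0 < δ ∧ (B : ℝ≥0∞) * (C * δ) ≤ ε / 3 := by
    have h1 : Tendsto (fun d : ℝ≥0 => (B : ℝ≥0∞) * (C * d)) (𝓝[>] 0) (𝓝 (B * (C * (0 : ℝ≥0)))) := by
      refine Tendsto.mono_left ?_ nhdsWithin_le_nhds
      refine ENNReal.Tendsto.const_mul (ENNReal.Tendsto.const_mul ?_ (Or.inr hCt)) (Or.inr (by simp))
      exact ENNReal.tendsto_coe.2 tendsto_id
    simp only [ENNReal.coe_zero, mul_zero] at h1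
    obtain ⟨d, hd1, hd2⟩ := ((ENNReal.tendsto_nhds_zero.1 h1 (ε / 3) (pos_iff_ne_zero.2 hε3)).and
      self_mem_nhdsWithin).exists
    exact ⟨d, hd2, hd1⟩
  obtain ⟨k, q, hq, hqk, hqg, hqε, -⟩ := happ δ hδ0
  have hqyc : Continuous fun x => (q y x : ℝ) :=
    NNReal.continuous_coe.comp (hq.comp (Continuous.prodMk_right y))
  set f : X →ᵇ ℝ := BoundedContinuousFunction.ofNormedAddCommGroup (fun x => (q y x : ℝ)) hqyc k
    (fun x => by rw [Real.norm_eq_abs, NNReal.abs_eq]; exact_mod_cast hqk y x) with hf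
  have hf_apply : ∀ x, f x = q y x := fun x => rfl
  have hqm : Measurable fun x => (q y x : ℝ≥0∞) :=
    ((hq.comp (Continuous.prodMk_right y)).measurable).coe_nnreal_ennreal
  have hdm : Measurable fun x => g y x - q y x := (measurable_kernel_left hgm y).sub hqm
  have hγB' : ENNReal.ofReal γ ≤ B := by
    rw [← ENNReal.ofReal_coe_nnreal]; exact ENNReal.ofReal_le_ofReal hγB
  have hfμ0 : 0 ≤ ∫ z, f z ∂(μ : Measure X) := integral_nonneg fun z => (q y z).coe_nonneg
  have hfμk : ∫ z, f z ∂(μ : Measure X) ≤ k := by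
    calc ∫ z, f z ∂(μ : Measure X) ≤ ∫ _, (k : ℝ) ∂(μ : Measure X) :=
          integral_mono (f.integrable _) (integrable_const _) fun z => by
            rw [hf_apply]; exact_mod_cast hqk y z
      _ = k := by simp
  have hqμ : ∫⁻ z, q y z ∂(μ : Measure X) = ENNReal.ofReal (∫ z, f z ∂(μ : Measure X)) := by
    rw [ofReal_integral_eq_lintegral_ofReal (f.integrable _)
      (ae_of_all _ fun z => (q y z).coe_nonneg)]
    simp [hf_apply]
  -- the three error terms
  set t := (expNeg (ENNReal.ofReal γ * ∫⁻ z, g y z ∂(μ : Measure X))).toReal with ht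
  set t' := (expNeg (ENNReal.ofReal γ * ∫⁻ z, q y z ∂(μ : Measure X))).toReal with ht'
  have hterm3 : ENNReal.ofReal |t' - t| ≤ ε / 3 := by
    rw [abs_sub_comm]
    refine (ofReal_abs_expNeg_sub_le (d := ENNReal.ofReal γ *
      ∫⁻ z, (g y z - q y z) ∂(μ : Measure X)) ?_ ?_).trans ?_
    · gcongr with z
      exact hqg y z
    · rw [← mul_add, ← lintegral_add_left hqm]
      gcongr with z
      exact le_add_tsub
    · calc ENNReal.ofReal γ * ∫⁻ z, (g y z - q y z) ∂(μ : Measure X)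
          ≤ B * ∫⁻ z, (g y z - q y z) ∂(C • m) := by gcongr
        _ ≤ B * (C * δ) := by
            rw [lintegral_smul_measure, smul_eq_mul]
            gcongr
            exact hqε y
        _ ≤ ε / 3 := hδ
  have hterm2 : Tendsto (fun N : ℕ => ENNReal.ofReal |((N + 1 : ℕ) : ℝ) * b N - γ| *
      ENNReal.ofReal k + B * ∫⁻ x, ENNReal.ofReal
      |∫ z, f z ∂(empirical x : Measure X) - ∫ z, f z ∂(μ : Measure X)|
        ∂(gasProb m g (b N) (N + 1))) atTop (𝓝 0) := by
    have h1 : Tendsto (fun N : ℕ => ENNReal.ofReal |((N + 1 : ℕ) : ℝ) * b N - γ|) atTop (𝓝 0) := by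
      have := ENNReal.tendsto_ofReal (hb.sub_const γ).abs
      simpa using this
    have h2 := (ENNReal.Tendsto.mul_const h1 (Or.inr (ENNReal.ofReal_ne_top (r := k)))).add
      (ENNReal.Tendsto.const_mul (hlln f) (Or.inr (ENNReal.coe_ne_top (r := B))))
    simpa using h2
  filter_upwards [ENNReal.tendsto_nhds_zero.1 hterm2 (ε / 3) (pos_iff_ne_zero.2 hε3)] with N hN
  have := isProbabilityMeasure_gasProb m hgm hg hGt hG (b N) (N + 1)
  have hBN : ((N + 1 : ℕ) : ℝ) * b N ≤ B := by
    have := NNReal.coe_le_coe.2 (hB N)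
    push_cast at this ⊢
    linarith
  have hpoint : ∀ x : Fin (N + 1) → X,
      ENNReal.ofReal |(expNeg (b N * ∑ j, g y (x j))).toReal - t| ≤
        b N * ∑ j, (g y (x j) - q y (x j)) +
        (ENNReal.ofReal |((N + 1 : ℕ) : ℝ) * b N - γ| * ENNReal.ofReal k +
          B * ENNReal.ofReal
            |∫ z, f z ∂(empirical x : Measure X) - ∫ z, f z ∂(μ : Measure X)|) + ε / 3 := by
    intro x
    set s := (expNeg (b N * ∑ j, g y (x j))).toReal with hs
    set s' := (expNeg (b N * ∑ j, (q y (x j) : ℝ≥0∞))).toReal with hs'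
    have h1 : ENNReal.ofReal |s - s'| ≤ b N * ∑ j, (g y (x j) - q y (x j)) := by
      refine ofReal_abs_expNeg_sub_le ?_ ?_
      · gcongr with j
        exact hqg _ _
      · rw [← mul_add, ← Finset.sum_add_distrib]
        gcongr with j
        exact le_add_tsub
    have h2 : |s' - t'| ≤ |((N + 1 : ℕ) : ℝ) * b N - γ| * k +
        B * |∫ z, f z ∂(empirical x : Measure X) - ∫ z, f z ∂(μ : Measure X)| := by
      have e1 : s' = Real.exp (-(((N + 1 : ℕ) : ℝ) * b N *
          ∫ z, f z ∂(empirical x : Measure X))) := by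
        have : ((b N : ℝ≥0∞) * ∑ j, (q y (x j) : ℝ≥0∞)) ≠ ∞ := by
          refine ENNReal.mul_ne_top (by simp) ?_
          simp
        rw [hs', toReal_expNeg this, integral_empirical]
        congr 2
        rw [ENNReal.toReal_mul, ENNReal.toReal_sum (by simp)]
        simp only [ENNReal.coe_toReal, hf_apply]
        have : ((N + 1 : ℕ) : ℝ) ≠ 0 := by positivity
        field_simp
      have e2 : t' = Real.exp (-(γ * ∫ z, f z ∂(μ : Measure X))) := by
        rw [ht', hqμ, ← ENNReal.ofReal_mul hγ, toReal_expNeg ENNReal.ofReal_ne_top,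
          ENNReal.toReal_ofReal (by positivity)]
      have hfe0 : 0 ≤ ∫ z, f z ∂(empirical x : Measure X) :=
        integral_nonneg fun z => (q y z).coe_nonneg
      rw [e1, e2]
      refine (abs_exp_neg_sub_exp_neg_le (by positivity) (by positivity)).trans ?_
      set A := ∫ z, f z ∂(empirical x : Measure X)
      set A' := ∫ z, f z ∂(μ : Measure X)
      calc |((N + 1 : ℕ) : ℝ) * b N * A - γ * A'|
          = |(((N + 1 : ℕ) : ℝ) * b N - γ) * A' + ((N + 1 : ℕ) : ℝ) * b N * (A - A')| := by ring_nf
        _ ≤ |((N + 1 : ℕ) : ℝ) * b N - γ| * |A'| + ((N + 1 : ℕ) : ℝ) * b N * |A - A'| := by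
            refine (abs_add_le _ _).trans ?_
            rw [abs_mul, abs_mul (((N + 1 : ℕ) : ℝ) * b N),
              abs_of_nonneg (a := ((N + 1 : ℕ) : ℝ) * b N) (by positivity)]
        _ ≤ _ := by
            rw [abs_of_nonneg hfμ0]
            gcongr
    have h2' : ENNReal.ofReal |s' - t'| ≤ ENNReal.ofReal |((N + 1 : ℕ) : ℝ) * b N - γ| *
        ENNReal.ofReal k + B * ENNReal.ofReal
          |∫ z, f z ∂(empirical x : Measure X) - ∫ z, f z ∂(μ : Measure X)| := by
      refine (ENNReal.ofReal_le_ofReal h2).trans (le_of_eq ?_)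
      rw [ENNReal.ofReal_add (by positivity) (by positivity), ENNReal.ofReal_mul (abs_nonneg _),
        ENNReal.ofReal_mul B.coe_nonneg, ENNReal.ofReal_coe_nnreal (p := B)]
    calc ENNReal.ofReal |s - t| ≤ ENNReal.ofReal (|s - s'| + |s' - t'| + |t' - t|) := by
          refine ENNReal.ofReal_le_ofReal ?_
          have := abs_sub_le s s' t
          have := abs_sub_le s' t' t
          linarith
      _ = ENNReal.ofReal |s - s'| + ENNReal.ofReal |s' - t'| + ENNReal.ofReal |t' - t| := by
          rw [ENNReal.ofReal_add (by positivity) (by positivity),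
            ENNReal.ofReal_add (by positivity) (by positivity)]
      _ ≤ _ := add_le_add (add_le_add h1 h2') hterm3
  have hdm' : Measurable fun x : Fin (N + 1) → X => (b N : ℝ≥0∞) * ∑ j, (g y (x j) - q y (x j)) :=
    (Finset.measurable_sum _ fun j _ => (show Measurable fun x : Fin (N + 1) → X =>
      g y (x j) - q y (x j) from hdm.comp (measurable_pi_apply j))).const_mul _
  calc ∫⁻ x, ENNReal.ofReal |(expNeg (b N * ∑ j, g y (x j))).toReal - t|
        ∂(gasProb m g (b N) (N + 1))
      ≤ _ := lintegral_mono hpoint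
    _ = ∫⁻ x, b N * ∑ j, (g y (x j) - q y (x j)) ∂(gasProb m g (b N) (N + 1)) +
        (ENNReal.ofReal |((N + 1 : ℕ) : ℝ) * b N - γ| * ENNReal.ofReal k +
          B * ∫⁻ x, ENNReal.ofReal
            |∫ z, f z ∂(empirical x : Measure X) - ∫ z, f z ∂(μ : Measure X)|
            ∂(gasProb m g (b N) (N + 1))) + ε / 3 := by
        rw [lintegral_add_right _ measurable_const, lintegral_add_left hdm',
          lintegral_add_left measurable_const, lintegral_const_mul' (B : ℝ≥0∞) _ (by simp)]
        simp only [lintegral_const, measure_univ, mul_one]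
    _ ≤ ε / 3 + ε / 3 + ε / 3 := by
        gcongr
        refine (lintegral_gasProb_sum_le m hgm hg hGt hG (hB N) hdm).trans (le_trans ?_ hδ)
        gcongr
        exact hqε y
    _ = ε := ENNReal.add_thirds ε

end PotentialLimit

end MeanFieldGas

namespace MeanFieldGas

/-! ### Removing a particle -/

section Removal

variable {X : Type*} [MeasurableSpace X]

theorem measurable_weight {g : X → X → ℝ≥0∞} (hgm : Measurable (Function.uncurry g)) (b : ℝ≥0)
    (N : ℕ) : Measurable fun q : X × (Fin N → X) => (expNeg (b * ∑ j, g q.1 (q.2 j))).toReal :=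
  (measurable_expNeg.comp ((measurable_sum_kernel hgm).const_mul _)).ennreal_toReal

theorem toReal_expNeg_le_one (a : ℝ≥0∞) : (expNeg a).toReal ≤ 1 :=
  ENNReal.toReal_le_of_le_ofReal zero_le_one (by simpa using expNeg_le_one a)

theorem integral_integral_eq_toReal {Y : Type*} [MeasurableSpace Y] (m : Measure X) (P : Measure Y)
    [IsFiniteMeasure m] [IsFiniteMeasure P] {f : X × Y → ℝ} (hf : Measurable f) {R : ℝ}
    (h0 : ∀ q, 0 ≤ f q) (hR : ∀ q, f q ≤ R) :
    ∫ y, ∫ x, f (y, x) ∂P ∂m = (∫⁻ y, ∫⁻ x, ENNReal.ofReal (f (y, x)) ∂P ∂m).toReal := by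
  have hint : Integrable f (m.prod P) :=
    Integrable.of_bound hf.aestronglyMeasurable R (ae_of_all _ fun q => by
      rw [Real.norm_eq_abs, abs_of_nonneg (h0 q)]; exact hR q)
  rw [← integral_prod _ hint, integral_eq_lintegral_of_nonneg_ae (ae_of_all _ h0)
    hf.aestronglyMeasurable, lintegral_prod _ hf.ennreal_ofReal.aemeasurable]

/-- Removing one particle from the gas. -/
theorem integral_gasProb_succ (m : Measure X) [IsProbabilityMeasure m] {g : X → X → ℝ≥0∞}
    (hgm : Measurable (Function.uncurry g)) (hg : ∀ u x, g u x = g x u)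
    {G : ℝ≥0∞} (hGt : G ≠ ∞) (hG : ∀ y, ∫⁻ x, g y x ∂m ≤ G) (b : ℝ≥0) {N : ℕ} (i : Fin (N + 1))
    {F : (Fin (N + 1) → X) → ℝ} (hF : Measurable F) {R : ℝ} (h0 : ∀ x, 0 ≤ F x)
    (hR : ∀ x, F x ≤ R) :
    ∫ x, F x ∂(gasProb m g b (N + 1)) =
      ((gas m g b N Set.univ).toReal / (gas m g b (N + 1) Set.univ).toReal) *
        ∫ y, ∫ x, F (i.insertNth y x : Fin (N + 1) → X) * (expNeg (b * ∑ j, g y (x j))).toReal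
          ∂(gasProb m g b N) ∂m := by
  have := isProbabilityMeasure_gasProb m hgm hg hGt hG b N
  have hZ := gas_univ_pos m hgm hg hGt hG b N
  have hw := measurable_weight hgm b N
  have hFi : Measurable fun q : X × (Fin N → X) => F (i.insertNth q.1 q.2) :=
    hF.comp (measurable_insertNth i)
  rw [integral_integral_eq_toReal m (gasProb m g b N)
    (f := fun q => F (i.insertNth q.1 q.2) * (expNeg (b * ∑ j, g q.1 (q.2 j))).toReal)
    (hFi.mul hw) (R := R) (fun q => mul_nonneg (h0 _) ENNReal.toReal_nonneg)
    (fun q => (mul_le_of_le_one_right (h0 _) (toReal_expNeg_le_one _)).trans (hR _)),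
    integral_eq_lintegral_of_nonneg_ae (ae_of_all _ h0) hF.aestronglyMeasurable]
  simp_rw [ENNReal.ofReal_mul (h0 _), ENNReal.ofReal_toReal (expNeg_ne_top _)]
  rw [gasProb, gasProb, lintegral_smul_measure, lintegral_gas_succ m hgm hg b i hF.ennreal_ofReal]
  simp_rw [lintegral_smul_measure, smul_eq_mul]
  rw [lintegral_const_mul' _ _ (ENNReal.inv_ne_top.2 hZ.ne')]
  rw [ENNReal.toReal_mul, ENNReal.toReal_mul, ENNReal.toReal_inv, ENNReal.toReal_inv]
  have hZ' : (gas m g b N Set.univ).toReal ≠ 0 := (ENNReal.toReal_pos hZ.ne' (measure_ne_top _ _)).ne'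
  field_simp

end Removal

/-! ### A differential inequality for the Laplace functional -/

section Laplace

variable {X : Type*}

theorem prod_one_sub_mem {N : ℕ} {h : X → ℝ} (h0 : ∀ x, 0 ≤ h x) (h1 : ∀ x, h x ≤ 1) {t : ℝ}
    (ht0 : 0 ≤ t) (ht1 : t ≤ 1) (s : Finset (Fin N)) (x : Fin N → X) :
    0 ≤ ∏ j ∈ s, (1 - t * h (x j)) ∧ ∏ j ∈ s, (1 - t * h (x j)) ≤ 1 := by
  have h2 : ∀ z, 0 ≤ 1 - t * h z := fun z => by nlinarith [h0 z, h1 z]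
  have h3 : ∀ z, 1 - t * h z ≤ 1 := fun z => by nlinarith [h0 z, h1 z]
  exact ⟨Finset.prod_nonneg fun j _ => h2 _, Finset.prod_le_one (fun j _ => h2 _) fun j _ => h3 _⟩

theorem prod_erase_insertNth {N : ℕ} (f : X → ℝ) (i : Fin (N + 1)) (y : X) (x : Fin N → X) :
    ∏ j ∈ Finset.univ.erase i, f ((i.insertNth y x : Fin (N + 1) → X) j) = ∏ j, f (x j) := by
  have h : Finset.univ.erase i = Finset.univ.image i.succAbove := by
    rw [Fin.image_succAbove_univ]
    ext j; simp
  rw [h, Finset.prod_image fun a _ b _ hab => Fin.succAbove_right_injective hab]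
  simp

variable [MeasurableSpace X]

theorem measurable_prod_one_sub {N : ℕ} {h : X → ℝ} (hm : Measurable h) (t : ℝ)
    (s : Finset (Fin N)) : Measurable fun x : Fin N → X => ∏ j ∈ s, (1 - t * h (x j)) :=
  Finset.measurable_prod _ fun j _ =>
    measurable_const.sub ((hm.comp (measurable_pi_apply j)).const_mul t)

theorem hasDerivAt_integral_prod_one_sub {N : ℕ} (P : Measure (Fin N → X)) [IsFiniteMeasure P]
    {h : X → ℝ} (hm : Measurable h) (h0 : ∀ x, 0 ≤ h x) (h1 : ∀ x, h x ≤ 1) (t₀ : ℝ) :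
    HasDerivAt (fun t => ∫ x, ∏ j, (1 - t * h (x j)) ∂P)
      (∫ x, ∑ i, (∏ j ∈ Finset.univ.erase i, (1 - t₀ * h (x j))) * (-h (x i)) ∂P) t₀ := by
  have hc1 : 1 ≤ |t₀| + 2 := by linarith [abs_nonneg t₀]
  have hb : ∀ t ∈ Metric.ball t₀ 1, ∀ x, |1 - t * h x| ≤ |t₀| + 2 := fun t ht x => by
    have h2 : |t - t₀| < 1 := by simpa [Real.dist_eq] using ht
    have h3 : |t| ≤ |t₀| + 1 := by
      have := abs_sub_abs_le_abs_sub t t₀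
      linarith
    calc |1 - t * h x| ≤ |1| + |t * h x| := abs_sub _ _
      _ = 1 + |t| * h x := by rw [abs_one, abs_mul, abs_of_nonneg (h0 x)]
      _ ≤ 1 + |t| * 1 := by gcongr; exact h1 x
      _ ≤ _ := by linarith
  have hpb : ∀ t ∈ Metric.ball t₀ 1, ∀ (s : Finset (Fin N)) (x : Fin N → X),
      |∏ j ∈ s, (1 - t * h (x j))| ≤ (|t₀| + 2) ^ N := fun t ht s x => by
    rw [Finset.abs_prod]
    calc ∏ j ∈ s, |1 - t * h (x j)| ≤ ∏ j ∈ s, (|t₀| + 2) :=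
          Finset.prod_le_prod (fun _ _ => abs_nonneg _) fun j _ => hb t ht _
      _ = (|t₀| + 2) ^ s.card := by simp
      _ ≤ (|t₀| + 2) ^ N := pow_le_pow_right₀ hc1 (by simpa using s.card_le_univ)
  have ht₀ : t₀ ∈ Metric.ball t₀ 1 := Metric.mem_ball_self one_pos
  refine (hasDerivAt_integral_of_dominated_loc_of_deriv_le
    (F' := fun t (x : Fin N → X) => ∑ i, (∏ j ∈ Finset.univ.erase i, (1 - t * h (x j))) * (-h (x i)))
    (bound := fun _ => N * (|t₀| + 2) ^ N) (Metric.ball_mem_nhds t₀ one_pos) ?_ ?_ ?_ ?_ ?_ ?_).2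
  · exact Eventually.of_forall fun t => (measurable_prod_one_sub hm t _).aestronglyMeasurable
  · exact Integrable.of_bound (measurable_prod_one_sub hm t₀ _).aestronglyMeasurable _
      (ae_of_all _ fun x => hpb t₀ ht₀ _ x)
  · refine (Finset.measurable_sum _ fun i _ => ?_).aestronglyMeasurable
    exact (measurable_prod_one_sub hm t₀ _).mul (hm.comp (measurable_pi_apply i)).neg
  · refine ae_of_all _ fun x t ht => ?_
    calc ‖∑ i, (∏ j ∈ Finset.univ.erase i, (1 - t * h (x j))) * (-h (x i))‖
        ≤ ∑ i, ‖(∏ j ∈ Finset.univ.erase i, (1 - t * h (x j))) * (-h (x i))‖ := norm_sum_le _ _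
      _ ≤ ∑ _i : Fin N, (|t₀| + 2) ^ N := by
          refine Finset.sum_le_sum fun i _ => ?_
          rw [Real.norm_eq_abs, abs_mul, abs_neg, abs_of_nonneg (h0 _)]
          calc _ ≤ (|t₀| + 2) ^ N * 1 := by
                exact mul_le_mul (hpb t ht _ x) (h1 _) (h0 _) (by positivity)
            _ = _ := mul_one _
      _ = _ := by simp
  · exact integrable_const _
  · refine ae_of_all _ fun x t _ => ?_
    have := HasDerivAt.fun_finsetProd (u := Finset.univ) (f := fun (j : Fin N) t => 1 - t * h (x j))
      (f' := fun j => -h (x j)) (x := t) fun j _ => by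
        simpa using ((hasDerivAt_id t).mul_const (h (x j))).const_sub 1
    simpa [smul_eq_mul] using this

/-- Grönwall with the integrating factor `e^{τt}`: the derivative of `e^{τt} A(t)` is at most `e^τ
ε` on `[0, 1]`, and the factor `e^τ` cancels at `t = 1`. -/
theorem abs_sub_exp_neg_le_of_deriv {A D : ℝ → ℝ} {τ ε : ℝ} (hτ : 0 ≤ τ)
    (hA : ∀ t, HasDerivAt A (-D t) t) (hA0 : A 0 = 1)
    (hD : ∀ t, 0 ≤ t → t ≤ 1 → |D t - τ * A t| ≤ ε) : |A 1 - Real.exp (-τ)| ≤ ε := by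
  have hε : 0 ≤ ε := (abs_nonneg _).trans (hD 0 le_rfl zero_le_one)
  set φ : ℝ → ℝ := fun t => Real.exp (τ * t) * A t with hφ
  have hφ' : ∀ t, HasDerivAt φ (Real.exp (τ * t) * (τ * A t - D t)) t := fun t => by
    have h1 : HasDerivAt (fun t => Real.exp (τ * t)) (Real.exp (τ * t) * τ) t := by
      simpa using ((hasDerivAt_id t).const_mul τ).exp
    convert! h1.mul (hA t) using 1
    ring
  have hbound : ∀ t ∈ Set.Icc (0 : ℝ) 1, ‖Real.exp (τ * t) * (τ * A t - D t)‖ ≤ Real.exp τ * ε := by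
    intro t ht
    rw [norm_mul, Real.norm_eq_abs, Real.norm_eq_abs, Real.abs_exp, abs_sub_comm]
    refine mul_le_mul (Real.exp_le_exp.2 ?_) (hD t ht.1 ht.2) (abs_nonneg _) (Real.exp_nonneg _)
    nlinarith [ht.1, ht.2]
  have h1 := (convex_Icc (0 : ℝ) 1).norm_image_sub_le_of_norm_hasDerivWithin_le
    (fun t _ => (hφ' t).hasDerivWithinAt) hbound (Set.left_mem_Icc.2 zero_le_one)
    (Set.right_mem_Icc.2 zero_le_one)
  have h2 : φ 1 - φ 0 = Real.exp τ * (A 1 - Real.exp (-τ)) := by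
    simp only [hφ, mul_one, mul_zero, Real.exp_zero, hA0, mul_sub, ← Real.exp_add]
    simp
  rw [h2, norm_mul, Real.norm_eq_abs, Real.norm_eq_abs, Real.abs_exp] at h1
  simp only [sub_zero, norm_one, mul_one] at h1
  exact le_of_mul_le_mul_left h1 (Real.exp_pos τ)

theorem abs_sub_sub_le {x y z u v w : ℝ} (hx : |x| ≤ u) (hy : |y| ≤ v) (hz : |z| ≤ w) :
    |x - y - z| ≤ u + v + w := by
  rw [abs_le] at *
  constructor <;> linarith

/-- Bookkeeping for the passage from `N + 1` to `N` particles: `u` is the weighted functional, `v`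
its part carrying `h`, `L` the integral of the mean-field weight, and `A'` the functional with one
particle fewer. -/
theorem abs_mul_sub_sub_le {κ t u v H A' L ξ : ℝ} (hκ : 0 ≤ κ) (ht0 : 0 ≤ t) (ht1 : t ≤ 1)
    (hA0 : 0 ≤ A') (hA1 : A' ≤ 1) (hv0 : 0 ≤ v) (hv : v ≤ H) (hu : |u - L * A'| ≤ ξ)
    (hL : |1 - κ * L| ≤ κ * ξ) : |κ * (u - t * v) - A'| ≤ κ * (2 * ξ + H) := by
  have e : κ * (u - t * v) - A' = κ * (u - L * A') - κ * (t * v) - (1 - κ * L) * A' := by ring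
  have h8 : |κ * (u - L * A')| ≤ κ * ξ := by
    rw [abs_mul, abs_of_nonneg hκ]; gcongr
  have h9 : |κ * (t * v)| ≤ κ * H := by
    rw [abs_of_nonneg (by positivity)]
    exact mul_le_mul_of_nonneg_left ((mul_le_of_le_one_left hv0 ht1).trans hv) hκ
  have h10 : |(1 - κ * L) * A'| ≤ κ * ξ := by
    rw [abs_mul, abs_of_nonneg hA0]
    exact (mul_le_of_le_one_right (abs_nonneg _) hA1).trans hL
  rw [e]
  refine (abs_sub_sub_le h8 h9 h10).trans_eq ?_
  ring

theorem abs_sub_mul_le {D c A A' p q : ℝ} (hc : 0 ≤ c) (h1 : |D - c * A'| ≤ p)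
    (h2 : |A - A'| ≤ q) : |D - c * A| ≤ p + c * q := by
  have e : D - c * A = (D - c * A') - c * (A - A') := by ring
  rw [e]
  refine (abs_sub _ _).trans (add_le_add h1 ?_)
  rw [abs_mul, abs_of_nonneg hc]
  exact mul_le_mul_of_nonneg_left h2 hc

theorem integrable_of_nonneg_of_le {Y : Type*} [MeasurableSpace Y] {P : Measure Y}
    [IsFiniteMeasure P] {f : Y → ℝ} (hf : Measurable f) {R : ℝ} (h : ∀ y, |f y| ≤ R) :
    Integrable f P := Integrable.of_bound hf.aestronglyMeasurable R (ae_of_all _ h)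

/-- Comparison of the Laplace functional of the gas with that of a Poisson process. -/
theorem abs_integral_prod_sub_exp_le (m : Measure X) [IsProbabilityMeasure m]
    {g : X → X → ℝ≥0∞} (hgm : Measurable (Function.uncurry g)) (hg : ∀ u x, g u x = g x u)
    {G : ℝ≥0∞} (hGt : G ≠ ∞) (hG : ∀ y, ∫⁻ x, g y x ∂m ≤ G) (b : ℝ≥0) (N : ℕ)
    {h : X → ℝ} (hm : Measurable h) (h0 : ∀ x, 0 ≤ h x) (h1 : ∀ x, h x ≤ 1)
    {l : X → ℝ} (hl : Measurable l) (hl0 : ∀ x, 0 ≤ l x) (hl1 : ∀ x, l x ≤ 1) {η ξ κ T : ℝ}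
    (hκ : κ = (gas m g b N Set.univ).toReal / (gas m g b (N + 1) Set.univ).toReal)
    (hT : T = ((N + 1 : ℕ) : ℝ) * ∫ y, h y ∂m)
    (hη : ∀ y, h y ≠ 0 →
      ∫ x, (1 - (expNeg (b * ∑ j, g y (x j))).toReal) ∂(gasProb m g b N) ≤ η)
    (hξ : ∫ y, ∫ x, |(expNeg (b * ∑ j, g y (x j))).toReal - l y| ∂(gasProb m g b N) ∂m ≤ ξ) :
    |1 - κ * ∫ y, l y ∂m| ≤ κ * ξ ∧
    |∫ x, ∏ j, (1 - h (x j)) ∂(gasProb m g b (N + 1)) - Real.exp (-(κ * T))| ≤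
      κ * T * η + κ * T * (κ * (2 * ξ + T / ((N + 1 : ℕ) : ℝ))) := by
  have hP := isProbabilityMeasure_gasProb m hgm hg hGt hG b N
  have hP' := isProbabilityMeasure_gasProb m hgm hg hGt hG b (N + 1)
  set P := gasProb m g b N with hPdef
  set w : X → (Fin N → X) → ℝ := fun y x => (expNeg (b * ∑ j, g y (x j))).toReal with hwdef
  have hw : Measurable (Function.uncurry w) := measurable_weight hgm b N
  have hwy : ∀ y, Measurable (w y) := fun y => hw.of_uncurry_left
  have hw0 : ∀ y x, 0 ≤ w y x := fun y x => ENNReal.toReal_nonneg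
  have hw1 : ∀ y x, w y x ≤ 1 := fun y x => toReal_expNeg_le_one _
  have hκ0 : 0 ≤ κ := by rw [hκ]; positivity
  have hih : 0 ≤ ∫ y, h y ∂m := integral_nonneg h0
  have hT0 : 0 ≤ T := by rw [hT]; positivity
  have hhint : Integrable h m := integrable_of_nonneg_of_le hm fun y => by
    rw [abs_of_nonneg (h0 y)]; exact h1 y
  set Λ : ℝ → (Fin N → X) → ℝ := fun t x => ∏ j, (1 - t * h (x j)) with hΛ
  have hΛm : ∀ t, Measurable (Λ t) := fun t => measurable_prod_one_sub hm t _
  set a : ℝ → X → ℝ := fun t y => ∫ x, Λ t x * w y x ∂P with ha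
  have ham : ∀ t, Measurable (a t) := fun t => by
    have h2 : Measurable fun q : X × (Fin N → X) => Λ t q.2 * w q.1 q.2 :=
      ((hΛm t).comp measurable_snd).mul hw
    exact (h2.stronglyMeasurable.integral_prod_right').measurable
  -- estimates for fixed `t ∈ [0,1]`
  have hΛ01 : ∀ t, 0 ≤ t → t ≤ 1 → ∀ x, 0 ≤ Λ t x ∧ Λ t x ≤ 1 := fun t ht0 ht1 x =>
    prod_one_sub_mem h0 h1 ht0 ht1 _ x
  have hΛi : ∀ t, 0 ≤ t → t ≤ 1 → Integrable (Λ t) P := fun t ht0 ht1 =>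
    integrable_of_nonneg_of_le (hΛm t) fun x => by
      rw [abs_of_nonneg (hΛ01 t ht0 ht1 x).1]; exact (hΛ01 t ht0 ht1 x).2
  have hΛw : ∀ t, 0 ≤ t → t ≤ 1 → ∀ y, Integrable (fun x => Λ t x * w y x) P := fun t ht0 ht1 y =>
    integrable_of_nonneg_of_le ((hΛm t).mul (hwy y)) (R := 1) fun x => by
      obtain ⟨h2, h3⟩ := hΛ01 t ht0 ht1 x
      rw [abs_of_nonneg (mul_nonneg h2 (hw0 y x))]
      exact mul_le_one₀ h3 (hw0 y x) (hw1 y x)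
  have hwi : ∀ y, Integrable (w y) P := fun y => integrable_of_nonneg_of_le (hwy y) fun x => by
    rw [abs_of_nonneg (hw0 y x)]; exact hw1 y x
  have ha01 : ∀ t, 0 ≤ t → t ≤ 1 → ∀ y, 0 ≤ a t y ∧ a t y ≤ 1 := fun t ht0 ht1 y => by
    refine ⟨integral_nonneg fun x => mul_nonneg (hΛ01 t ht0 ht1 x).1 (hw0 y x), ?_⟩
    calc a t y ≤ ∫ _, (1 : ℝ) ∂P := integral_mono (hΛw t ht0 ht1 y) (integrable_const _) fun x =>
          mul_le_one₀ (hΛ01 t ht0 ht1 x).2 (hw0 y x) (hw1 y x)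
      _ = 1 := by simp
  have hai : ∀ t, 0 ≤ t → t ≤ 1 → Integrable (a t) m := fun t ht0 ht1 =>
    integrable_of_nonneg_of_le (ham t) fun y => by
      rw [abs_of_nonneg (ha01 t ht0 ht1 y).1]; exact (ha01 t ht0 ht1 y).2
  have hA'01 : ∀ t, 0 ≤ t → t ≤ 1 → 0 ≤ ∫ x, Λ t x ∂P ∧ ∫ x, Λ t x ∂P ≤ 1 := fun t ht0 ht1 => by
    refine ⟨integral_nonneg fun x => (hΛ01 t ht0 ht1 x).1, ?_⟩
    calc ∫ x, Λ t x ∂P ≤ ∫ _, (1 : ℝ) ∂P := integral_mono (hΛi t ht0 ht1) (integrable_const _)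
          fun x => (hΛ01 t ht0 ht1 x).2
      _ = 1 := by simp
  have hha : ∀ t, 0 ≤ t → t ≤ 1 → Integrable (fun y => h y * a t y) m := fun t ht0 ht1 =>
    integrable_of_nonneg_of_le (hm.mul (ham t)) (R := 1) fun y => by
      rw [abs_of_nonneg (mul_nonneg (h0 y) (ha01 t ht0 ht1 y).1)]
      exact mul_le_one₀ (h1 y) (ha01 t ht0 ht1 y).1 (ha01 t ht0 ht1 y).2
  have hli : Integrable l m := integrable_of_nonneg_of_le hl fun y => by
    rw [abs_of_nonneg (hl0 y)]; exact hl1 y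
  -- the Laplace functional with `N + 1` particles
  have hA : ∀ t, 0 ≤ t → t ≤ 1 → ∫ x, ∏ j, (1 - t * h (x j)) ∂(gasProb m g b (N + 1)) =
      κ * (∫ y, a t y ∂m - t * ∫ y, h y * a t y ∂m) := fun t ht0 ht1 => by
    rw [integral_gasProb_succ m hgm hg hGt hG b (0 : Fin (N + 1))
      (measurable_prod_one_sub hm t Finset.univ) (R := 1)
      (fun x => (prod_one_sub_mem h0 h1 ht0 ht1 _ x).1)
      (fun x => (prod_one_sub_mem h0 h1 ht0 ht1 _ x).2), ← hκ, ← integral_const_mul t,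
      ← integral_sub (hai t ht0 ht1) ((hha t ht0 ht1).const_mul t)]
    congr 1
    refine integral_congr_ae (ae_of_all _ fun y => ?_)
    have : ∀ x : Fin N → X, (∏ j, (1 - t * h (((0 : Fin (N + 1)).insertNth y x :
        Fin (N + 1) → X) j))) * (expNeg (b * ∑ j, g y (x j))).toReal =
        (1 - t * h y) * (Λ t x * w y x) := fun x => by
      rw [Fin.prod_univ_succAbove _ 0]
      simp only [Fin.insertNth_apply_same, Fin.insertNth_apply_succAbove, hΛ, hwdef]
      ring
    simp_rw [this]
    rw [integral_const_mul]
    ring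
  set D : ℝ → ℝ := fun t => -∫ x, ∑ i, (∏ j ∈ Finset.univ.erase i, (1 - t * h (x j))) *
    (-h (x i)) ∂(gasProb m g b (N + 1)) with hD
  -- Removing particle `i` gives the same value for every `i`, hence the factor `N + 1`.
  have hDeq : ∀ t, 0 ≤ t → t ≤ 1 → D t = κ * ((N + 1 : ℕ) * ∫ y, h y * a t y ∂m) := by
    intro t ht0 ht1
    have hterm : ∀ i : Fin (N + 1), ∫ x, (∏ j ∈ Finset.univ.erase i, (1 - t * h (x j))) * h (x i)
        ∂(gasProb m g b (N + 1)) = κ * ∫ y, h y * a t y ∂m := fun i => by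
      have hmeas : Measurable fun x : Fin (N + 1) → X =>
          (∏ j ∈ Finset.univ.erase i, (1 - t * h (x j))) * h (x i) :=
        (measurable_prod_one_sub hm t _).mul (hm.comp (measurable_pi_apply i))
      rw [integral_gasProb_succ m hgm hg hGt hG b i hmeas (R := 1)
        (fun x => mul_nonneg (prod_one_sub_mem h0 h1 ht0 ht1 _ x).1 (h0 _))
        (fun x => mul_le_one₀ (prod_one_sub_mem h0 h1 ht0 ht1 _ x).2 (h0 _) (h1 _)), ← hκ]
      congr 1
      refine integral_congr_ae (ae_of_all _ fun y => ?_)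
      have : ∀ x : Fin N → X, (∏ j ∈ Finset.univ.erase i, (1 - t * h ((i.insertNth y x :
          Fin (N + 1) → X) j))) * h ((i.insertNth y x : Fin (N + 1) → X) i) *
          (expNeg (b * ∑ j, g y (x j))).toReal = h y * (Λ t x * w y x) := fun x => by
        rw [prod_erase_insertNth (fun z => 1 - t * h z)]
        simp only [Fin.insertNth_apply_same, hΛ, hwdef]
        ring
      simp_rw [this]
      rw [integral_const_mul]
    have hint : ∀ i ∈ Finset.univ, Integrable (fun x : Fin (N + 1) → X =>
        (∏ j ∈ Finset.univ.erase i, (1 - t * h (x j))) * h (x i)) (gasProb m g b (N + 1)) :=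
      fun i _ => by
        refine integrable_of_nonneg_of_le (R := 1)
          ((measurable_prod_one_sub hm t _).mul (hm.comp (measurable_pi_apply i))) fun x => ?_
        rw [abs_of_nonneg (mul_nonneg (prod_one_sub_mem h0 h1 ht0 ht1 _ x).1 (h0 _))]
        exact mul_le_one₀ (prod_one_sub_mem h0 h1 ht0 ht1 _ x).2 (h0 _) (h1 _)
    simp only [hD, mul_neg, Finset.sum_neg_distrib, integral_neg, neg_neg]
    rw [integral_finsetSum _ hint]
    simp_rw [hterm]
    rw [Finset.sum_const, Finset.card_univ, Fintype.card_fin, nsmul_eq_mul]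
    ring
  -- Only points with `h y ≠ 0` matter, and there replacing the weight by `1` costs at most `η`.
  have hD1 : ∀ t, 0 ≤ t → t ≤ 1 → |D t - κ * T * ∫ x, Λ t x ∂P| ≤ κ * T * η := by
    intro t ht0 ht1
    have e : D t - κ * T * ∫ x, Λ t x ∂P =
        κ * ((N + 1 : ℕ) * ∫ y, h y * (a t y - ∫ x, Λ t x ∂P) ∂m) := by
      simp_rw [mul_sub]
      rw [hDeq t ht0 ht1, integral_sub (hha t ht0 ht1) (hhint.mul_const _), integral_mul_const, hT]
      ring
    rw [e, abs_mul, abs_mul, abs_of_nonneg hκ0, Nat.abs_cast]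
    have h2 : |∫ y, h y * (a t y - ∫ x, Λ t x ∂P) ∂m| ≤ ∫ y, h y * η ∂m := by
      refine (abs_integral_le_integral_abs).trans (integral_mono_of_nonneg
        (ae_of_all _ fun _ => abs_nonneg _) (hhint.mul_const _) (ae_of_all _ fun y => ?_))
      simp only [abs_mul, abs_of_nonneg (h0 y)]
      by_cases hy : h y = 0
      · simp [hy]
      refine mul_le_mul_of_nonneg_left (le_trans ?_ (hη y hy)) (h0 y)
      simp only [ha]
      rw [← integral_sub (hΛw t ht0 ht1 y) (hΛi t ht0 ht1)]
      refine (abs_integral_le_integral_abs).trans (integral_mono_of_nonneg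
        (ae_of_all _ fun _ => abs_nonneg _) ((integrable_const _).sub (hwi y))
        (ae_of_all _ fun x => ?_))
      obtain ⟨h2, h3⟩ := hΛ01 t ht0 ht1 x
      have h4 : Λ t x * w y x - Λ t x = -(Λ t x * (1 - w y x)) := by ring
      have h5 : 0 ≤ 1 - w y x := sub_nonneg.2 (hw1 y x)
      simp only [h4, abs_neg]
      rw [abs_of_nonneg (mul_nonneg h2 h5)]
      exact mul_le_of_le_one_left h5 h3
    rw [integral_mul_const] at h2
    calc κ * (((N + 1 : ℕ) : ℝ) * |∫ y, h y * (a t y - ∫ x, Λ t x ∂P) ∂m|)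
        ≤ κ * (((N + 1 : ℕ) : ℝ) * ((∫ y, h y ∂m) * η)) := by gcongr
      _ = κ * T * η := by rw [hT]; ring
  -- Here `y` ranges over the whole space, so the weight is replaced by the mean-field value `l y`
  -- instead of `1`.
  have hA1 : ∀ t, 0 ≤ t → t ≤ 1 →
      |∫ y, a t y ∂m - (∫ y, l y ∂m) * ∫ x, Λ t x ∂P| ≤ ξ := by
    intro t ht0 ht1
    rw [← integral_mul_const, ← integral_sub (hai t ht0 ht1) (hli.mul_const _)]
    refine le_trans ((abs_integral_le_integral_abs).trans ?_) hξ
    have hdm : Measurable fun q : X × (Fin N → X) => |w q.1 q.2 - l q.1| :=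
      ((hw.sub (hl.comp measurable_fst))).abs
    have hd1 : ∀ y x, |w y x - l y| ≤ 1 := fun y x => by
      rw [abs_le]; constructor <;> linarith [hw0 y x, hw1 y x, hl0 y, hl1 y]
    have hdi : Integrable (fun q : X × (Fin N → X) => |w q.1 q.2 - l q.1|) (m.prod P) :=
      integrable_of_nonneg_of_le hdm (R := 1) fun q => by rw [abs_abs]; exact hd1 _ _
    refine integral_mono_of_nonneg (ae_of_all _ fun _ => abs_nonneg _) hdi.integral_prod_left
      (ae_of_all _ fun y => ?_)
    simp only [ha]
    rw [← integral_const_mul, ← integral_sub (hΛw t ht0 ht1 y) ((hΛi t ht0 ht1).const_mul _)]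
    refine (abs_integral_le_integral_abs).trans (integral_mono_of_nonneg
      (ae_of_all _ fun _ => abs_nonneg _) ?_ (ae_of_all _ fun x => ?_))
    · exact integrable_of_nonneg_of_le ((hwy y).sub_const _).abs (R := 1) fun x => by
        rw [abs_abs]; exact hd1 _ _
    · obtain ⟨h2, h3⟩ := hΛ01 t ht0 ht1 x
      have h4 : Λ t x * w y x - l y * Λ t x = Λ t x * (w y x - l y) := by ring
      simp only [h4, abs_mul, abs_of_nonneg h2]
      exact mul_le_of_le_one_left (abs_nonneg _) h3
  -- At `t = 0` both functionals equal `1`, so the comparison becomes a statement about `κ` alone.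
  have hκl : |1 - κ * ∫ y, l y ∂m| ≤ κ * ξ := by
    have h2 := hA 0 le_rfl zero_le_one
    have h3 := hA1 0 le_rfl zero_le_one
    simp only [zero_mul, sub_zero, Finset.prod_const_one, integral_const, probReal_univ,
      one_smul] at h2
    have h4 : ∫ x, Λ 0 x ∂P = 1 := by simp [hΛ]
    rw [h4, mul_one] at h3
    rw [h2, ← mul_sub, abs_mul, abs_of_nonneg hκ0]
    gcongr
  refine ⟨hκl, ?_⟩
  have hfin := abs_sub_exp_neg_le_of_deriv (τ := κ * T)
    (ε := κ * T * η + κ * T * (κ * (2 * ξ + T / ((N + 1 : ℕ) : ℝ)))) (D := D)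
    (A := fun t => ∫ x, ∏ j, (1 - t * h (x j)) ∂(gasProb m g b (N + 1))) (by positivity)
    (fun t => by
      simp only [hD, neg_neg]
      exact hasDerivAt_integral_prod_one_sub _ hm h0 h1 t) (by simp) ?_
  · simpa using hfin
  intro t ht0 ht1
  set A' := ∫ x, Λ t x ∂P with hA'
  have hAA : |∫ x, ∏ j, (1 - t * h (x j)) ∂(gasProb m g b (N + 1)) - A'| ≤
      κ * (2 * ξ + T / ((N + 1 : ℕ) : ℝ)) := by
    rw [hA t ht0 ht1]
    have h2 := hA1 t ht0 ht1
    obtain ⟨h3, h4⟩ := hA'01 t ht0 ht1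
    have h5 : 0 ≤ ∫ y, h y * a t y ∂m :=
      integral_nonneg fun y => mul_nonneg (h0 y) (ha01 t ht0 ht1 y).1
    have h6 : ∫ y, h y * a t y ∂m ≤ ∫ y, h y ∂m := integral_mono (hha t ht0 ht1) hhint fun y =>
      mul_le_of_le_one_right (h0 y) (ha01 t ht0 ht1 y).2
    have h7 : T / ((N + 1 : ℕ) : ℝ) = ∫ y, h y ∂m := by
      rw [hT]; field_simp
    rw [h7]
    exact abs_mul_sub_sub_le hκ0 ht0 ht1 h3 h4 h5 h6 h2 hκl
  exact abs_sub_mul_le (by positivity) (hD1 t ht0 ht1) hAA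

end Laplace

end MeanFieldGas

namespace MeanFieldGas

open scoped BoundedContinuousFunction

/-! ### Passage to the Poisson limit -/

section PoissonLimit

/-- The right side contains `κ` itself: once `ξ < l/2` the inequality gives `κ ≤ 2/l`, and with this
bound it yields the limit. -/
theorem tendsto_inv_of_abs_one_sub_mul_le {κ ξ : ℕ → ℝ} {l : ℝ} (hl : 0 < l) (hκ : ∀ N, 0 ≤ κ N)
    (hξ : Tendsto ξ atTop (𝓝 0)) (h : ∀ N, |1 - κ N * l| ≤ κ N * ξ N) :
    Tendsto κ atTop (𝓝 l⁻¹) := by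
  have h1 : ∀ᶠ N in atTop, κ N ≤ 2 / l := by
    filter_upwards [hξ.eventually (gt_mem_nhds (half_pos hl))] with N hN
    have h2 := (abs_le.1 (h N)).1
    have h3 : κ N * ξ N ≤ κ N * (l / 2) := mul_le_mul_of_nonneg_left hN.le (hκ N)
    rw [le_div_iff₀ hl]
    linarith
  have h2 : ∀ᶠ N in atTop, |κ N - l⁻¹| ≤ 2 / l * |ξ N| * l⁻¹ := by
    filter_upwards [h1] with N hN
    have e : κ N - l⁻¹ = -((1 - κ N * l) * l⁻¹) := by field_simp; ring
    rw [e, abs_neg, abs_mul, abs_of_pos (inv_pos.2 hl)]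
    gcongr
    calc |1 - κ N * l| ≤ κ N * ξ N := h N
      _ ≤ κ N * |ξ N| := mul_le_mul_of_nonneg_left (le_abs_self _) (hκ N)
      _ ≤ _ := by gcongr
  have h3 : Tendsto (fun N => 2 / l * |ξ N| * l⁻¹) atTop (𝓝 0) := by
    simpa using (hξ.abs.const_mul (2 / l)).mul_const l⁻¹
  rw [tendsto_iff_norm_sub_tendsto_zero]
  exact squeeze_zero' (Eventually.of_forall fun _ => norm_nonneg _) h2 h3

variable {X : Type*} [MeasurableSpace X] [MetricSpace X] [SecondCountableTopology X]
  [BorelSpace X]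

theorem exists_bound_of_tendsto {γ : ℝ} {b : ℕ → ℝ≥0}
    (hb : Tendsto (fun N => ((N + 1 : ℕ) : ℝ) * b N) atTop (𝓝 γ)) :
    ∃ B : ℝ≥0, ∀ N, b N * (N + 1 : ℕ) ≤ B := by
  obtain ⟨B, hB⟩ := hb.bddAbove_range
  refine ⟨B.toNNReal, fun N => ?_⟩
  have h1 := hB ⟨N, rfl⟩
  rw [← NNReal.coe_le_coe]
  refine le_trans ?_ (Real.le_coe_toNNReal B)
  push_cast at h1 ⊢
  linarith

/-- The Laplace functionals of the gas, evaluated at functions whose supports escape to infinity,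
converge to those of a Poisson process. -/
theorem tendsto_integral_gasProb_prod {γ : ℝ} (hγ : 0 ≤ γ) {m : Measure X}
    [IsProbabilityMeasure m] [(cocompact X).IsCountablyGenerated] {g : X → X → ℝ≥0∞}
    (hgm : Measurable (Function.uncurry g))
    (hg : ∀ u x, g u x = g x u) (happ : IsApproxKernel g m) {μ : ProbabilityMeasure X}
    {b : ℕ → ℝ≥0} (hb : Tendsto (fun N => ((N + 1 : ℕ) : ℝ) * b N) atTop (𝓝 γ))
    (hlln : ∀ f : X →ᵇ ℝ, Tendsto (fun N => ∫⁻ x, ENNReal.ofReal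
      |∫ z, f z ∂(empirical x : Measure X) - ∫ z, f z ∂(μ : Measure X)|
        ∂(gasProb m g (b N) (N + 1))) atTop (𝓝 0)) {h : ℕ → X → ℝ}
    (hm : ∀ N, Measurable (h N)) (h0 : ∀ N x, 0 ≤ h N x) (h1 : ∀ N x, h N x ≤ 1)
    (hsupp : ∀ S ∈ cocompact X, ∀ᶠ N in atTop, ∀ y, h N y ≠ 0 → y ∈ S) {T : ℝ}
    (hT : Tendsto (fun N => ((N + 1 + 1 : ℕ) : ℝ) * ∫ y, h N y ∂m) atTop (𝓝 T)) :
    0 < ∫ y, (expNeg (ENNReal.ofReal γ * ∫⁻ z, g y z ∂(μ : Measure X))).toReal ∂m ∧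
    Tendsto (fun N => ∫ x, ∏ j, (1 - h N (x j)) ∂(gasProb m g (b N) (N + 1 + 1))) atTop
      (𝓝 (Real.exp (-((∫ y, (expNeg (ENNReal.ofReal γ *
        ∫⁻ z, g y z ∂(μ : Measure X))).toReal ∂m)⁻¹ * T)))) := by
  obtain ⟨G, hG⟩ := happ.exists_lintegral_le
  have hGt : (G : ℝ≥0∞) ≠ ∞ := ENNReal.coe_ne_top
  obtain ⟨B, hB⟩ := exists_bound_of_tendsto hb
  have hP : ∀ N, IsProbabilityMeasure (gasProb m g (b N) (N + 1)) := fun N =>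
    isProbabilityMeasure_gasProb m hgm hg hGt hG (b N) (N + 1)
  set C := (expNeg (B * G))⁻¹ with hC
  have hCt : C ≠ ∞ := ENNReal.inv_ne_top.2 (expNeg_pos (ENNReal.mul_ne_top (by simp) hGt)).ne'
  have hμC : (μ : Measure X) ≤ C • m := le_smul_of_tendsto_gasProb hgm hg hGt hG hB hlln
  set l : X → ℝ := fun y => (expNeg (ENNReal.ofReal γ * ∫⁻ z, g y z ∂(μ : Measure X))).toReal
    with hl
  have hlm : Measurable l :=
    (measurable_expNeg.comp ((hgm.lintegral_prod_right').const_mul _)).ennreal_toReal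
  have hl0 : ∀ y, 0 ≤ l y := fun y => ENNReal.toReal_nonneg
  have hl1 : ∀ y, l y ≤ 1 := fun y => toReal_expNeg_le_one _
  -- Since `μ ≤ C • m`, the potential of `μ` is finite everywhere, not merely almost everywhere.
  have hlpos : ∀ y, 0 < l y := fun y => by
    refine ENNReal.toReal_pos (expNeg_pos (ENNReal.mul_ne_top ENNReal.ofReal_ne_top ?_)).ne'
      (expNeg_ne_top _)
    refine ne_top_of_le_ne_top (ENNReal.mul_ne_top hCt hGt)
      ((lintegral_mono' hμC le_rfl).trans ?_)
    rw [lintegral_smul_measure, smul_eq_mul]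
    gcongr
    exact hG y
  have hli : Integrable l m := integrable_of_nonneg_of_le hlm (R := 1) fun y => by
    rw [abs_of_nonneg (hl0 y)]; exact hl1 y
  have hlbar : 0 < ∫ y, l y ∂m := by
    rw [integral_pos_iff_support_of_nonneg hl0 hli,
      show Function.support l = Set.univ from Set.eq_univ_of_forall fun y => (hlpos y).ne']
    simp
  refine ⟨hlbar, ?_⟩
  -- the error in replacing the random potential by the mean field
  set ξ' : ℕ → ℝ≥0∞ := fun N => ∫⁻ y, ∫⁻ x, ENNReal.ofReal
    |(expNeg (b N * ∑ j, g y (x j))).toReal - l y| ∂(gasProb m g (b N) (N + 1)) ∂m with hξ'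
  have hdm : ∀ N, Measurable fun q : X × (Fin (N + 1) → X) =>
      |(expNeg (b N * ∑ j, g q.1 (q.2 j))).toReal - l q.1| := fun N =>
    ((measurable_weight hgm (b N) (N + 1)).sub (hlm.comp measurable_fst)).abs
  have hd1 : ∀ N y (x : Fin (N + 1) → X), |(expNeg (b N * ∑ j, g y (x j))).toReal - l y| ≤ 1 :=
    fun N y x => by
      rw [abs_le]
      constructor <;> linarith [hl0 y, hl1 y, toReal_expNeg_le_one (b N * ∑ j, g y (x j)),
        (ENNReal.toReal_nonneg : 0 ≤ (expNeg (b N * ∑ j, g y (x j))).toReal)]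
  have hξ'0 : Tendsto ξ' atTop (𝓝 0) := by
    have h2 : Tendsto ξ' atTop (𝓝 (∫⁻ _, 0 ∂m)) := by
      refine tendsto_lintegral_of_dominated_convergence (fun _ => 1)
        (fun N => (hdm N).ennreal_ofReal.lintegral_prod_right') (fun N => ae_of_all _ fun y => ?_)
        (by simp) (ae_of_all _ fun y =>
          tendsto_lintegral_gasProb_abs_expNeg_sub hγ hgm hg happ hb hlln y)
      have := hP N
      calc ∫⁻ x, ENNReal.ofReal |(expNeg (b N * ∑ j, g y (x j))).toReal - l y|
            ∂(gasProb m g (b N) (N + 1)) ≤ ∫⁻ _, 1 ∂(gasProb m g (b N) (N + 1)) :=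
            lintegral_mono fun x => by
              rw [← ENNReal.ofReal_one]; exact ENNReal.ofReal_le_ofReal (hd1 N y x)
        _ = 1 := by simp
    simpa using h2
  have hξ0 : Tendsto (fun N => (ξ' N).toReal) atTop (𝓝 0) := by
    simpa [Function.comp_def] using (ENNReal.tendsto_toReal ENNReal.zero_ne_top).comp hξ'0
  have hξ : ∀ N, ∫ y, ∫ x, |(expNeg (b N * ∑ j, g y (x j))).toReal - l y|
      ∂(gasProb m g (b N) (N + 1)) ∂m ≤ (ξ' N).toReal := fun N => by
    have := hP N
    exact (integral_integral_eq_toReal m (gasProb m g (b N) (N + 1)) (hdm N) (R := 1)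
      (fun q => abs_nonneg _) (fun q => hd1 N _ _)).le
  -- the energy of a particle at infinity
  set η' : ℕ → ℝ≥0∞ := fun N => ⨆ y, ⨆ (_ : h N y ≠ 0),
    ∫⁻ x, (1 - expNeg (b N * ∑ j, g y (x j))) ∂(gasProb m g (b N) (N + 1)) with hη'
  have hη'1 : ∀ N, η' N ≤ 1 := fun N => iSup₂_le fun y _ => by
    have := hP N
    calc _ ≤ ∫⁻ _, 1 ∂(gasProb m g (b N) (N + 1)) := lintegral_mono fun x => tsub_le_self
      _ = 1 := by simp
  -- Uniformity in `y` comes from the supports eventually entering any set whose complement lies in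
  -- a compact set.
  have hη'0 : Tendsto η' atTop (𝓝 0) := by
    have h2 : Tendsto (fun y => (B : ℝ≥0∞) * (C * ∫⁻ z, g y z ∂m)) (cocompact X) (𝓝 0) := by
      simpa using ENNReal.Tendsto.const_mul (ENNReal.Tendsto.const_mul
        happ.tendsto_lintegral_cocompact (Or.inr hCt)) (Or.inr (ENNReal.coe_ne_top (r := B)))
    rw [ENNReal.tendsto_nhds_zero] at h2 ⊢
    intro ε hε
    filter_upwards [hsupp _ (h2 ε hε)] with N hN
    exact iSup₂_le fun y hy =>
      (lintegral_gasProb_one_sub_expNeg_le m hgm hg hGt hG (hB N) y).trans (hN y hy)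
  have hη0 : Tendsto (fun N => (η' N).toReal) atTop (𝓝 0) := by
    simpa [Function.comp_def] using (ENNReal.tendsto_toReal ENNReal.zero_ne_top).comp hη'0
  have hη : ∀ N y, h N y ≠ 0 → ∫ x, (1 - (expNeg (b N * ∑ j, g y (x j))).toReal)
      ∂(gasProb m g (b N) (N + 1)) ≤ (η' N).toReal := fun N y hy => by
    have hwm : Measurable fun x : Fin (N + 1) → X =>
        1 - (expNeg (b N * ∑ j, g y (x j))).toReal :=
      measurable_const.sub (Measurable.of_uncurry_left (x := y)
        (f := fun y (x : Fin (N + 1) → X) => (expNeg (b N * ∑ j, g y (x j))).toReal)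
        (measurable_weight hgm (b N) (N + 1)))
    rw [integral_eq_lintegral_of_nonneg_ae
      (ae_of_all _ fun x => sub_nonneg.2 (toReal_expNeg_le_one _)) hwm.aestronglyMeasurable]
    refine ENNReal.toReal_mono (ne_top_of_le_ne_top ENNReal.one_ne_top (hη'1 N)) ?_
    simp_rw [ENNReal.ofReal_sub _ ENNReal.toReal_nonneg, ENNReal.ofReal_one,
      ENNReal.ofReal_toReal (expNeg_ne_top _)]
    exact le_iSup₂_of_le (f := fun y (_ : h N y ≠ 0) => ∫⁻ x, (1 - expNeg (b N * ∑ j, g y (x j)))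
      ∂(gasProb m g (b N) (N + 1))) y hy le_rfl
  -- Ratio of the partition functions of `N + 1` and `N + 2` particles, both at `b N`; its limit is
  -- read off from the first half of `abs_integral_prod_sub_exp_le`.
  set κ : ℕ → ℝ := fun N => (gas m g (b N) (N + 1) Set.univ).toReal /
    (gas m g (b N) (N + 1 + 1) Set.univ).toReal with hκ
  have key := fun N => abs_integral_prod_sub_exp_le m hgm hg hGt hG (b N) (N + 1) (hm N) (h0 N)
    (h1 N) hlm hl0 hl1 (hκ ▸ rfl : κ N = _) rfl (hη N) (hξ N)
  have hκlim : Tendsto κ atTop (𝓝 (∫ y, l y ∂m)⁻¹) :=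
    tendsto_inv_of_abs_one_sub_mul_le hlbar (fun N => by positivity) hξ0 fun N => (key N).1
  have hinv : Tendsto (fun N => ∫ y, h N y ∂m) atTop (𝓝 0) := by
    have h2 : Tendsto (fun N : ℕ => ((N + 1 + 1 : ℕ) : ℝ)⁻¹) atTop (𝓝 0) :=
      tendsto_inv_atTop_zero.comp (tendsto_natCast_atTop_atTop.comp (tendsto_add_atTop_nat 2))
    refine ((hT.mul h2).congr fun N => ?_).trans (by simp)
    field_simp
  have herr : Tendsto (fun N => κ N * (((N + 1 + 1 : ℕ) : ℝ) * ∫ y, h N y ∂m) * (η' N).toReal +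
      κ N * (((N + 1 + 1 : ℕ) : ℝ) * ∫ y, h N y ∂m) * (κ N * (2 * (ξ' N).toReal +
        (((N + 1 + 1 : ℕ) : ℝ) * ∫ y, h N y ∂m) / ((N + 1 + 1 : ℕ) : ℝ)))) atTop (𝓝 0) := by
    have h3 : Tendsto (fun N : ℕ => (((N + 1 + 1 : ℕ) : ℝ) * ∫ y, h N y ∂m) /
        ((N + 1 + 1 : ℕ) : ℝ)) atTop (𝓝 0) := hinv.congr fun N => by field_simp
    simpa using ((hκlim.mul hT).mul hη0).add
      ((hκlim.mul hT).mul (hκlim.mul ((hξ0.const_mul 2).add h3)))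
  have hexp := (Real.continuous_exp.tendsto _).comp (hκlim.mul hT).neg
  have hdiff := squeeze_zero (fun N => abs_nonneg _) (fun N => (key N).2) herr
  have := hexp.add ((tendsto_zero_iff_abs_tendsto_zero _).2 hdiff)
  rw [add_zero] at this
  refine this.congr fun N => ?_
  simp only [Function.comp_apply]
  ring

end PoissonLimit

end MeanFieldGas

namespace MeanFieldGas

open InformationTheory
open scoped BoundedContinuousFunction

/-! ### Decaying kernels are approximable -/

section Kernel

theorem isCountablyGenerated_cocompact (X : Type*) [NormedAddCommGroup X] [ProperSpace X] :
    (cocompact X).IsCountablyGenerated := by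
  rw [← Metric.cobounded_eq_cocompact, ← comap_norm_atTop]
  infer_instance

/-- If `a ≥ δ`, then `a = a^{1-p} a^p ≤ δ^{1-p} a^p`. This turns smallness in `Lᵖ` into smallness in
`L¹` for a probability measure. -/
theorem le_add_rpow_mul {a : ℝ≥0∞} {δ : ℝ≥0} (hδ : 0 < δ) {p : ℝ} (hp : 1 < p) :
    a ≤ δ + ((δ : ℝ≥0∞) ^ (p - 1))⁻¹ * a ^ p := by
  rcases le_total a δ with h | h
  · exact h.trans le_self_add
  refine le_trans ?_ le_add_self
  have h0 : (δ : ℝ≥0∞) ^ (p - 1) ≠ 0 := by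
    simp [ENNReal.rpow_eq_zero_iff, hδ.ne']
  have ht : (δ : ℝ≥0∞) ^ (p - 1) ≠ ∞ := ENNReal.rpow_ne_top_of_nonneg (by linarith) (by simp)
  rw [mul_comm, ← div_eq_mul_inv, ENNReal.le_div_iff_mul_le (Or.inl h0) (Or.inl ht)]
  calc a * (δ : ℝ≥0∞) ^ (p - 1) ≤ a ^ (1 : ℝ) * a ^ (p - 1) := by
        rw [ENNReal.rpow_one]
        gcongr
    _ = a ^ p := by
        rw [← ENNReal.rpow_add_of_nonneg _ _ zero_le_one (by linarith)]
        congr 1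
        ring

/-- The continuous part of the kernel may be negative; as the kernel is nonnegative, the positive
part is still a minorant, with a remainder no larger than `c`. -/
theorem le_ofReal_add_of_coe_eq {a : ℝ≥0∞} {r : ℝ} {c : ℝ≥0∞}
    (h : (a : EReal) = (r : EReal) + (c : EReal)) :
    ENNReal.ofReal r ≤ a ∧ a ≤ ENNReal.ofReal r + c := by
  constructor
  · rw [← EReal.coe_ennreal_le_coe_ennreal_iff, EReal.coe_ennreal_ofReal]
    rcases le_total r 0 with hr | hr
    · rw [max_eq_right hr]
      exact EReal.coe_ennreal_nonneg a
    · rw [max_eq_left hr, h]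
      exact le_add_of_nonneg_right (EReal.coe_ennreal_nonneg c)
  · rw [← EReal.coe_ennreal_le_coe_ennreal_iff, EReal.coe_ennreal_add, h, EReal.coe_ennreal_ofReal]
    gcongr
    exact le_max_left _ _

variable {n : ℕ}

/-- The approximant is the positive part of `gLow k` for large `k`. The density bound `m ≤ C •
volume` transfers the `Lᵖ` bound on `gUp k` from Lebesgue measure to `m`. -/
theorem IsDecayingKernel.isApproxKernel
    {g : EuclideanSpace ℝ (Fin n) → EuclideanSpace ℝ (Fin n) → ℝ≥0∞} (hg : IsDecayingKernel g)
    {m : Measure (EuclideanSpace ℝ (Fin n))} [IsProbabilityMeasure m] {C : ℝ≥0}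
    (hm : m ≤ C • volume) : IsApproxKernel g m := by
  obtain ⟨gLow, gUp, p, c, hp, hc, h⟩ := hg.decomp
  intro ε hε
  set δ : ℝ≥0 := ε / 2 with hδ
  have hδ0 : 0 < δ := half_pos hε
  set D : ℝ≥0∞ := ((δ : ℝ≥0∞) ^ (p - 1))⁻¹ with hD
  have hDt : D ≠ ∞ := ENNReal.inv_ne_top.2 (by simp [ENNReal.rpow_eq_zero_iff, hδ0.ne'])
  have hlim : Tendsto (fun k => D * (C * (c k : ℝ≥0∞))) atTop (𝓝 0) := by
    simpa using ENNReal.Tendsto.const_mul (ENNReal.Tendsto.const_mul (ENNReal.tendsto_coe.2 hc)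
      (Or.inr (ENNReal.coe_ne_top (r := C)))) (Or.inr hDt)
  obtain ⟨k, hk, hk1⟩ := ((ENNReal.tendsto_nhds_zero.1 hlim δ (by exact_mod_cast hδ0)).and
    (eventually_ge_atTop 1)).exists
  obtain ⟨hdec, hcont, hle, hup, hinf⟩ := h k hk1
  refine ⟨k, fun u x => (gLow k u x).toNNReal, continuous_real_toNNReal.comp hcont, fun u x => ?_,
    fun u x => (le_ofReal_add_of_coe_eq (hdec u x)).1, fun u => ?_, fun x => ?_⟩
  · rw [Real.toNNReal_le_iff_le_coe]
    exact_mod_cast hle u x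
  · calc ∫⁻ x, (g u x - (gLow k u x).toNNReal) ∂m
        ≤ ∫⁻ x, (δ + D * gUp k u x ^ p) ∂m := lintegral_mono fun x =>
          (tsub_le_iff_left.2 (le_ofReal_add_of_coe_eq (hdec u x)).2).trans
            (le_add_rpow_mul hδ0 hp)
      _ = δ + D * ∫⁻ x, gUp k u x ^ p ∂m := by
          rw [lintegral_add_left measurable_const, lintegral_const_mul' _ _ hDt]
          simp
      _ ≤ δ + D * (C * c k) := by
          gcongr
          refine (lintegral_mono' hm le_rfl).trans ?_
          rw [lintegral_smul_measure]
          exact mul_le_mul_right (hup u) _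
      _ ≤ δ + δ := by gcongr
      _ = ε := by rw [hδ, ← ENNReal.coe_add, add_halves]
  · simpa [Function.comp_def] using (continuous_real_toNNReal.tendsto 0).comp (hinf x)

end Kernel

/-! ### From the Gibbs measure to the gas over the reference measure -/

section Reference

variable {n : ℕ} {V : EuclideanSpace ℝ (Fin n) → ℝ}

theorem pi_withDensity {X : Type*} [MeasurableSpace X] (m : Measure X) [SigmaFinite m]
    {f : X → ℝ≥0∞} (hf : Measurable f) [SigmaFinite (m.withDensity f)] (N : ℕ) :
    Measure.pi (fun _ : Fin N => m.withDensity f) =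
      (Measure.pi fun _ : Fin N => m).withDensity fun x => ∏ i, f (x i) := by
  refine Measure.pi_eq fun s hs => ?_
  rw [withDensity_apply _ (MeasurableSet.univ_pi hs), ← lintegral_indicator (MeasurableSet.univ_pi hs)]
  have e : ∀ x : Fin N → X, (Set.univ.pi s).indicator (fun x => ∏ i, f (x i)) x =
      ∏ i, (s i).indicator f (x i) := fun x => by
    by_cases hx : x ∈ Set.univ.pi s
    · rw [Set.indicator_of_mem hx]
      exact Finset.prod_congr rfl fun i _ => (Set.indicator_of_mem (hx i trivial) f).symm
    · rw [Set.indicator_of_notMem hx]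
      obtain ⟨i, hi⟩ : ∃ i, x i ∉ s i := by simpa [Set.mem_univ_pi] using hx
      exact (Finset.prod_eq_zero (Finset.mem_univ i) (Set.indicator_of_notMem hi f)).symm
  simp_rw [e]
  rw [lintegral_pi_prod m fun i => hf.indicator (hs i)]
  exact Finset.prod_congr rfl fun i _ => by
    rw [lintegral_indicator (hs i), withDensity_apply _ (hs i)]

theorem integral_exp_neg_pos (hV : Integrable fun x => Real.exp (-V x)) :
    0 < ∫ x, Real.exp (-V x) := integral_exp_pos hV

theorem tilted_eq_withDensity_expNeg (hV0 : ∀ x, 0 ≤ V x) :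
    volume.tilted (fun x => -V x) = volume.withDensity fun x =>
      ENNReal.ofReal (∫ x, Real.exp (-V x))⁻¹ * expNeg (ENNReal.ofReal (V x)) := by
  rw [Measure.tilted]
  congr 1 with x
  rw [expNeg_ofReal (hV0 x), ← ENNReal.ofReal_mul' (Real.exp_nonneg _), div_eq_inv_mul]

theorem tilted_le_smul (hV0 : ∀ x, 0 ≤ V x) :
    volume.tilted (fun x => -V x) ≤ (∫ x, Real.exp (-V x))⁻¹.toNNReal • volume := by
  rw [tilted_eq_withDensity_expNeg hV0]
  calc _ ≤ volume.withDensity fun _ => ENNReal.ofReal (∫ x, Real.exp (-V x))⁻¹ :=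
        withDensity_mono (ae_of_all _ fun x => mul_le_of_le_one_right' (expNeg_le_one _))
    _ = _ := by rw [withDensity_const]; rfl

variable {g : EuclideanSpace ℝ (Fin n) → EuclideanSpace ℝ (Fin n) → ℝ≥0∞}

theorem expNeg_hamiltonian (β : ℝ) (N : ℕ) (x : Fin N → EuclideanSpace ℝ (Fin n)) :
    expNeg (hamiltonian g V β N x) =
      (∏ j, expNeg (ENNReal.ofReal (V (x j)))) * expNeg (β.toNNReal * pairEnergy g x) := by
  rw [hamiltonian, expNeg_add, expNeg_sum, mul_comm]
  rfl

theorem gas_tilted (hV0 : ∀ x, 0 ≤ V x) (hVm : Measurable V)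
    (hgm : Measurable (Function.uncurry g)) (β : ℝ) (N : ℕ) :
    gas (volume.tilted fun x => -V x) g β.toNNReal N =
      ENNReal.ofReal (∫ x, Real.exp (-V x))⁻¹ ^ N •
        volume.withDensity (fun x => expNeg (hamiltonian g V β N x)) := by
  have hf : Measurable fun x => ENNReal.ofReal (∫ x, Real.exp (-V x))⁻¹ *
      expNeg (ENNReal.ofReal (V x)) := (measurable_expNeg.comp hVm.ennreal_ofReal).const_mul _
  have hs : SigmaFinite (volume.withDensity fun x => ENNReal.ofReal (∫ x, Real.exp (-V x))⁻¹ *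
      expNeg (ENNReal.ofReal (V x))) := by
    rw [← tilted_eq_withDensity_expNeg hV0]
    infer_instance
  have hp : Measurable fun x : Fin N → EuclideanSpace ℝ (Fin n) => ∏ i,
      (ENNReal.ofReal (∫ x, Real.exp (-V x))⁻¹ * expNeg (ENNReal.ofReal (V (x i)))) :=
    Finset.measurable_prod _ fun i _ => hf.comp (measurable_pi_apply i)
  have he : Measurable fun x : Fin N → EuclideanSpace ℝ (Fin n) =>
      expNeg (β.toNNReal * pairEnergy g x) :=
    measurable_expNeg.comp ((measurable_pairEnergy hgm).const_mul _)
  rw [gas, tilted_eq_withDensity_expNeg hV0, pi_withDensity volume hf, ← withDensity_mul _ hp he,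
    ← volume_pi, ← withDensity_smul' _ _ (by simp)]
  congr 1 with x
  simp only [Pi.mul_apply, Pi.smul_apply, smul_eq_mul, Finset.prod_mul_distrib, Finset.prod_const,
    Finset.card_univ, Fintype.card_fin, expNeg_hamiltonian, mul_assoc]

/-- Normalizing the reference measure multiplies numerator and partition function by the same power
of `(∫ e^{-V})⁻¹`. -/
theorem gibbs_eq_gasProb (hV0 : ∀ x, 0 ≤ V x) (hVm : Measurable V)
    (hV : Integrable fun x => Real.exp (-V x))
    (hgm : Measurable (Function.uncurry g)) (β : ℝ) (N : ℕ) :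
    gibbs g V β N = gasProb (volume.tilted fun x => -V x) g β.toNNReal N := by
  have hc := inv_pos.2 (integral_exp_neg_pos hV)
  have h0 : ENNReal.ofReal (∫ x, Real.exp (-V x))⁻¹ ^ N ≠ 0 :=
    pow_ne_zero _ (ENNReal.ofReal_pos.2 hc).ne'
  have ht : ENNReal.ofReal (∫ x, Real.exp (-V x))⁻¹ ^ N ≠ ∞ :=
    ENNReal.pow_ne_top ENNReal.ofReal_ne_top
  rw [gasProb, gas_tilted hV0 hVm hgm, gibbs, partitionFunction, Measure.smul_apply,
    withDensity_apply _ MeasurableSet.univ, setLIntegral_univ, smul_smul, smul_eq_mul,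
    ENNReal.mul_inv (Or.inl h0) (Or.inl ht), mul_right_comm, ENNReal.inv_mul_cancel h0 ht, one_mul]

theorem normConst_eq (hV0 : ∀ x, 0 ≤ V x) (hV : Integrable fun x => Real.exp (-V x))
    (hVm : Measurable V) (hgm : Measurable (Function.uncurry g)) (γ : ℝ)
    (μ : Measure (EuclideanSpace ℝ (Fin n))) [SFinite μ] :
    normConst γ g V μ = (∫ x, Real.exp (-V x)) *
      ∫ y, (expNeg (ENNReal.ofReal γ * ∫⁻ z, g y z ∂μ)).toReal
        ∂(volume.tilted fun x => -V x) := by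
  have hc := integral_exp_neg_pos hV
  have hf : Measurable fun x => ENNReal.ofReal (∫ x, Real.exp (-V x))⁻¹ *
      expNeg (ENNReal.ofReal (V x)) := (measurable_expNeg.comp hVm.ennreal_ofReal).const_mul _
  have hm : Measurable fun y => expNeg (ENNReal.ofReal γ * ∫⁻ z, g y z ∂μ) :=
    measurable_expNeg.comp ((hgm.lintegral_prod_right').const_mul _)
  rw [integral_toReal hm.aemeasurable (ae_of_all _ fun y => (expNeg_ne_top _).lt_top),
    ← ENNReal.toReal_ofReal hc.le, ← ENNReal.toReal_mul, normConst, tilted_eq_withDensity_expNeg hV0,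
    lintegral_withDensity_eq_lintegral_mul _ hf hm]
  congr 1
  simp_rw [Pi.mul_apply, mul_assoc]
  rw [lintegral_const_mul' _ _ ENNReal.ofReal_ne_top, ← mul_assoc,
    ← ENNReal.ofReal_mul hc.le, mul_inv_cancel₀ hc.ne', ENNReal.ofReal_one, one_mul]
  refine lintegral_congr fun x => ?_
  rw [expNeg_add, mul_comm]
  rfl

theorem IsUniqueMinimizer.lt {γ : ℝ} {μ : ProbabilityMeasure (EuclideanSpace ℝ (Fin n))}
    (h : IsUniqueMinimizer γ g V μ) (P : ProbabilityMeasure (EuclideanSpace ℝ (Fin n)))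
    (hP : P ≠ μ) : freeEnergy γ g V μ < freeEnergy γ g V P := by
  by_contra hlt
  exact hP (h.2 P fun ν => (not_lt.1 hlt).trans (h.1 ν))

/-- The reference measure `m` is a competitor with zero entropy and energy at most `G`. When `γ = 0`
the free energy does not control the interaction energy, but then the minimizer is `m` itself. -/
theorem finite_of_minimizer {X : Type*} [MeasurableSpace X] {γ : ℝ} (hγ : 0 ≤ γ) {m : Measure X}
    [IsProbabilityMeasure m] {g : X → X → ℝ≥0∞} {G : ℝ≥0∞} (hGt : G ≠ ∞)
    (hG : ∀ y, ∫⁻ x, g y x ∂m ≤ G) {μ : Measure X} [IsProbabilityMeasure μ]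
    (hmin : refFreeEnergy γ g m μ ≤ refFreeEnergy γ g m m) :
    ∫⁻ y, ∫⁻ z, g y z ∂μ ∂μ ≠ ∞ ∧ klDiv μ m ≠ ∞ := by
  have hGG : ∫⁻ y, ∫⁻ z, g y z ∂m ∂m ≤ G := by
    calc _ ≤ ∫⁻ _, G ∂m := lintegral_mono hG
      _ = G := by simp
  have h1 : refFreeEnergy γ g m μ ≤ ENNReal.ofReal (γ / 2) * G := by
    refine hmin.trans ?_
    rw [refFreeEnergy, klDiv_self, add_zero]
    gcongr
  have h2 : refFreeEnergy γ g m μ ≠ ∞ :=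
    ne_top_of_le_ne_top (ENNReal.mul_ne_top ENNReal.ofReal_ne_top hGt) h1
  have h3 := ENNReal.add_ne_top.1 h2
  refine ⟨?_, h3.2⟩
  rcases hγ.eq_or_lt with rfl | hγ
  · have h4 : klDiv μ m = 0 := by
      have : refFreeEnergy 0 g m μ = klDiv μ m := by simp [refFreeEnergy]
      rw [← this]
      simpa using h1
    rw [klDiv_eq_zero_iff.1 h4]
    exact ne_top_of_le_ne_top hGt hGG
  · intro h4
    refine h3.1 ?_
    rw [h4, ENNReal.mul_top]
    simpa using hγ

/-- The Laplace functionals of the Gibbs measures at functions whose supports escape to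
infinity. -/
theorem tendsto_integral_gibbs_prod {γ : ℝ} (hγ : 0 ≤ γ) (hg : IsDecayingKernel g)
    (hV0 : ∀ x, 0 ≤ V x) (hVm : Measurable V) (hV : Integrable fun x => Real.exp (-V x))
    {μ : ProbabilityMeasure (EuclideanSpace ℝ (Fin n))} (hμ : IsUniqueMinimizer γ g V μ)
    {β : ℕ → ℝ} (hβ_pos : ∀ N, 0 < β N)
    (hβ : Tendsto (fun N : ℕ => (N : ℝ) * β N) atTop (𝓝 γ))
    {h : ℕ → EuclideanSpace ℝ (Fin n) → ℝ}
    (hm : ∀ N, Measurable (h N)) (h0 : ∀ N x, 0 ≤ h N x) (h1 : ∀ N x, h N x ≤ 1)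
    (hsupp : ∀ S ∈ cocompact (EuclideanSpace ℝ (Fin n)), ∀ᶠ N in atTop, ∀ y, h N y ≠ 0 → y ∈ S)
    {T : ℝ} (hT : Tendsto (fun N : ℕ => (N : ℝ) * ∫ y, Real.exp (-V y) * h N y) atTop (𝓝 T)) :
    Tendsto (fun N => ∫ x, ∏ j, (1 - h N (x j)) ∂(gibbs g V (β N) N)) atTop
      (𝓝 (Real.exp (-((normConst γ g V μ)⁻¹ * T)))) := by
  set m := volume.tilted (fun x => -V x) with hmdef
  have : IsProbabilityMeasure m := isProbabilityMeasure_tilted hV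
  have := isCountablyGenerated_cocompact (EuclideanSpace ℝ (Fin n))
  have hgm : Measurable (Function.uncurry g) := hg.lsc.measurable
  have happ : IsApproxKernel g m := hg.isApproxKernel (tilted_le_smul hV0)
  obtain ⟨G, hG⟩ := happ.exists_lintegral_le
  have hGt : (G : ℝ≥0∞) ≠ ∞ := ENNReal.coe_ne_top
  have hc := integral_exp_neg_pos hV
  -- The limit theorem concerns `N + 2` particles at `b N`, while its law of large numbers uses `N +
  -- 1` particles at the same `b N`.
  set b : ℕ → ℝ≥0 := fun N => (β (N + 2)).toNNReal with hbdef
  have hb : Tendsto (fun N => ((N + 1 : ℕ) : ℝ) * b N) atTop (𝓝 γ) := by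
    have h2 := (tendsto_add_atTop_iff_nat 2).2 hβ
    have h3 : Tendsto (fun N : ℕ => ((N + 1 : ℕ) : ℝ) / ((N + 1 : ℕ) + 1)) atTop (𝓝 1) :=
      (tendsto_add_atTop_iff_nat 1).2 (tendsto_natCast_div_add_atTop (1 : ℝ))
    have h4 := h3.mul h2
    rw [one_mul] at h4
    refine h4.congr fun N => ?_
    rw [hbdef, Real.coe_toNNReal _ (hβ_pos _).le]
    push_cast
    field_simp
    ring
  obtain ⟨hI, hH⟩ := finite_of_minimizer hγ hGt hG (μ := (μ : Measure (EuclideanSpace ℝ (Fin n))))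
    (hμ.1 ⟨m, inferInstance⟩)
  have hlln := tendsto_lintegral_gasProb_abs_sub hγ hg.symm hg.lsc hGt hG hI hH hμ.lt hb
  have hT' : Tendsto (fun N : ℕ => ((N + 1 + 1 : ℕ) : ℝ) * ∫ y, h (N + 2) y ∂m) atTop
      (𝓝 ((∫ x, Real.exp (-V x))⁻¹ * T)) := by
    refine (((tendsto_add_atTop_iff_nat 2).2 hT).const_mul _).congr fun N => ?_
    have e : ∫ y, h (N + 2) y ∂m =
        (∫ x, Real.exp (-V x))⁻¹ * ∫ y, Real.exp (-V y) * h (N + 2) y := by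
      rw [hmdef, integral_tilted, ← integral_const_mul]
      refine integral_congr_ae (ae_of_all _ fun y => ?_)
      simp only [smul_eq_mul]
      ring
    rw [e]
    ring
  have key := tendsto_integral_gasProb_prod hγ hgm hg.symm happ hb hlln (fun N => hm (N + 2))
    (fun N => h0 (N + 2)) (fun N => h1 (N + 2))
    (fun S hS => (tendsto_add_atTop_nat 2).eventually (hsupp S hS)) hT'
  rw [← tendsto_add_atTop_iff_nat 2, normConst_eq hV0 hV hVm hgm]
  refine (key.2.congr fun N => ?_).trans_eq ?_
  · rw [gibbs_eq_gasProb hV0 hVm hV hgm]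
  · rw [mul_inv]
    congr 3
    ring

end Reference

end MeanFieldGas

namespace MeanFieldGas

/-! ### The zooming window escapes to infinity -/

section Escape

variable {X : Type*} [NormedAddCommGroup X]

theorem eventually_div_le_half_norm {ι : Type*} {l : Filter ι} {E : ι → X} {α : ι → ℝ}
    (hα : ∀ᶠ N in l, 0 < α N)
    (hαE : Tendsto (fun N => α N * ‖E N‖) l atTop) (R : ℝ) :
    ∀ᶠ N in l, R / α N ≤ ‖E N‖ / 2 := by
  filter_upwards [hα, hαE.eventually_ge_atTop (2 * R)] with N h1 h2
  rw [div_le_div_iff₀ h1 two_pos]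
  linarith

/-- Because `α N * ‖E N‖` diverges, the radius `R / α N` is eventually at most `‖E N‖ / 2`, so the
ball leaves every bounded set. -/
theorem eventually_closedBall_subset {ι : Type*} {l : Filter ι} {E : ι → X} {α : ι → ℝ}
    (hE : Tendsto (fun N => ‖E N‖) l atTop) (hα : ∀ᶠ N in l, 0 < α N)
    (hαE : Tendsto (fun N => α N * ‖E N‖) l atTop) (R : ℝ) {S : Set X}
    (hS : S ∈ Bornology.cobounded X) :
    ∀ᶠ N in l, Metric.closedBall (E N) (R / α N) ⊆ S := by
  rw [← comap_norm_atTop, mem_comap] at hS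
  obtain ⟨t, ht, htS⟩ := hS
  obtain ⟨c, hc⟩ := mem_atTop_sets.1 ht
  filter_upwards [eventually_div_le_half_norm hα hαE R, hE.eventually_ge_atTop (2 * c)]
    with N h1 h2 y hy
  refine htS (hc _ ?_)
  have h3 := mem_closedBall_iff_norm'.1 hy
  have h4 := norm_sub_norm_le (E N) y
  linarith

end Escape

/-! ### First-order Taylor estimate -/

section Taylor

variable {X : Type*} [NormedAddCommGroup X] [InnerProductSpace ℝ X] [CompleteSpace X]

/-- The mean value inequality is used twice: for the derivative of `V`, then for `V` minus its
linear part. The constant is not optimal, but only smallness is needed. -/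
theorem abs_sub_sub_inner_le {V : X → ℝ} {e v : X} {r M : ℝ} (hM : 0 ≤ M)
    (hV : ∀ p ∈ Metric.closedBall e r, ContDiffAt ℝ 2 V p) (hgrad : HasGradientAt V v e)
    (hH : ∀ p ∈ Metric.closedBall e r, ‖iteratedFDeriv ℝ 2 V p‖ ≤ M) {y : X} (hy : ‖y‖ ≤ r) :
    |V (e + y) - V e - ⟪v, y⟫| ≤ M * r * r := by
  have hr : 0 ≤ r := (norm_nonneg y).trans hy
  have hconv : Convex ℝ (Metric.closedBall e r) := convex_closedBall e r
  have he : e ∈ Metric.closedBall e r := Metric.mem_closedBall_self hr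
  have hd : fderiv ℝ V e = InnerProductSpace.toDual ℝ X v :=
    (hasGradientAt_iff_hasFDerivAt.1 hgrad).fderiv
  have h1 : ∀ p ∈ Metric.closedBall e r,
      ‖fderiv ℝ V p - InnerProductSpace.toDual ℝ X v‖ ≤ M * r := fun p hp => by
    rw [← hd]
    refine (hconv.norm_image_sub_le_of_norm_fderiv_le (𝕜 := ℝ) (C := M) (fun q hq => ?_)
      (fun q hq => ?_) he hp).trans ?_
    · exact ((hV q hq).fderiv_right (m := 1) (by norm_num)).differentiableAt (by simp)
    · rw [← norm_iteratedFDeriv_one, norm_iteratedFDeriv_fderiv]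
      exact hH q hq
    · exact mul_le_mul_of_nonneg_left (mem_closedBall_iff_norm.1 hp) hM
  have hye : e + y ∈ Metric.closedBall e r := by simpa [mem_closedBall_iff_norm] using hy
  have h2 := hconv.norm_image_sub_le_of_norm_fderiv_le' (𝕜 := ℝ)
    (fun p hp => (hV p hp).differentiableAt (by simp)) h1 he hye
  rw [add_sub_cancel_left, InnerProductSpace.toDual_apply_apply, Real.norm_eq_abs] at h2
  exact h2.trans (mul_le_mul_of_nonneg_left hy (by positivity))

end Taylor

/-! ### The intensity measure in the zoomed coordinates -/

section Zoom

variable {n : ℕ} {V : EuclideanSpace ℝ (Fin n) → ℝ} {E : ℕ → EuclideanSpace ℝ (Fin n)}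
  {α : ℕ → ℝ} {υ : ℕ → EuclideanSpace ℝ (Fin n)} {υlim : EuclideanSpace ℝ (Fin n)}
  {ψ : Diffeomorph 𝓘(ℝ, EuclideanSpace ℝ (Fin n)) 𝓘(ℝ, EuclideanSpace ℝ (Fin n))
      (EuclideanSpace ℝ (Fin n)) (EuclideanSpace ℝ (Fin n)) 1}

theorem zoomInv_symm_mem_imp {e : EuclideanSpace ℝ (Fin n)} {a : ℝ} (ha : 0 < a)
    {K : Set (EuclideanSpace ℝ (Fin n))} {R : ℝ} (hR : ∀ x ∈ K, ‖ψ x‖ ≤ R)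
    {y : EuclideanSpace ℝ (Fin n)} (hy : zoomInv e a ψ.symm y ∈ K) :
    y ∈ Metric.closedBall e (R / a) := by
  have h1 := hR _ hy
  rw [zoomInv, ψ.apply_symm_apply, norm_smul, Real.norm_eq_abs, abs_of_pos ha] at h1
  rw [mem_closedBall_iff_norm, le_div_iff₀ ha]
  linarith

/-- The potential is asymptotically affine on the zooming scale. -/
theorem exists_tendsto_zero_abs_sub_inner_le
    (hV_C2 : ∃ K : Set (EuclideanSpace ℝ (Fin n)), IsCompact K ∧ ContDiffOn ℝ 2 V Kᶜ)
    (hE : Tendsto (fun N => ‖E N‖) atTop atTop) (hα : ∀ᶠ N in atTop, 0 < α N)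
    (hgrad : ∀ᶠ N in atTop, HasGradientAt V (α N • υ N) (E N))
    (hαE : Tendsto (fun N => α N * ‖E N‖) atTop atTop)
    (hc2 : ∀ 𝒦 : Set (EuclideanSpace ℝ (Fin n)), IsCompact 𝒦 →
      Tendsto (fun N => ENNReal.ofReal ((α N ^ 2)⁻¹) *
        ⨆ x ∈ 𝒦, ‖iteratedFDeriv ℝ 2 V (zoom (E N) (α N) ψ x)‖ₑ) atTop (𝓝 0)) (R : ℝ) :
    ∃ δ : ℕ → ℝ, Tendsto δ atTop (𝓝 0) ∧ ∀ᶠ N in atTop, ∀ z, ‖z‖ ≤ R →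
      |V (E N + (α N)⁻¹ • z) - V (E N) - ⟪υ N, z⟫| ≤ δ N := by
  obtain ⟨K₀, hK₀, hVK⟩ := hV_C2
  -- The compact set `ψ⁻¹(closedBall 0 R)` is chosen so that its zoomed image is the ball of radius
  -- `R / α N` around `E N`.
  set D : ℕ → ℝ≥0∞ := fun N => ENNReal.ofReal ((α N ^ 2)⁻¹) *
    ⨆ x ∈ ψ.symm '' Metric.closedBall 0 R, ‖iteratedFDeriv ℝ 2 V (zoom (E N) (α N) ψ x)‖ₑ with hD
  have hDlim : Tendsto D atTop (𝓝 0) :=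
    hc2 _ ((isCompact_closedBall _ _).image ψ.symm.continuous)
  -- The Hessian bound `α² D` times the squared radius `(R / α)²`.
  refine ⟨fun N => (D N).toReal * R * R, ?_, ?_⟩
  · have := (ENNReal.tendsto_toReal ENNReal.zero_ne_top).comp hDlim
    simpa [Function.comp_def] using (this.mul_const R).mul_const R
  have hK₀' : K₀ᶜ ∈ Bornology.cobounded (EuclideanSpace ℝ (Fin n)) := by
    rw [Metric.cobounded_eq_cocompact]
    exact hK₀.compl_mem_cocompact
  filter_upwards [hα, hgrad, eventually_closedBall_subset hE hα hαE R hK₀',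
    hDlim.eventually (gt_mem_nhds zero_lt_one)] with N hαN hgN hsub hD1 z hz
  have hDt : D N ≠ ∞ := (hD1.trans ENNReal.one_lt_top).ne
  have hH : ∀ p ∈ Metric.closedBall (E N) (R / α N),
      ‖iteratedFDeriv ℝ 2 V p‖ ≤ α N ^ 2 * (D N).toReal := fun p hp => by
    have h1 : ‖α N • (p - E N)‖ ≤ R := by
      rw [norm_smul, Real.norm_eq_abs, abs_of_pos hαN]
      have := mem_closedBall_iff_norm.1 hp
      rw [le_div_iff₀ hαN] at this
      linarith
    have h2 : zoom (E N) (α N) ψ (ψ.symm (α N • (p - E N))) = p :=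
      zoom_zoomInv (E N) hαN ψ.toEquiv p
    have h3 : ENNReal.ofReal ((α N ^ 2)⁻¹) * ‖iteratedFDeriv ℝ 2 V p‖ₑ ≤ D N := by
      refine mul_le_mul_right ?_ _
      exact le_iSup₂_of_le (f := fun x (_ : x ∈ ψ.symm '' Metric.closedBall 0 R) =>
        ‖iteratedFDeriv ℝ 2 V (zoom (E N) (α N) ψ x)‖ₑ) (ψ.symm (α N • (p - E N)))
        ⟨_, mem_closedBall_zero_iff.2 h1, rfl⟩ (by rw [h2])
    have h4 := ENNReal.toReal_mono hDt h3
    rw [ENNReal.toReal_mul, ENNReal.toReal_ofReal (by positivity), toReal_enorm,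
      inv_mul_le_iff₀ (by positivity)] at h4
    exact h4
  have hzr : ‖(α N)⁻¹ • z‖ ≤ R / α N := by
    rw [norm_smul, norm_inv, Real.norm_eq_abs, abs_of_pos hαN, div_eq_inv_mul]
    gcongr
  have h5 := abs_sub_sub_inner_le (by positivity) (fun p hp => hVK.contDiffAt
    (hK₀.isClosed.isOpen_compl.mem_nhds (hsub hp))) hgN hH hzr
  rw [inner_smul_left, inner_smul_right, conj_trivial, ← mul_assoc, mul_inv_cancel₀ hαN.ne',
    one_mul] at h5
  refine h5.trans_eq ?_
  field_simp

theorem integral_comp_diffeomorph (hψ : ∀ x, |(fderiv ℝ ψ x).det| = 1)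
    (f : EuclideanSpace ℝ (Fin n) → ℝ) : ∫ x, f (ψ x) = ∫ z, f z := by
  have h := integral_image_eq_integral_abs_det_fderiv_smul volume MeasurableSet.univ
    (fun x _ => ((ψ.contDiff.differentiable (by simp)) x).hasFDerivAt.hasFDerivWithinAt)
    ψ.injective.injOn f
  have hr : Set.range ψ = Set.univ := ψ.surjective.range_eq
  rw [Set.image_univ, hr] at h
  simpa [hψ] using h.symm

theorem integral_zoom (G : EuclideanSpace ℝ (Fin n) → ℝ) (e : EuclideanSpace ℝ (Fin n)) {a : ℝ}
    (ha : 0 < a) : ∫ y, G y = (a ^ n)⁻¹ * ∫ z, G (e + a⁻¹ • z) := by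
  rw [Measure.integral_comp_smul volume (fun z => G (e + z)), integral_add_left_eq_self G e,
    finrank_euclideanSpace_fin, smul_eq_mul, inv_pow, inv_inv, abs_of_pos (pow_pos ha n),
    inv_mul_cancel_left₀ (pow_pos ha n).ne']

/-- Substituting `y = E + α⁻¹ z` extracts `N e^{-V(E)} / αⁿ`, which tends to `L`. What remains is an
integral over a fixed ball, where the increment of `V` tends to `⟪υlim, z⟫`; volume preservation by
`ψ` returns to the variable `x`. -/
theorem tendsto_integral_zoom
    (hV_cont : Continuous V)
    (hV_C2 : ∃ K : Set (EuclideanSpace ℝ (Fin n)), IsCompact K ∧ ContDiffOn ℝ 2 V Kᶜ)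
    (hE : Tendsto (fun N => ‖E N‖) atTop atTop) (hα : ∀ᶠ N in atTop, 0 < α N)
    (hυ : ∀ᶠ N in atTop, ‖υ N‖ = 1)
    (hgrad : ∀ᶠ N in atTop, HasGradientAt V (α N • υ N) (E N))
    {L : ℝ} (hL : Tendsto (fun N : ℕ => (N : ℝ) * Real.exp (-V (E N)) / α N ^ n) atTop (𝓝 L))
    (hυlim : Tendsto υ atTop (𝓝 υlim))
    (hαE : Tendsto (fun N => α N * ‖E N‖) atTop atTop)
    (hψ : ∀ x, |(fderiv ℝ ψ x).det| = 1)
    (hc2 : ∀ 𝒦 : Set (EuclideanSpace ℝ (Fin n)), IsCompact 𝒦 →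
      Tendsto (fun N => ENNReal.ofReal ((α N ^ 2)⁻¹) *
        ⨆ x ∈ 𝒦, ‖iteratedFDeriv ℝ 2 V (zoom (E N) (α N) ψ x)‖ₑ) atTop (𝓝 0))
    {F : EuclideanSpace ℝ (Fin n) → ℝ} (hF : Continuous F) (hF0 : ∀ x, 0 ≤ F x)
    (hF1 : ∀ x, F x ≤ 1) (hFc : HasCompactSupport F) :
    Tendsto (fun N : ℕ => (N : ℝ) * ∫ y, Real.exp (-V y) * F (zoomInv (E N) (α N) ψ.symm y)) atTop
      (𝓝 (L * ∫ x, Real.exp (-⟪υlim, ψ x⟫) * F x)) := by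
  obtain ⟨R, hR⟩ : ∃ R, ∀ x ∈ tsupport F, ‖ψ x‖ ≤ R := by
    obtain ⟨R, hR⟩ := (hFc.isCompact.image ψ.continuous).isBounded.exists_norm_le
    exact ⟨R, fun x hx => hR _ ⟨x, hx, rfl⟩⟩
  have hFz : ∀ z, R < ‖z‖ → F (ψ.symm z) = 0 := fun z hz => by
    by_contra h
    have := hR _ (subset_tsupport F h)
    rw [ψ.apply_symm_apply] at this
    linarith
  obtain ⟨δ, hδ0, hδ⟩ := exists_tendsto_zero_abs_sub_inner_le hV_C2 hE hα hgrad hαE hc2 R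
  have hdct : Tendsto (fun N => ∫ z, Real.exp (-(V (E N + (α N)⁻¹ • z) - V (E N))) * F (ψ.symm z))
      atTop (𝓝 (∫ z, Real.exp (-⟪υlim, z⟫) * F (ψ.symm z))) := by
    -- On the ball, `⟪υ N, z⟫ ≥ -R` because `υ N` is a unit vector, and the Taylor error is
    -- eventually below `1`; hence the dominating constant `e^{R+1}`.
    refine tendsto_integral_filter_of_dominated_convergence
      ((Metric.closedBall 0 R).indicator fun _ => Real.exp (R + 1)) ?_ ?_ ?_ ?_
    · refine Eventually.of_forall fun N => Continuous.aestronglyMeasurable ?_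
      exact (Real.continuous_exp.comp ((hV_cont.comp (by fun_prop)).sub continuous_const).neg).mul
        (hF.comp ψ.symm.continuous)
    · filter_upwards [hδ, hυ, hδ0.eventually (gt_mem_nhds zero_lt_one)] with N h1 h2 h3
      refine ae_of_all _ fun z => ?_
      by_cases hz : ‖z‖ ≤ R
      · rw [Set.indicator_of_mem (mem_closedBall_zero_iff.2 hz), norm_mul, Real.norm_eq_abs,
          Real.norm_eq_abs, Real.abs_exp, abs_of_nonneg (hF0 _)]
        refine (mul_le_of_le_one_right (Real.exp_nonneg _) (hF1 _)).trans (Real.exp_le_exp.2 ?_)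
        have h4 := (abs_le.1 (h1 z hz)).1
        have h5 := (abs_le.1 (abs_real_inner_le_norm (υ N) z)).1
        rw [h2, one_mul] at h5
        linarith
      · rw [hFz z (not_le.1 hz), mul_zero, norm_zero]
        exact Set.indicator_nonneg (fun _ _ => Real.exp_nonneg _) z
    · exact (integrable_indicator_iff Metric.isClosed_closedBall.measurableSet).2
        (integrableOn_const (isCompact_closedBall _ _).measure_lt_top.ne)
    · refine ae_of_all _ fun z => ?_
      by_cases hz : ‖z‖ ≤ R
      · refine Tendsto.mul_const _ ((Real.continuous_exp.tendsto _).comp (Tendsto.neg ?_))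
        have h1 : Tendsto (fun N => V (E N + (α N)⁻¹ • z) - V (E N) - ⟪υ N, z⟫) atTop (𝓝 0) :=
          squeeze_zero_norm' (hδ.mono fun N h => h z hz) hδ0
        have h2 : Tendsto (fun N => ⟪υ N, z⟫) atTop (𝓝 ⟪υlim, z⟫) :=
          hυlim.inner tendsto_const_nhds
        simpa using h1.add h2
      · simp [hFz z (not_le.1 hz)]
  have hcov : ∫ x, Real.exp (-⟪υlim, ψ x⟫) * F x = ∫ z, Real.exp (-⟪υlim, z⟫) * F (ψ.symm z) := by
    rw [← integral_comp_diffeomorph hψ fun z => Real.exp (-⟪υlim, z⟫) * F (ψ.symm z)]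
    simp only [ψ.symm_apply_apply]
  rw [hcov]
  refine (hL.mul hdct).congr' ?_
  filter_upwards [hα] with N hαN
  rw [integral_zoom (fun y => Real.exp (-V y) * F (zoomInv (E N) (α N) ψ.symm y)) (E N) hαN]
  have e : ∀ z, Real.exp (-V (E N + (α N)⁻¹ • z)) *
      F (zoomInv (E N) (α N) ψ.symm (E N + (α N)⁻¹ • z)) = Real.exp (-V (E N)) *
        (Real.exp (-(V (E N + (α N)⁻¹ • z) - V (E N))) * F (ψ.symm z)) := fun z => by
    rw [← mul_assoc, ← Real.exp_add, zoomInv, add_sub_cancel_left, smul_smul,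
      mul_inv_cancel₀ hαN.ne', one_smul]
    congr 2
    ring
  simp_rw [e]
  rw [integral_const_mul]
  ring

theorem eventually_forall_mem_of_zoomInv_ne_zero
    (hE : Tendsto (fun N => ‖E N‖) atTop atTop) (hα : ∀ᶠ N in atTop, 0 < α N)
    (hαE : Tendsto (fun N => α N * ‖E N‖) atTop atTop)
    {F : EuclideanSpace ℝ (Fin n) → ℝ} (hFc : HasCompactSupport F)
    {S : Set (EuclideanSpace ℝ (Fin n))} (hS : S ∈ cocompact (EuclideanSpace ℝ (Fin n))) :
    ∀ᶠ N in atTop, ∀ y, F (zoomInv (E N) (α N) ψ.symm y) ≠ 0 → y ∈ S := by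
  obtain ⟨R, hR⟩ := (hFc.isCompact.image ψ.continuous).isBounded.exists_norm_le
  rw [← Metric.cobounded_eq_cocompact] at hS
  filter_upwards [hα, eventually_closedBall_subset hE hα hαE R hS] with N h1 h2 y hy
  exact h2 (zoomInv_symm_mem_imp h1 (fun x hx => hR _ ⟨x, hx, rfl⟩) (subset_tsupport F hy))

end Zoom

end MeanFieldGas

namespace MeanFieldGas

open ProbabilityTheory

/-! ### Construction of Poisson processes -/

section PointProcess

variable {X : Type*} [MeasurableSpace X]

/-- The point measure built from countably many finite families of points. -/
noncomputable def pointSum (ω : ℕ → ℕ × (ℕ → X)) : Measure X :=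
  Measure.sum fun i : {j : ℕ | j.unpair.2 < (ω j.unpair.1).1} =>
    Measure.dirac ((ω (i : ℕ).unpair.1).2 (i : ℕ).unpair.2)

/-- A pair (family, position) is coded by one natural number, so that the points are indexed by a
set of naturals as `IsPointProcess` requires; here the code is undone. -/
theorem lintegral_pointSum (ω : ℕ → ℕ × (ℕ → X)) {f : X → ℝ≥0∞} (hf : Measurable f) :
    ∫⁻ x, f x ∂(pointSum ω) = ∑' k, ∑ i ∈ Finset.range (ω k).1, f ((ω k).2 i) := by
  rw [pointSum, lintegral_sum_measure]
  simp_rw [lintegral_dirac' _ hf]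
  rw [tsum_subtype {j : ℕ | j.unpair.2 < (ω j.unpair.1).1}
    (fun j => f ((ω j.unpair.1).2 j.unpair.2)), ← Nat.pairEquiv.tsum_eq, ENNReal.tsum_prod']
  refine tsum_congr fun k => ?_
  rw [tsum_eq_sum (s := Finset.range (ω k).1)]
  · refine Finset.sum_congr rfl fun i hi => ?_
    simp [Set.indicator, Finset.mem_range.1 hi]
  · intro i hi
    rw [Finset.mem_range, not_lt] at hi
    simp [Set.indicator, hi.not_gt]

theorem measurable_sum_range {f : X → ℝ≥0∞} (hf : Measurable f) :
    Measurable fun q : ℕ × (ℕ → X) => ∑ i ∈ Finset.range q.1, f (q.2 i) :=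
  measurable_from_prod_countable_right fun N =>
    (show Measurable fun a : ℕ → X => ∑ i ∈ Finset.range N, f (a i) from
      Finset.measurable_sum _ fun i _ =>
        (show Measurable fun a : ℕ → X => f (a i) from hf.comp (measurable_pi_apply i)))

theorem measurable_pointSum : Measurable (pointSum : (ℕ → ℕ × (ℕ → X)) → Measure X) := by
  refine Measure.measurable_of_measurable_coe _ fun s hs => ?_
  have h1 : Measurable (s.indicator (1 : X → ℝ≥0∞)) := measurable_one.indicator hs
  have e : ∀ ω : ℕ → ℕ × (ℕ → X), pointSum ω s =
      ∑' k, ∑ i ∈ Finset.range (ω k).1, s.indicator 1 ((ω k).2 i) := fun ω => by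
    rw [← lintegral_pointSum ω h1, lintegral_indicator_one hs]
  simp_rw [e]
  exact Measurable.tsum fun k => (measurable_sum_range h1).comp (measurable_pi_apply k)

theorem lintegral_infinitePi_prod {Y : ℕ → Type*} [∀ i, MeasurableSpace (Y i)]
    (P : ∀ i, Measure (Y i)) [∀ i, IsProbabilityMeasure (P i)] {F : ∀ i, Y i → ℝ≥0∞}
    (hF : ∀ i, Measurable (F i)) (s : Finset ℕ) :
    ∫⁻ ω, ∏ i ∈ s, F i (ω i) ∂(Measure.infinitePi P) = ∏ i ∈ s, ∫⁻ y, F i y ∂(P i) := by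
  refine (lintegral_prod_eq_prod_lintegral_of_indepFun s
    (fun i (ω : ∀ i, Y i) => F i (ω i)) (iIndepFun_infinitePi hF)
    fun i => (hF i).comp (measurable_pi_apply i)).trans ?_
  refine Finset.prod_congr rfl fun i _ => ?_
  rw [← Measure.infinitePi_map_eval P i, lintegral_map (hF i) (measurable_pi_apply i)]

theorem lintegral_pow_poissonMeasure (r : ℝ≥0) {p : ℝ≥0∞} (hp : p ≤ 1) :
    ∫⁻ N, p ^ N ∂(poissonMeasure r) = expNeg (r * (1 - p)) := by
  obtain ⟨t, rfl⟩ : ∃ t : ℝ≥0, p = t := ⟨p.toNNReal, (ENNReal.coe_toNNReal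
    (ne_top_of_le_ne_top ENNReal.one_ne_top hp)).symm⟩
  have ht : t ≤ 1 := by exact_mod_cast hp
  have hs : HasSum (fun N : ℕ => Real.exp (-r) * r ^ N / N.factorial * (t : ℝ) ^ N)
      (Real.exp (-r) * Real.exp (r * t)) := by
    have := (NormedSpace.expSeries_div_hasSum_exp ((r : ℝ) * t)).mul_left (Real.exp (-r))
    rw [← Real.exp_eq_exp_ℝ] at this
    refine this.congr_fun ?_
    intro N
    rw [mul_pow]
    ring
  rw [poissonMeasure, lintegral_sum_measure]
  simp_rw [lintegral_smul_measure, lintegral_dirac, smul_eq_mul]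
  have e : ∀ N : ℕ, ENNReal.ofReal (Real.exp (-r) * r ^ N / N.factorial) * (t : ℝ≥0∞) ^ N =
      ENNReal.ofReal (Real.exp (-r) * r ^ N / N.factorial * (t : ℝ) ^ N) := fun N => by
    rw [ENNReal.ofReal_mul (by positivity), ENNReal.ofReal_pow t.coe_nonneg,
      ENNReal.ofReal_coe_nnreal]
  simp_rw [e]
  rw [← ENNReal.ofReal_tsum_of_nonneg (fun N => by positivity) hs.summable, hs.tsum_eq,
    ← ENNReal.coe_one, ← ENNReal.coe_sub, ← ENNReal.coe_mul, expNeg_coe, ← Real.exp_add]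
  congr 2
  rw [NNReal.coe_mul, NNReal.coe_sub ht, NNReal.coe_one]
  ring

/-- Given the number `N` of points, independence yields `p^N` with `p = ∫ e^{-f} dρ`; the generating
function of the Poisson law does the rest. -/
theorem lintegral_expNeg_poisson (r : ℝ≥0) (ρ : Measure X) [IsProbabilityMeasure ρ]
    {f : X → ℝ≥0∞} (hf : Measurable f) :
    ∫⁻ q, expNeg (∑ i ∈ Finset.range q.1, f (q.2 i))
      ∂((poissonMeasure r).prod (Measure.infinitePi fun _ : ℕ => ρ)) =
      expNeg (∫⁻ x, (1 - expNeg (f x)) ∂(r • ρ)) := by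
  have hfm : Measurable fun x => expNeg (f x) := measurable_expNeg.comp hf
  have hle : ∫⁻ x, expNeg (f x) ∂ρ ≤ 1 := by
    calc ∫⁻ x, expNeg (f x) ∂ρ ≤ ∫⁻ _, 1 ∂ρ := lintegral_mono fun x => expNeg_le_one _
      _ = 1 := by simp
  have hF : Measurable fun q : ℕ × (ℕ → X) => expNeg (∑ i ∈ Finset.range q.1, f (q.2 i)) :=
    measurable_expNeg.comp (measurable_sum_range hf)
  rw [lintegral_prod _ hF.aemeasurable]
  simp_rw [expNeg_sum, lintegral_infinitePi_prod (fun _ : ℕ => ρ) (fun _ => hfm), Finset.prod_const,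
    Finset.card_range]
  rw [lintegral_pow_poissonMeasure r hle, lintegral_smul_measure, lintegral_sub hfm
    (ne_top_of_le_ne_top ENNReal.one_ne_top hle) (ae_of_all _ fun x => expNeg_le_one _)]
  simp [ENNReal.smul_def]

theorem tendsto_expNeg_tsum (a : ℕ → ℝ≥0∞) :
    Tendsto (fun K => ∏ k ∈ Finset.range K, expNeg (a k)) atTop (𝓝 (expNeg (∑' k, a k))) := by
  simp_rw [← expNeg_sum]
  exact (continuous_expNeg.tendsto _).comp (ENNReal.tendsto_nat_tsum a)

/-- The Laplace functional of a superposition of independent Poisson processes. -/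
theorem lintegral_expNeg_pointSum (r : ℕ → ℝ≥0) (ρ : ℕ → Measure X)
    [∀ k, IsProbabilityMeasure (ρ k)] {f : X → ℝ≥0∞} (hf : Measurable f) :
    ∫⁻ ω, expNeg (∫⁻ x, f x ∂(pointSum ω)) ∂(Measure.infinitePi fun k =>
      (poissonMeasure (r k)).prod (Measure.infinitePi fun _ : ℕ => ρ k)) =
      expNeg (∫⁻ x, (1 - expNeg (f x)) ∂(Measure.sum fun k => r k • ρ k)) := by
  have hF : Measurable fun q : ℕ × (ℕ → X) => expNeg (∑ i ∈ Finset.range q.1, f (q.2 i)) :=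
    measurable_expNeg.comp (measurable_sum_range hf)
  simp_rw [lintegral_pointSum _ hf, lintegral_sum_measure]
  -- Finitely many families factor by independence; both sides are limits of such finite
  -- superpositions.
  refine tendsto_nhds_unique ?_ (tendsto_expNeg_tsum _)
  simp_rw [← lintegral_expNeg_poisson _ _ hf]
  simp_rw [← lintegral_infinitePi_prod (fun k => (poissonMeasure (r k)).prod
    (Measure.infinitePi fun _ : ℕ => ρ k)) (fun _ => hF)]
  refine tendsto_lintegral_of_dominated_convergence (fun _ => 1)
    (fun K => Finset.measurable_prod _ fun k _ => hF.comp (measurable_pi_apply k))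
    (fun K => ae_of_all _ fun ω => Finset.prod_le_one' fun k _ => expNeg_le_one _) (by simp)
    (ae_of_all _ fun ω => tendsto_expNeg_tsum _)

theorem exists_eq_smul_probabilityMeasure [Nonempty X] (ν : Measure X) [IsFiniteMeasure ν] :
    ∃ (r : ℝ≥0) (ρ : Measure X), IsProbabilityMeasure ρ ∧ ν = r • ρ := by
  rcases eq_or_ne ν 0 with rfl | hν
  · exact ⟨0, Measure.dirac (Classical.arbitrary X), inferInstance, by simp⟩
  have h0 : ν Set.univ ≠ 0 := by simpa using hν
  refine ⟨(ν Set.univ).toNNReal, (ν Set.univ)⁻¹ • ν, ⟨?_⟩, ?_⟩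
  · rw [Measure.smul_apply, smul_eq_mul, ENNReal.inv_mul_cancel h0 (measure_ne_top _ _)]
  · rw [ENNReal.smul_def, ENNReal.coe_toNNReal (measure_ne_top _ _), smul_smul,
      ENNReal.mul_inv_cancel h0 (measure_ne_top _ _), one_smul]

variable {n : ℕ} {Ω : Type*} [MeasurableSpace Ω] {P : Measure Ω}
  {Ξ : Ω → Measure (EuclideanSpace ℝ (Fin n))} {θ : Measure (EuclideanSpace ℝ (Fin n))}

/-- Test with `t · 1_K`: since `e^{-tΞ(K)}` vanishes where `Ξ(K) = ∞`, finiteness has probability at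
least `exp(-(1 - e^{-t}) θ(K))`, which tends to `1` as `t` decreases to `0`. -/
theorem ae_lt_top_of_laplace_eq [IsProbabilityMeasure P] (hΞ : Measurable Ξ)
    (h : ∀ f : EuclideanSpace ℝ (Fin n) → ℝ≥0, Measurable f →
      laplace P Ξ f = expNeg (∫⁻ x, (1 - expNeg (f x : ℝ≥0∞)) ∂θ))
    {K : Set (EuclideanSpace ℝ (Fin n))} (hK : MeasurableSet K) (hθ : θ K ≠ ∞) :
    ∀ᵐ ω ∂P, Ξ ω K < ∞ := by
  have hm : Measurable fun ω => Ξ ω K := (Measure.measurable_coe hK).comp hΞ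
  have hS : MeasurableSet {ω | Ξ ω K < ∞} := hm measurableSet_Iio
  refine (prob_compl_eq_zero_iff hS).2 (le_antisymm prob_le_one ?_)
  have key : ∀ t : ℝ≥0, 0 < t → expNeg ((1 - expNeg t) * θ K) ≤ P {ω | Ξ ω K < ∞} := fun t ht => by
    have h1 := h (K.indicator fun _ => t) (measurable_const.indicator hK)
    have e1 : ∀ ν : Measure (EuclideanSpace ℝ (Fin n)),
        ∫⁻ x, (K.indicator (fun _ => t) x : ℝ≥0) ∂ν = t * ν K := fun ν => by
      have : ∀ x, ((K.indicator (fun _ => t) x : ℝ≥0) : ℝ≥0∞) = K.indicator (fun _ => (t : ℝ≥0∞)) x :=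
        fun x => by by_cases hx : x ∈ K <;> simp [hx]
      simp_rw [this]
      rw [lintegral_indicator_const hK]
    have e2 : ∫⁻ x, (1 - expNeg (K.indicator (fun _ => t) x : ℝ≥0)) ∂θ = (1 - expNeg t) * θ K := by
      have : ∀ x, 1 - expNeg ((K.indicator (fun _ => t) x : ℝ≥0) : ℝ≥0∞) =
          K.indicator (fun _ => 1 - expNeg t) x := fun x => by by_cases hx : x ∈ K <;> simp [hx]
      simp_rw [this]
      rw [lintegral_indicator_const hK]
    rw [e2] at h1
    rw [← h1, laplace, ← lintegral_indicator_one hS]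
    simp_rw [e1]
    refine lintegral_mono fun ω => ?_
    by_cases hω : Ξ ω K < ∞
    · rw [Set.indicator_of_mem (by exact hω)]
      exact expNeg_le_one _
    · rw [not_lt_top_iff.1 hω, ENNReal.mul_top (by exact_mod_cast ht.ne'), expNeg_top]
      exact zero_le
  have hlim : Tendsto (fun j : ℕ => expNeg ((1 - expNeg ((1 / ((j : ℝ≥0) + 1) : ℝ≥0) : ℝ≥0∞)) *
      θ K)) atTop (𝓝 (expNeg ((1 - expNeg ((0 : ℝ≥0) : ℝ≥0∞)) * θ K))) := by
    refine (continuous_expNeg.tendsto _).comp (ENNReal.Tendsto.mul_const ?_ (Or.inr hθ))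
    refine ENNReal.Tendsto.sub tendsto_const_nhds ((continuous_expNeg.tendsto _).comp
      (ENNReal.tendsto_coe.2 ?_)) (Or.inl ENNReal.one_ne_top)
    exact tendsto_one_div_add_atTop_nhds_zero_nat
  simp only [ENNReal.coe_zero, expNeg_zero, tsub_self, zero_mul] at hlim
  exact le_of_tendsto' hlim fun j => key _ (by positivity)

/-- Decompose `θ` into finite measures `r k • ρ k` and superpose independent families, each a
Poisson number of independent points of law `ρ k`. Local finiteness is read off from the Laplace
functional on countably many balls. -/
theorem exists_isPoissonProcess (θ : Measure (EuclideanSpace ℝ (Fin n))) [SFinite θ]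
    (hθ : ∀ K : Set (EuclideanSpace ℝ (Fin n)), IsCompact K → θ K < ∞) :
    ∃ (Ω : Type) (_ : MeasurableSpace Ω) (P : Measure Ω)
      (Ξ : Ω → Measure (EuclideanSpace ℝ (Fin n))), IsPoissonProcess P Ξ θ := by
  choose r ρ hρ hr using fun k => exists_eq_smul_probabilityMeasure (sfiniteSeq θ k)
  have hsum : Measure.sum (fun k => r k • ρ k) = θ := by
    simp_rw [← hr]
    exact sum_sfiniteSeq θ
  have hlap : ∀ f : EuclideanSpace ℝ (Fin n) → ℝ≥0, Measurable f →
      laplace (Measure.infinitePi fun k => (poissonMeasure (r k)).prod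
        (Measure.infinitePi fun _ : ℕ => ρ k)) pointSum f =
        expNeg (∫⁻ x, (1 - expNeg (f x : ℝ≥0∞)) ∂θ) := fun f hf => by
    rw [laplace, lintegral_expNeg_pointSum r ρ hf.coe_nnreal_ennreal, hsum]
  refine ⟨_, inferInstance, _, pointSum, ⟨inferInstance, measurable_pointSum,
    ae_of_all _ fun ω => ⟨_, fun j => (ω j.unpair.1).2 j.unpair.2, rfl⟩, ?_⟩, hlap⟩
  have h1 : ∀ j : ℕ, ∀ᵐ ω ∂(Measure.infinitePi fun k => (poissonMeasure (r k)).prod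
      (Measure.infinitePi fun _ : ℕ => ρ k)), pointSum ω (Metric.closedBall 0 j) < ∞ := fun j =>
    ae_lt_top_of_laplace_eq measurable_pointSum hlap Metric.isClosed_closedBall.measurableSet
      (hθ _ (isCompact_closedBall _ _)).ne
  filter_upwards [ae_all_iff.2 h1] with ω hω K hK
  obtain ⟨R, hR⟩ := hK.isBounded.subset_closedBall 0
  obtain ⟨j, hj⟩ := exists_nat_ge R
  exact (measure_mono (hR.trans (Metric.closedBall_subset_closedBall hj))).trans_lt (hω j)

end PointProcess

end MeanFieldGas

namespace MeanFieldGas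

/-! ### Translation to Laplace functionals of point processes -/

section Final

variable {n : ℕ} {g : EuclideanSpace ℝ (Fin n) → EuclideanSpace ℝ (Fin n) → ℝ≥0∞}
  {V : EuclideanSpace ℝ (Fin n) → ℝ}

theorem isProbabilityMeasure_gibbs (hg : IsDecayingKernel g) (hV0 : ∀ x, 0 ≤ V x)
    (hVm : Measurable V) (hV : Integrable fun x => Real.exp (-V x)) (β : ℝ) (N : ℕ) :
    IsProbabilityMeasure (gibbs g V β N) := by
  have : IsProbabilityMeasure (volume.tilted fun x => -V x) := isProbabilityMeasure_tilted hV
  obtain ⟨G, hG⟩ := (hg.isApproxKernel (tilted_le_smul hV0)).exists_lintegral_le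
  rw [gibbs_eq_gasProb hV0 hVm hV hg.lsc.measurable]
  exact isProbabilityMeasure_gasProb _ hg.lsc.measurable hg.symm ENNReal.coe_ne_top hG _ _

/-- The function `1 - e^{-f}`. -/
noncomputable def oneSubExp (f : EuclideanSpace ℝ (Fin n) → ℝ≥0) (x : EuclideanSpace ℝ (Fin n)) : ℝ :=
  1 - Real.exp (-(f x : ℝ))

theorem oneSubExp_nonneg (f : EuclideanSpace ℝ (Fin n) → ℝ≥0) (x : EuclideanSpace ℝ (Fin n)) :
    0 ≤ oneSubExp f x := sub_nonneg.2 (Real.exp_le_one_iff.2 (neg_nonpos.2 (f x).coe_nonneg))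

theorem oneSubExp_le_one (f : EuclideanSpace ℝ (Fin n) → ℝ≥0) (x : EuclideanSpace ℝ (Fin n)) :
    oneSubExp f x ≤ 1 := sub_le_self _ (Real.exp_nonneg _)

theorem continuous_oneSubExp {f : EuclideanSpace ℝ (Fin n) → ℝ≥0} (hf : Continuous f) :
    Continuous (oneSubExp f) :=
  continuous_const.sub (Real.continuous_exp.comp (NNReal.continuous_coe.comp hf).neg)

theorem hasCompactSupport_oneSubExp {f : EuclideanSpace ℝ (Fin n) → ℝ≥0}
    (hf : HasCompactSupport f) : HasCompactSupport (oneSubExp f) :=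
  hf.comp_left (g := fun t : ℝ≥0 => 1 - Real.exp (-(t : ℝ))) (by simp)

theorem ofReal_oneSubExp (f : EuclideanSpace ℝ (Fin n) → ℝ≥0) (x : EuclideanSpace ℝ (Fin n)) :
    ENNReal.ofReal (oneSubExp f x) = 1 - expNeg (f x : ℝ≥0∞) := by
  rw [oneSubExp, expNeg_coe, ENNReal.ofReal_sub _ (Real.exp_nonneg _), ENNReal.ofReal_one]

theorem laplace_zoomedProcess {N : ℕ} (P : Measure (Fin N → EuclideanSpace ℝ (Fin n)))
    [IsProbabilityMeasure P] (e : EuclideanSpace ℝ (Fin n)) (a : ℝ)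
    {ψinv : EuclideanSpace ℝ (Fin n) → EuclideanSpace ℝ (Fin n)} (hψ : Measurable (zoomInv e a ψinv))
    {f : EuclideanSpace ℝ (Fin n) → ℝ≥0} (hf : Measurable f) :
    laplace P (zoomedProcess e a ψinv N) f =
      ENNReal.ofReal (∫ x, ∏ j, (1 - oneSubExp f (zoomInv e a ψinv (x j))) ∂P) := by
  have hm : Measurable fun x : Fin N → EuclideanSpace ℝ (Fin n) =>
      ∏ j, Real.exp (-(f (zoomInv e a ψinv (x j)) : ℝ)) :=
    Finset.measurable_prod _ fun j _ => Real.measurable_exp.comp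
      ((hf.comp (hψ.comp (measurable_pi_apply j))).coe_nnreal_real).neg
  simp only [oneSubExp, sub_sub_cancel]
  have h0 : ∀ x : Fin N → EuclideanSpace ℝ (Fin n),
      0 ≤ ∏ j, Real.exp (-(f (zoomInv e a ψinv (x j)) : ℝ)) := fun x =>
    Finset.prod_nonneg fun j _ => Real.exp_nonneg _
  rw [ofReal_integral_eq_lintegral_ofReal (integrable_of_nonneg_of_le hm (R := 1) fun x => ?_)
    (ae_of_all _ h0), laplace]
  · refine lintegral_congr fun x => ?_
    rw [zoomedProcess, lintegral_finsetSum_measure, expNeg_sum,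
      ENNReal.ofReal_prod_of_nonneg fun j _ => Real.exp_nonneg _]
    refine Finset.prod_congr rfl fun j _ => ?_
    rw [lintegral_dirac' _ hf.coe_nnreal_ennreal, expNeg_coe]
  · rw [abs_of_nonneg (h0 x)]
    exact Finset.prod_le_one (fun j _ => Real.exp_nonneg _) fun j _ =>
      Real.exp_le_one_iff.2 (neg_nonpos.2 (NNReal.coe_nonneg _))

theorem lintegral_one_sub_expNeg_withDensity {w : EuclideanSpace ℝ (Fin n) → ℝ}
    (hw : Continuous w) {f : EuclideanSpace ℝ (Fin n) → ℝ≥0} (hf : Continuous f)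
    (hfc : HasCompactSupport f) :
    expNeg (∫⁻ x, (1 - expNeg (f x : ℝ≥0∞))
      ∂(volume.withDensity fun x => ENNReal.ofReal (Real.exp (w x)))) =
      ENNReal.ofReal (Real.exp (-∫ x, Real.exp (w x) * oneSubExp f x)) := by
  have hm : Measurable fun x => 1 - expNeg (f x : ℝ≥0∞) :=
    measurable_const.sub (measurable_expNeg.comp hf.measurable.coe_nnreal_ennreal)
  have hwm : Measurable fun x => ENNReal.ofReal (Real.exp (w x)) :=
    (Real.measurable_exp.comp hw.measurable).ennreal_ofReal
  have h0 : ∀ x, 0 ≤ Real.exp (w x) * oneSubExp f x := fun x =>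
    mul_nonneg (Real.exp_nonneg _) (oneSubExp_nonneg f x)
  have hc : Continuous fun x => Real.exp (w x) * oneSubExp f x :=
    (Real.continuous_exp.comp hw).mul (continuous_oneSubExp hf)
  have hi : Integrable fun x => Real.exp (w x) * oneSubExp f x :=
    hc.integrable_of_hasCompactSupport ((hasCompactSupport_oneSubExp hfc).mul_left)
  rw [← expNeg_ofReal (integral_nonneg h0), ofReal_integral_eq_lintegral_ofReal hi (ae_of_all _ h0),
    lintegral_withDensity_eq_lintegral_mul _ hwm hm]
  congr 1
  refine lintegral_congr fun x => ?_
  rw [ENNReal.ofReal_mul (Real.exp_nonneg _), ofReal_oneSubExp]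
  rfl

theorem withDensity_lt_top_of_isCompact {w : EuclideanSpace ℝ (Fin n) → ℝ} (hw : Continuous w)
    {K : Set (EuclideanSpace ℝ (Fin n))} (hK : IsCompact K) :
    volume.withDensity (fun x => ENNReal.ofReal (Real.exp (w x))) K < ∞ := by
  have hi : IntegrableOn (fun x => Real.exp (w x)) K :=
    (Real.continuous_exp.comp hw).continuousOn.integrableOn_compact hK
  rw [withDensity_apply _ hK.measurableSet]
  exact hi.lintegral_lt_top

end Final

end MeanFieldGas

theorem mainTheorem7 {n : ℕ} (γ : ℝ) (hγ : 0 ≤ γ)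
    -- the interaction kernel and the potential
    (g : EuclideanSpace ℝ (Fin n) → EuclideanSpace ℝ (Fin n) → ℝ≥0∞)
    (hg : IsDecayingKernel g)
    (V : EuclideanSpace ℝ (Fin n) → ℝ) (hV_nonneg : ∀ x, 0 ≤ V x) (hV_cont : Continuous V)
    (hV_C2 : ∃ K : Set (EuclideanSpace ℝ (Fin n)), IsCompact K ∧ ContDiffOn ℝ 2 V Kᶜ)
    (hV_int : Integrable (fun x => Real.exp (-V x)))
    -- the equilibrium measure
    (μ : ProbabilityMeasure (EuclideanSpace ℝ (Fin n))) (hμ : IsUniqueMinimizer γ g V μ)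
    -- the inverse temperatures
    (β : ℕ → ℝ) (hβ_pos : ∀ N, 0 < β N)
    (hβ : Tendsto (fun N : ℕ => (N : ℝ) * β N) atTop (𝓝 γ))
    -- the points around which one zooms
    (E : ℕ → EuclideanSpace ℝ (Fin n)) (hE : Tendsto (fun N => ‖E N‖) atTop atTop)
    (α : ℕ → ℝ) (υ : ℕ → EuclideanSpace ℝ (Fin n)) (υlim : EuclideanSpace ℝ (Fin n))
    (hα : ∀ᶠ N in atTop, 0 < α N) (hυ : ∀ᶠ N in atTop, ‖υ N‖ = 1)
    (hgrad : ∀ᶠ N in atTop, HasGradientAt V (α N • υ N) (E N))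
    (hc1 : Tendsto (fun N : ℕ => (N : ℝ) * Real.exp (-V (E N)) /
      (normConst γ g V (μ : Measure (EuclideanSpace ℝ (Fin n))) * α N ^ n)) atTop (𝓝 1))
    (hυlim : Tendsto υ atTop (𝓝 υlim))
    (hαE : Tendsto (fun N => α N * ‖E N‖) atTop atTop)
    -- the volume-preserving diffeomorphism and the Hessian condition
    (ψ : Diffeomorph 𝓘(ℝ, EuclideanSpace ℝ (Fin n)) 𝓘(ℝ, EuclideanSpace ℝ (Fin n))
      (EuclideanSpace ℝ (Fin n)) (EuclideanSpace ℝ (Fin n)) 1)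
    (hψ : ∀ x, |(fderiv ℝ ψ x).det| = 1)
    (hc2 : ∀ 𝒦 : Set (EuclideanSpace ℝ (Fin n)), IsCompact 𝒦 →
      Tendsto (fun N => ENNReal.ofReal ((α N ^ 2)⁻¹) *
        ⨆ x ∈ 𝒦, ‖iteratedFDeriv ℝ 2 V (zoom (E N) (α N) ψ x)‖ₑ) atTop (𝓝 0)) :
    ∃ (Ω : Type) (_ : MeasurableSpace Ω) (P : Measure Ω)
      (Ξ : Ω → Measure (EuclideanSpace ℝ (Fin n))),
      IsPoissonProcess P Ξ
        (volume.withDensity (fun x => ENNReal.ofReal (Real.exp (-⟪υlim, ψ x⟫)))) ∧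
      ConvergesInDistribution (fun N => gibbs g V (β N) N)
        (fun N => zoomedProcess (E N) (α N) ψ.symm N) P Ξ := by
  have hw : Continuous fun x => -⟪υlim, ψ x⟫ :=
    (continuous_const.inner ψ.continuous).neg
  obtain ⟨Ω, mΩ, P, Ξ, hΞ⟩ := exists_isPoissonProcess
    (volume.withDensity fun x => ENNReal.ofReal (Real.exp (-⟪υlim, ψ x⟫)))
    fun K hK => withDensity_lt_top_of_isCompact hw hK
  refine ⟨Ω, mΩ, P, Ξ, hΞ, fun f hf hfc => ?_⟩
  set L := normConst γ g V (μ : Measure (EuclideanSpace ℝ (Fin n))) with hL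
  -- If `L` were `0`, the quotient in `hc1` would be identically `0` by the convention on division,
  -- and could not tend to `1`.
  have hL0 : L ≠ 0 := fun h => by
    simp only [h, zero_mul, div_zero] at hc1
    exact zero_ne_one (tendsto_nhds_unique tendsto_const_nhds hc1)
  have hlim : Tendsto (fun N : ℕ => (N : ℝ) * Real.exp (-V (E N)) / α N ^ n) atTop (𝓝 L) := by
    have := hc1.const_mul L
    rw [mul_one] at this
    refine this.congr fun N => ?_
    rw [← div_div, mul_div_assoc', mul_div_cancel₀ _ hL0]
  have hT := tendsto_integral_zoom hV_cont hV_C2 hE hα hυ hgrad hlim hυlim hαE hψ hc2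
    (continuous_oneSubExp hf) (oneSubExp_nonneg f) (oneSubExp_le_one f)
    (hasCompactSupport_oneSubExp hfc)
  have hz : ∀ N, Continuous (zoomInv (E N) (α N) ψ.symm) := fun N =>
    ψ.symm.continuous.comp (by fun_prop : Continuous fun y => α N • (y - E N))
  have key := tendsto_integral_gibbs_prod hγ hg hV_nonneg hV_cont.measurable hV_int hμ hβ_pos hβ
    (h := fun N y => oneSubExp f (zoomInv (E N) (α N) ψ.symm y))
    (fun N => ((continuous_oneSubExp hf).comp (hz N)).measurable)
    (fun N y => oneSubExp_nonneg f _) (fun N y => oneSubExp_le_one f _)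
    (fun S hS => eventually_forall_mem_of_zoomInv_ne_zero hE hα hαE
      (hasCompactSupport_oneSubExp hfc) hS) hT
  -- The factor `L` produced by the zoom cancels the normalization of the equilibrium measure,
  -- leaving the intensity `e^{-υ·ψ}`.
  rw [← hL, inv_mul_cancel_left₀ hL0] at key
  rw [hΞ.laplace_eq f hf.measurable, lintegral_one_sub_expNeg_withDensity hw hf hfc]
  refine (ENNReal.tendsto_ofReal key).congr fun N => ?_
  have := isProbabilityMeasure_gibbs hg hV_nonneg hV_cont.measurable hV_int (β N) N
  exact (laplace_zoomedProcess _ _ _ (hz N).measurable hf.measurable).symm
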